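/- **Setting.** Let $d\in\{1,2,3\}$, let $\Omega\subset\mathbb R^d$ be a bounded connected open set with Lipschitz boundary, let $\mu>0$ and $\lambda$ be constants with $d\lambda+2\mu>0$, and let $\delta_0\in(0,\infty)$. For $\delta\in(0,\delta_0]$ put $$\Omega_I=\{y\in\mathbb R^d\setminus\Omega:\ |y-x|<2\delta\text{ for some }x\in\Omega\},\qquad \overline\Omega=\Omega\cup\Omega_I ,$$ let $\Omega_I=\Omega_{loc}\cup\Omega_{nloc}$ be a partition into disjoint measurable sets, and put $\Gamma_{loc}=\partial\Omega_{loc}\cap\partial\overline\Omega$, $\Gamma_{nloc}=\partial\Omega_{nloc}\cap\partial\overline\Omega$. Let $\gamma=\gamma_\delta:[0,\infty)\to[0,\infty)$ be measurable with $\gamma(r)>0$ for $0<r<\delta$, $\gamma(r)=0$ for $r\ge\delta$ and $\int_{\mathbb R^d}\gamma(|z|)\,dz<\infty$, and put $m(\delta)=\int_{B_\delta(0)}\gamma(|z|)|z|^2dz$. The sets $\overline\Omega,\Omega_I,\Omega_{loc},\Omega_{nloc}$, the kernel $\gamma$ and all data and solutions below may depend on $\delta$. The linear peridynamic solid (LPS)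 operator is $$\mathcal L^{LPS}u(x)=\frac{C_1}{m(\delta)}\int_{\overline\Omega}(\lambda-\mu)\gamma(|y-x|)(y-x)\big(\theta(x)+\theta(y)\big)dy+\frac{C_2}{m(\delta)}\int_{\overline\Omega}\mu\,\gamma(|y-x|)\frac{(y-x)\otimes(y-x)}{|y-x|^2}\big(u(y)-u(x)\big)dy,$$ $$\theta(x)=\frac{d}{m(\delta)}\int_{\overline\Omega}\gamma(|y-x|)(y-x)\cdot(u(y)-u(x))\,dy,\qquad C_1=d,\quad C_2=2d(d+2)$$ (so $C_1=2$, $C_2=16$ for $d=2$). The nonlocal flux $\mathcal N^{LPS}u$ is given by the same expression at points of $\Omega_I$. The energy seminorm is $$|||u|||_{LPS}^2=\frac1{m(\delta)}\int_{\overline\Omega}\int_{\overline\Omega\cap B_\delta(x)}\frac{\gamma(|y-x|)}{|y-x|^2}\big[(u(y)-u(x))\cdot(y-x)\big]^2dy\,dx ,$$ and $V^{LPS}(\overline\Omega)=\{u\in L^2(\overline\Omega)^d:|||u|||_{LPS}<\infty\}$. **Local solution.** For each $\delta\in(0,\delta_0]$ let $u_l\in C^4(\overline\Omega)$, continuous up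 to $\partial\overline\Omega$, solve $$-\nabla\cdot\big(\lambda\,\mathrm{tr}(E)I+2\mu E\big)=s\ \text{ in }\overline\Omega,\quad E=\tfrac12(\nabla u_l+\nabla u_l^T),\qquad u_l=w_l\ \text{ on }\Gamma_{loc},\qquad u_l=v_n\ \text{ on }\Gamma_{nloc}.$$ Assume that all derivatives of $u_l$ of order $0,\dots,4$ are bounded on $\overline\Omega$ by a constant independent of $\delta\in(0,\delta_0]$, and that the nonlocal data $v_n$ are compatible with $u_l$, i.e. $v_n=u_l$ almost everywhere in $\Omega_{nloc}$. **Theorem.** 1. (DtD) If for each $\delta\in(0,\delta_0]$ the function $u_n\in V^{LPS}(\overline\Omega)$ satisfies, almost everywhere, $-\mathcal L^{LPS}u_n=s$ in $\Omega$, $u_n=u_l$ in $\Omega_{loc}$ and $u_n=v_n$ in $\Omega_{nloc}$, then there is $C$ such that $|||u_n-u_l|||_{LPS}\le C\delta^2$ for all $\delta\in(0,\delta_0]$. 2. (DtN) Assume that there are $p\in\partial\Omega$ and $r>0$, independent of $\delta$, such that $B_r(p)\cap\Omega_I\subset\Omega_{nloc}$ for all $\delta\in(0,\delta_0]$. If for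 each $\delta\in(0,\delta_0]$ the function $u_n\in V^{LPS}(\overline\Omega)$ satisfies, almost everywhere, $-\mathcal L^{LPS}u_n=s$ in $\Omega$, $-\mathcal N^{LPS}u_n=-\mathcal N^{LPS}u_l$ in $\Omega_{loc}$ and $u_n=v_n$ in $\Omega_{nloc}$, then $|||u_n-u_l|||_{LPS}=\mathcal O(\delta^2)$ as $\delta\to0$, i.e. there are $C$ and $\delta_1\in(0,\delta_0]$ such that $|||u_n-u_l|||_{LPS}\le C\delta^2$ for all $\delta\in(0,\delta_1]$. -/

import Mathlib

open MeasureTheory Set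
open scoped ENNReal NNReal RealInnerProductSpace

noncomputable section

namespace LPS

/-- Euclidean space `ℝ^d`. -/
abbrev E (d : ℕ) : Type := EuclideanSpace ℝ (Fin d)

/-- `Ω` has a Lipschitz boundary: near every boundary point, after a choice of a unit direction `e`,
`Ω` is the set of points lying strictly below the graph of a Lipschitz function of the component
of `x` orthogonal to `e`. -/
def HasLipschitzBoundary {d : ℕ} (Ω : Set (E d)) : Prop :=
  ∀ p ∈ frontier Ω, ∃ r : ℝ, 0 < r ∧ ∃ e : E d, ‖e‖ = 1 ∧
    ∃ (K : ℝ≥0) (φ : E d → ℝ), LipschitzWith K φ ∧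
      ∀ x ∈ Metric.ball p r, x ∈ Ω ↔ ⟪e, x⟫ < φ (x - ⟪e, x⟫ • e)

/-- The interaction domain `Ω_I`, a layer of thickness `2δ` around `Ω`. -/
def interactionDomain {d : ℕ} (Ω : Set (E d)) (δ : ℝ) : Set (E d) :=
  {y | y ∉ Ω ∧ ∃ x ∈ Ω, ‖y - x‖ < 2 * δ}

/-- The enlarged domain `Ω ∪ Ω_I` (an open set when `Ω` is open and `δ > 0`). -/
def fullDomain {d : ℕ} (Ω : Set (E d)) (δ : ℝ) : Set (E d) :=
  Ω ∪ interactionDomain Ω δ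

/-- `Ω_I` is split into the nonoverlapping measurable parts `Ωloc` and `Ωnloc`. -/
structure IsInteractionPartition {d : ℕ} (Ω : Set (E d)) (δ : ℝ) (Ωloc Ωnloc : Set (E d)) :
    Prop where
  measurable_loc : MeasurableSet Ωloc
  measurable_nloc : MeasurableSet Ωnloc
  union_eq : Ωloc ∪ Ωnloc = interactionDomain Ω δ
  disjoint : Disjoint Ωloc Ωnloc

/-- Part of the outer boundary belonging to `A ⊆ Ω_I`: `∂A ∩ ∂(Ω ∪ Ω_I)`. -/
def outerBoundary {d : ℕ} (Ω : Set (E d)) (δ : ℝ) (A : Set (E d)) : Set (E d) :=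
  frontier A ∩ frontier (fullDomain Ω δ)

/-- Radial profile `γ` of an integrable peridynamic kernel `γ(|y - x|)` with horizon `δ`.
The value at `r = 0` is only required to be nonnegative. -/
structure IsKernel (d : ℕ) (δ : ℝ) (γ : ℝ → ℝ) : Prop where
  measurable : Measurable γ
  nonneg : ∀ r, 0 ≤ γ r
  pos : ∀ r, 0 < r → r < δ → 0 < γ r
  zero : ∀ r, δ ≤ r → γ r = 0
  integrable : Integrable (fun z : E d => γ ‖z‖)

/-- The weighted volume `m(δ) = ∫_{B_δ} γ(|z|) |z|² dz`. -/
def weightedVolume (d : ℕ) (δ : ℝ) (γ : ℝ → ℝ) : ℝ :=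
  ∫ z in Metric.ball (0 : E d) δ, γ ‖z‖ * ‖z‖ ^ 2

/-- The nonlocal dilatation `θ`; the factor is `d`, equal to `2` in the plane. -/
def dilatation {d : ℕ} (Ω : Set (E d)) (δ : ℝ) (γ : ℝ → ℝ) (u : E d → E d) (x : E d) : ℝ :=
  (d : ℝ) / weightedVolume d δ γ *
    ∫ y in fullDomain Ω δ, γ ‖y - x‖ * ⟪y - x, u y - u x⟫

/-- The linear peridynamic solid operator, with `C₁ = d` and `C₂ = 2 d (d + 2)`;
in the plane these are `C₁ = 2` and `C₂ = 16`. -/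
def lpsOperator {d : ℕ} (lam mu : ℝ) (Ω : Set (E d)) (δ : ℝ) (γ : ℝ → ℝ) (u : E d → E d)
    (x : E d) : E d :=
  ((d : ℝ) / weightedVolume d δ γ) •
      (∫ y in fullDomain Ω δ,
        ((lam - mu) * γ ‖y - x‖ * (dilatation Ω δ γ u x + dilatation Ω δ γ u y)) • (y - x)) +
    (2 * (d : ℝ) * (d + 2) / weightedVolume d δ γ) •
      (∫ y in fullDomain Ω δ,
        (mu * γ ‖y - x‖ * (⟪y - x, u y - u x⟫ / ‖y - x‖ ^ 2)) • (y - x))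

/-- The nonlocal flux operator: the same expression, to be evaluated at points of `Ω_I`. -/
def lpsFlux {d : ℕ} (lam mu : ℝ) (Ω : Set (E d)) (δ : ℝ) (γ : ℝ → ℝ) (u : E d → E d)
    (x : E d) : E d :=
  lpsOperator lam mu Ω δ γ u x

/-- The energy seminorm `|||u|||_LPS`, with values in `[0, ∞]`. -/
def lpsNorm {d : ℕ} (Ω : Set (E d)) (δ : ℝ) (γ : ℝ → ℝ) (u : E d → E d) : ℝ≥0∞ :=
  ((∫⁻ x in fullDomain Ω δ, ∫⁻ y in fullDomain Ω δ ∩ Metric.ball x δ,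
      ENNReal.ofReal (γ ‖y - x‖ / ‖y - x‖ ^ 2 * ⟪u y - u x, y - x⟫ ^ 2)) /
    ENNReal.ofReal (weightedVolume d δ γ)) ^ (1 / 2 : ℝ)

/-- Membership in the energy space `V^LPS(Ω ∪ Ω_I)`. -/
def MemEnergySpace {d : ℕ} (Ω : Set (E d)) (δ : ℝ) (γ : ℝ → ℝ) (u : E d → E d) : Prop :=
  MemLp u 2 (volume.restrict (fullDomain Ω δ)) ∧ lpsNorm Ω δ γ u < ∞

/-- The partial derivative `∂_j f (x)` of a scalar function. -/
def partialDeriv {d : ℕ} (j : Fin d) (f : E d → ℝ) (x : E d) : ℝ :=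
  fderiv ℝ f x (EuclideanSpace.single j 1)

/-- The strain tensor `(∇u + ∇uᵀ) / 2`. -/
def strain {d : ℕ} (u : E d → E d) (x : E d) : Matrix (Fin d) (Fin d) ℝ :=
  Matrix.of fun i j =>
    (1 / 2 : ℝ) * (partialDeriv j (fun y => u y i) x + partialDeriv i (fun y => u y j) x)

/-- The stress tensor `λ tr(E) I + 2 μ E`, `E` being the strain. -/
def stress {d : ℕ} (lam mu : ℝ) (u : E d → E d) (x : E d) : Matrix (Fin d) (Fin d) ℝ :=
  (lam * (strain u x).trace) • (1 : Matrix (Fin d) (Fin d) ℝ) + (2 * mu) • strain u x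

/-- The Navier operator `∇ · (λ tr(E) I + 2 μ E)`. -/
def navierOperator {d : ℕ} (lam mu : ℝ) (u : E d → E d) (x : E d) : E d :=
  WithLp.toLp 2 fun i => ∑ j, partialDeriv j (fun y => stress lam mu u y i j) x

/-- `u` is a `C⁴` classical solution, continuous up to the boundary, of the Dirichlet problem for
the Navier equation on `Ω ∪ Ω_I`, with forcing `s`, and boundary data `w` and (the boundary values
of) `v` on the outer boundary portions belonging to `Ωloc` and `Ωnloc`. -/
structure IsNavierSolution {d : ℕ} (lam mu : ℝ) (Ω : Set (E d)) (δ : ℝ) (Ωloc Ωnloc : Set (E d))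
    (s w v u : E d → E d) : Prop where
  contDiffOn : ContDiffOn ℝ 4 u (fullDomain Ω δ)
  continuousOn : ContinuousOn u (closure (fullDomain Ω δ))
  equation : ∀ x ∈ fullDomain Ω δ, -navierOperator lam mu u x = s x
  boundary_loc : ∀ x ∈ outerBoundary Ω δ Ωloc, u x = w x
  boundary_nloc : ∀ x ∈ outerBoundary Ω δ Ωnloc, u x = v x

/-- `u` solves the nonlocal problem of the Dirichlet-to-Dirichlet strategy, in which the local
solution `ul` is the volume constraint on `Ωloc`. -/
structure IsDtDSolution {d : ℕ} (lam mu : ℝ) (Ω : Set (E d)) (δ : ℝ) (γ : ℝ → ℝ)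
    (Ωloc Ωnloc : Set (E d)) (s v ul u : E d → E d) : Prop where
  mem : MemEnergySpace Ω δ γ u
  equation : ∀ᵐ x ∂(volume.restrict Ω), -lpsOperator lam mu Ω δ γ u x = s x
  constraint_loc : ∀ᵐ x ∂(volume.restrict Ωloc), u x = ul x
  constraint_nloc : ∀ᵐ x ∂(volume.restrict Ωnloc), u x = v x

/-- `u` solves the nonlocal problem of the Dirichlet-to-Neumann strategy, in which the nonlocal
flux of the local solution `ul` is the Neumann volume constraint on `Ωloc`. -/
structure IsDtNSolution {d : ℕ} (lam mu : ℝ) (Ω : Set (E d)) (δ : ℝ) (γ : ℝ → ℝ)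
    (Ωloc Ωnloc : Set (E d)) (s v ul u : E d → E d) : Prop where
  mem : MemEnergySpace Ω δ γ u
  equation : ∀ᵐ x ∂(volume.restrict Ω), -lpsOperator lam mu Ω δ γ u x = s x
  constraint_loc : ∀ᵐ x ∂(volume.restrict Ωloc),
    -lpsFlux lam mu Ω δ γ u x = -lpsFlux lam mu Ω δ γ ul x
  constraint_nloc : ∀ᵐ x ∂(volume.restrict Ωnloc), u x = v x

end LPS

end

/-! Consistency plus stability for the error `e = un - ul`, with every constant independent of the
horizon and of the kernel.

Consistency: at a point of `Ω` all bonds entering the operator, including those inside the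
dilatations of the neighbours, stay in the full domain, so central symmetry removes the odd Taylor
terms. Rotation invariance makes the second and fourth moments of the kernel isotropic tensors, and
their contractions with `D²u` are exactly those of the Navier operator. The remainder is `O(δ²)` for
any kernel, because every error estimate keeps a factor `γ ‖z‖ * ‖z‖ ^ 2` whose integral is `m(δ)`
(`IsKernel.norm_lpsOperator_sub_le`). Hence `e` has residual `O(δ²)` in `Ω`, while in the
interaction domain either `e = 0` or its flux vanishes.

Coercivity: integrating `⟪-L e, e⟫` over all pairs gives `(λ - μ) ∫ θ² + d (d + 2) μ |||e|||²`, and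
Cauchy–Schwarz gives `∫ θ² ≤ d² |||e|||²`. If `λ < μ` this leaves the factor `d (d λ + 2 μ)`, which
is where that sign condition enters (`IsKernel.coercive`).

A Poincaré inequality `∫_Ω ‖e‖² ≤ C |||e|||²` then absorbs the residual. The energy controls only
increments of `⟪e, z⟫` along `z`, but with `z` fixed these telescope along a walk `x, x + z, x + 2z,
…`. A walk of length `ℓ` has about `ℓ / ‖z‖` steps, and the square of this number turns the weight
`γ` into the energy weight `γ / ‖z‖²`. Since the directions in any cone carry a fixed share of the
second moment, letting `z` range over a cone recovers all of `e x` (`exists_transport`); no Korn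
inequality is needed.

When `e` vanishes on the whole layer, every walk out of `Ω` ends at a zero of `e`. When it vanishes
only near a boundary point `p`, the inequality holds near `p` by walking across the boundary graph.
It spreads through `Ω` by connectedness, reaches the rest of the boundary through the cones of the
Lipschitz condition, and becomes global by compactness of the closure
(`exists_poincareOn_of_vanishing`). Steps must be short compared with these geometric scales, hence
the restriction to small horizons. -/

namespace LPS

/-! ### Elementary properties of the kernel. -/

section Kernel

variable {d : ℕ} {δ : ℝ} {γ : ℝ → ℝ}

theorem IsKernel.measurable_comp_norm (K : IsKernel d δ γ) : Measurable fun z : E d => γ ‖z‖ :=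
  K.measurable.comp measurable_norm

theorem IsKernel.mul_norm_pow_le (K : IsKernel d δ γ) (n : ℕ) (z : E d) :
    γ ‖z‖ * ‖z‖ ^ n ≤ δ ^ n * γ ‖z‖ := by
  rcases lt_or_ge ‖z‖ δ with h | h
  · rw [mul_comm]
    exact mul_le_mul_of_nonneg_right (pow_le_pow_left₀ (norm_nonneg _) h.le _) (K.nonneg _)
  · simp [K.zero _ h]

theorem IsKernel.integrable_of_norm_le {G : Type*} [NormedAddCommGroup G] (K : IsKernel d δ γ)
    {f : E d → G} (hf : AEStronglyMeasurable f volume) (C : ℝ)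
    (h : ∀ z, ‖f z‖ ≤ C * γ ‖z‖) : Integrable f :=
  (K.integrable.const_mul C).mono' hf (Filter.Eventually.of_forall h)

theorem IsKernel.integrable_mul_norm_pow (K : IsKernel d δ γ) (n : ℕ) :
    Integrable fun z : E d => γ ‖z‖ * ‖z‖ ^ n := by
  refine K.integrable_of_norm_le
    (K.measurable_comp_norm.mul (measurable_norm.pow_const n)).aestronglyMeasurable (δ ^ n) fun z => ?_
  rw [Real.norm_of_nonneg (mul_nonneg (K.nonneg _) (by positivity))]
  exact K.mul_norm_pow_le n z

theorem IsKernel.weightedVolume_eq (K : IsKernel d δ γ) :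
    weightedVolume d δ γ = ∫ z : E d, γ ‖z‖ * ‖z‖ ^ 2 := by
  refine setIntegral_eq_integral_of_forall_compl_eq_zero fun z hz => ?_
  rw [Metric.mem_ball, dist_zero_right, not_lt] at hz
  simp [K.zero _ hz]

theorem IsKernel.weightedVolume_pos (K : IsKernel d δ γ) (hd : 1 ≤ d) (hδ : 0 < δ) :
    0 < weightedVolume d δ γ := by
  have : Nonempty (Fin d) := ⟨⟨0, hd⟩⟩
  rw [K.weightedVolume_eq, integral_pos_iff_support_of_nonneg
    (fun z => mul_nonneg (K.nonneg _) (by positivity)) (K.integrable_mul_norm_pow 2)]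
  have hsub : Metric.ball (0 : E d) δ \ {0} ⊆
      Function.support fun z : E d => γ ‖z‖ * ‖z‖ ^ 2 := by
    rintro z ⟨hz, hz0⟩
    rw [Metric.mem_ball, dist_zero_right] at hz
    have : 0 < ‖z‖ := norm_pos_iff.2 hz0
    exact (mul_pos (K.pos _ this hz) (by positivity)).ne'
  refine lt_of_lt_of_le ?_ (measure_mono hsub)
  -- The weight vanishes at the origin, which is a null set because `d ≥ 1`.
  rw [measure_sdiff_null (by simp)]
  exact Metric.measure_ball_pos _ _ hδ

end Kernel

/-! ### Isotropy of the second and fourth moments. -/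

section Moments

variable {d : ℕ}

theorem exists_linearIsometryEquiv_map_eq {v w : E d} (h : ‖v‖ = ‖w‖) :
    ∃ L : E d ≃ₗᵢ[ℝ] E d, L v = w :=
  ⟨_, Submodule.reflection_sub h⟩

/-- Rotation invariance: a reflection taking `‖v‖ • e` to `v` preserves Lebesgue measure and the
radial weight, so one reference direction determines all of them. -/
theorem integral_radial_mul_inner_pow (g : ℝ → ℝ) (n : ℕ) {e : E d} (he : ‖e‖ = 1) (v : E d) :
    ∫ z : E d, g ‖z‖ * ⟪z, v⟫ ^ n = ‖v‖ ^ n * ∫ z : E d, g ‖z‖ * ⟪z, e⟫ ^ n := by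
  obtain ⟨L, hL⟩ := exists_linearIsometryEquiv_map_eq (v := ‖v‖ • e) (w := v)
    (by simp [norm_smul, he])
  have h1 := L.measurePreserving.integral_comp' (f := L.toMeasurableEquiv)
    (fun z : E d => g ‖z‖ * ⟪z, v⟫ ^ n)
  rw [← h1, ← integral_const_mul]
  congr 1
  ext z
  have h2 : ⟪L z, v⟫ = ‖v‖ * ⟪z, e⟫ := by
    conv_lhs => rw [← hL]
    rw [L.inner_map_map, inner_smul_right]
  simp only [LinearIsometryEquiv.coe_toMeasurableEquiv, LinearIsometryEquiv.norm_map, h2]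
  ring

variable {δ : ℝ} {γ : ℝ → ℝ}

theorem IsKernel.integrable_mul_inner_mul_inner (K : IsKernel d δ γ) (a b : E d) :
    Integrable fun z : E d => γ ‖z‖ * (⟪z, a⟫ * ⟪z, b⟫) := by
  refine K.integrable_of_norm_le (Measurable.aestronglyMeasurable
    (K.measurable_comp_norm.mul (by fun_prop))) (δ ^ 2 * (‖a‖ * ‖b‖)) fun z => ?_
  rw [norm_mul, Real.norm_of_nonneg (K.nonneg _), norm_mul]
  calc γ ‖z‖ * (‖⟪z, a⟫‖ * ‖⟪z, b⟫‖) ≤ γ ‖z‖ * ((‖z‖ * ‖a‖) * (‖z‖ * ‖b‖)) := by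
        have := K.nonneg ‖z‖
        gcongr <;> exact norm_inner_le_norm _ _
    _ = (γ ‖z‖ * ‖z‖ ^ 2) * (‖a‖ * ‖b‖) := by ring
    _ ≤ (δ ^ 2 * γ ‖z‖) * (‖a‖ * ‖b‖) :=
        mul_le_mul_of_nonneg_right (K.mul_norm_pow_le 2 z) (by positivity)
    _ = _ := by ring

theorem norm_sq_eq_sum_inner_single_sq (z : E d) :
    ‖z‖ ^ 2 = ∑ i, ⟪z, EuclideanSpace.single i (1 : ℝ)⟫ ^ 2 := by
  simp [EuclideanSpace.norm_sq_eq, EuclideanSpace.inner_single_right]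

/-- The diagonal case is a multiple of `‖v‖ ^ 2` by rotation invariance. Polarization gives the
bilinear form, and summing over an orthonormal basis identifies the multiple as `m / d`. -/
theorem IsKernel.second_moment (K : IsKernel d δ γ) (a b : E d) :
    d * ∫ z : E d, γ ‖z‖ * (⟪z, a⟫ * ⟪z, b⟫) = weightedVolume d δ γ * ⟪a, b⟫ := by
  rcases Nat.eq_zero_or_pos d with rfl | hd
  · simp [Subsingleton.elim a 0]
  let e : E d := EuclideanSpace.single ⟨0, hd⟩ 1
  have he : ‖e‖ = 1 := by simp [e]
  set c : ℝ := ∫ z : E d, γ ‖z‖ * ⟪z, e⟫ ^ 2 with hc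
  have hItg : ∀ v : E d, Integrable fun z : E d => γ ‖z‖ * ⟪z, v⟫ ^ 2 := fun v => by
    simpa only [pow_two] using K.integrable_mul_inner_mul_inner v v
  have hq : ∀ v : E d, ∫ z : E d, γ ‖z‖ * ⟪z, v⟫ ^ 2 = ‖v‖ ^ 2 * c := fun v =>
    integral_radial_mul_inner_pow γ 2 he v
  have hm : weightedVolume d δ γ = d * c := by
    rw [K.weightedVolume_eq]
    simp_rw [norm_sq_eq_sum_inner_single_sq, Finset.mul_sum]
    rw [integral_finsetSum _ fun i _ => by
      simpa using hItg (EuclideanSpace.single i (1 : ℝ))]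
    simp_rw [hq]
    simp
  have hab : ∫ z : E d, γ ‖z‖ * (⟪z, a⟫ * ⟪z, b⟫) = ⟪a, b⟫ * c := by
    have : (fun z : E d => γ ‖z‖ * (⟪z, a⟫ * ⟪z, b⟫)) = fun z =>
        (1 / 4 : ℝ) * (γ ‖z‖ * ⟪z, a + b⟫ ^ 2 - γ ‖z‖ * ⟪z, a - b⟫ ^ 2) := by
      ext z
      rw [inner_add_right, inner_sub_right]
      ring
    rw [this, integral_const_mul, integral_sub (hItg _) (hItg _), hq, hq, norm_add_sq_real,
      norm_sub_sq_real]
    ring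
  rw [hab, hm]
  ring

theorem IsKernel.integrable_div_mul_inner_pow_four (K : IsKernel d δ γ) (v : E d) :
    Integrable fun z : E d => γ ‖z‖ / ‖z‖ ^ 2 * ⟪z, v⟫ ^ 4 := by
  refine K.integrable_of_norm_le (Measurable.aestronglyMeasurable
    ((K.measurable_comp_norm.div (by fun_prop)).mul (by fun_prop))) (δ ^ 2 * ‖v‖ ^ 4) fun z => ?_
  rw [norm_mul, Real.norm_of_nonneg (div_nonneg (K.nonneg _) (by positivity)), norm_pow]
  have := K.nonneg ‖z‖
  calc γ ‖z‖ / ‖z‖ ^ 2 * ‖⟪z, v⟫‖ ^ 4 ≤ γ ‖z‖ / ‖z‖ ^ 2 * (‖z‖ * ‖v‖) ^ 4 := by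
        gcongr
        exact norm_inner_le_norm _ _
    _ = (γ ‖z‖ * ‖z‖ ^ 2) * ‖v‖ ^ 4 := by
        rcases eq_or_ne ‖z‖ 0 with h | h
        · simp [h]
        · field_simp
    _ ≤ (δ ^ 2 * γ ‖z‖) * ‖v‖ ^ 4 :=
        mul_le_mul_of_nonneg_right (K.mul_norm_pow_le 2 z) (by positivity)
    _ = _ := by ring

/-- As for the second moment: the quartic form is `k ‖v‖ ^ 4`, its polarization is the symmetric
isotropic 4-tensor, and a double trace identifies `k`. -/
theorem IsKernel.fourth_moment (K : IsKernel d δ γ) (a b c e : E d) :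
    d * (d + 2) * ∫ z : E d, γ ‖z‖ / ‖z‖ ^ 2 * (⟪z, a⟫ * ⟪z, b⟫ * ⟪z, c⟫ * ⟪z, e⟫) =
      weightedVolume d δ γ * (⟪a, b⟫ * ⟪c, e⟫ + ⟪a, c⟫ * ⟪b, e⟫ + ⟪a, e⟫ * ⟪b, c⟫) := by
  rcases Nat.eq_zero_or_pos d with rfl | hd
  · simp [Subsingleton.elim a 0]
  let e₀ : E d := EuclideanSpace.single ⟨0, hd⟩ 1
  have he : ‖e₀‖ = 1 := by simp [e₀]
  set k : ℝ := ∫ z : E d, γ ‖z‖ / ‖z‖ ^ 2 * ⟪z, e₀⟫ ^ 4 with hk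
  have hItg := K.integrable_div_mul_inner_pow_four
  have hq : ∀ v : E d, ∫ z : E d, γ ‖z‖ / ‖z‖ ^ 2 * ⟪z, v⟫ ^ 4 = ‖v‖ ^ 4 * k := fun v =>
    integral_radial_mul_inner_pow (fun r => γ r / r ^ 2) 4 he v
  -- Polarization of a quartic form over the eight relative signs; `192 = 8 * 4!`.
  have hpol : ∀ a b c e : E d,
      (fun z : E d => γ ‖z‖ / ‖z‖ ^ 2 * (⟪z, a⟫ * ⟪z, b⟫ * ⟪z, c⟫ * ⟪z, e⟫)) = fun z =>
        (1 / 192 : ℝ) * (γ ‖z‖ / ‖z‖ ^ 2 * ⟪z, a + b + c + e⟫ ^ 4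
          - γ ‖z‖ / ‖z‖ ^ 2 * ⟪z, a + b + c - e⟫ ^ 4
          - γ ‖z‖ / ‖z‖ ^ 2 * ⟪z, a + b - c + e⟫ ^ 4
          + γ ‖z‖ / ‖z‖ ^ 2 * ⟪z, a + b - c - e⟫ ^ 4
          - γ ‖z‖ / ‖z‖ ^ 2 * ⟪z, a - b + c + e⟫ ^ 4
          + γ ‖z‖ / ‖z‖ ^ 2 * ⟪z, a - b + c - e⟫ ^ 4
          + γ ‖z‖ / ‖z‖ ^ 2 * ⟪z, a - b - c + e⟫ ^ 4
          - γ ‖z‖ / ‖z‖ ^ 2 * ⟪z, a - b - c - e⟫ ^ 4) := by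
    intro a b c e
    ext z
    simp only [inner_add_right, inner_sub_right]
    ring
  have hF : ∀ a b c e : E d,
      (Integrable fun z : E d => γ ‖z‖ / ‖z‖ ^ 2 * (⟪z, a⟫ * ⟪z, b⟫ * ⟪z, c⟫ * ⟪z, e⟫)) ∧
      ∫ z : E d, γ ‖z‖ / ‖z‖ ^ 2 * (⟪z, a⟫ * ⟪z, b⟫ * ⟪z, c⟫ * ⟪z, e⟫) =
      k / 3 * (⟪a, b⟫ * ⟪c, e⟫ + ⟪a, c⟫ * ⟪b, e⟫ + ⟪a, e⟫ * ⟪b, c⟫) := by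
    intro a b c e
    have hn : ∀ v : E d, ‖v‖ ^ 4 = ⟪v, v⟫ ^ 2 := fun v => by
      rw [real_inner_self_eq_norm_sq]; ring
    rw [hpol]
    refine ⟨((((((((hItg _).sub (hItg _)).sub (hItg _)).add (hItg _)).sub (hItg _)).add
      (hItg _)).add (hItg _)).sub (hItg _)).const_mul _, ?_⟩
    rw [integral_const_mul, integral_sub (by fun_prop) (hItg _), integral_add (by fun_prop)
      (hItg _), integral_add (by fun_prop) (hItg _), integral_sub (by fun_prop) (hItg _),
      integral_add (by fun_prop) (hItg _), integral_sub (by fun_prop) (hItg _),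
      integral_sub (hItg _) (hItg _)]
    rw [hq, hq, hq, hq, hq, hq, hq, hq]
    simp only [hn, inner_add_left, inner_sub_left, inner_add_right, inner_sub_right,
      real_inner_comm a b, real_inner_comm a c, real_inner_comm a e, real_inner_comm b c,
      real_inner_comm b e, real_inner_comm c e]
    ring
  -- Double trace: `∑ i j, (1 + 2 * δ_ij) = d ^ 2 + 2 * d`.
  have hm : weightedVolume d δ γ = k / 3 * (d * (d + 2)) := by
    have h1 : ∀ z : E d, γ ‖z‖ * ‖z‖ ^ 2 = ∑ i : Fin d, ∑ j : Fin d, γ ‖z‖ / ‖z‖ ^ 2 *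
        (⟪z, EuclideanSpace.single i (1 : ℝ)⟫ * ⟪z, EuclideanSpace.single i (1 : ℝ)⟫ *
          ⟪z, EuclideanSpace.single j (1 : ℝ)⟫ * ⟪z, EuclideanSpace.single j (1 : ℝ)⟫) := by
      intro z
      have h2 : γ ‖z‖ * ‖z‖ ^ 2 = γ ‖z‖ / ‖z‖ ^ 2 * (‖z‖ ^ 2 * ‖z‖ ^ 2) := by
        rcases eq_or_ne ‖z‖ 0 with h | h
        · simp [h]
        · field_simp
      rw [h2]
      conv_lhs => rw [norm_sq_eq_sum_inner_single_sq z]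
      rw [Finset.sum_mul_sum, ← norm_sq_eq_sum_inner_single_sq z, Finset.mul_sum]
      refine Finset.sum_congr rfl fun i _ => ?_
      rw [Finset.mul_sum]
      refine Finset.sum_congr rfl fun j _ => ?_
      ring
    rw [K.weightedVolume_eq]
    simp_rw [h1]
    rw [integral_finsetSum _ fun i _ => integrable_finsetSum _ fun j _ => (hF _ _ _ _).1]
    simp_rw [integral_finsetSum _ fun j _ => (hF _ _ _ _).1, (hF _ _ _ _).2]
    have h3 : ∀ i j : Fin d, ⟪(EuclideanSpace.single i (1 : ℝ) : E d),
        EuclideanSpace.single j (1 : ℝ)⟫ = if i = j then 1 else 0 := fun i j => by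
      simp [EuclideanSpace.inner_single_right, eq_comm]
    simp only [h3, ← Finset.mul_sum]
    congr 1
    simp [Finset.sum_add_distrib]
    ring
  rw [(hF a b c e).2, hm]
  ring

end Moments

/-! ### Share of the second moment carried by a cone. -/

section Cone

variable {d : ℕ}

/-- The closed cone of aperture `η` around the direction `e`. -/
def cone (e : E d) (η : ℝ) : Set (E d) := {z | ‖z - ‖z‖ • e‖ ≤ η * ‖z‖}

theorem measurableSet_cone (e : E d) (η : ℝ) : MeasurableSet (cone e η) :=
  measurableSet_le (by fun_prop) (by fun_prop)

theorem exists_finset_cone_cover (η : ℝ) (hη : 0 < η) :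
    ∃ t : Finset (E d), (∀ e ∈ t, ‖e‖ = 1) ∧ ∀ z : E d, z ≠ 0 → ∃ e ∈ t, z ∈ cone e η := by
  obtain ⟨t, ht, hfin, hcov⟩ := (isCompact_sphere (0 : E d) 1).finite_cover_balls hη
  refine ⟨hfin.toFinset, fun e he => by simpa using ht (hfin.mem_toFinset.1 he), fun z hz => ?_⟩
  have hz' : 0 < ‖z‖ := norm_pos_iff.2 hz
  have h1 : ‖z‖⁻¹ • z ∈ Metric.sphere (0 : E d) 1 := by
    simp [norm_smul, hz'.ne']
  obtain ⟨e, he, hze⟩ := mem_iUnion₂.1 (hcov h1)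
  refine ⟨e, hfin.mem_toFinset.2 he, ?_⟩
  rw [Metric.mem_ball, dist_eq_norm] at hze
  have h2 : z - ‖z‖ • e = ‖z‖ • (‖z‖⁻¹ • z - e) := by
    rw [smul_sub, smul_smul, mul_inv_cancel₀ hz'.ne', one_smul]
  change ‖z - ‖z‖ • e‖ ≤ η * ‖z‖
  rw [h2, norm_smul, norm_norm, mul_comm]
  exact mul_le_mul_of_nonneg_right hze.le hz'.le

theorem setIntegral_cone_radial (g : ℝ → ℝ) (η : ℝ) {e f : E d} (he : ‖e‖ = 1) (hf : ‖f‖ = 1) :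
    ∫ z in cone e η, g ‖z‖ = ∫ z in cone f η, g ‖z‖ := by
  obtain ⟨L, hL⟩ := exists_linearIsometryEquiv_map_eq (he.trans hf.symm)
  have hpre : L ⁻¹' cone f η = cone e η := by
    ext z
    simp only [cone, mem_preimage, mem_ofPred_eq, L.norm_map, ← hL, ← L.map_smul, ← L.map_sub]
  have h := L.measurePreserving.setIntegral_preimage_emb
    (L.toMeasurableEquiv.measurableEmbedding) (fun z => g ‖z‖) (cone f η)
  rw [← h, hpre]
  simp

variable {δ : ℝ} {γ : ℝ → ℝ}

/-- Finitely many congruent cones cover the space, and a radial weight gives them all the same mass,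
so each one has at least the total divided by their number. That number depends only on `d` and `η`.
-/
theorem exists_weightedVolume_le_setIntegral_cone (η : ℝ) (hη : 0 < η) :
    ∃ κ : ℝ, 0 < κ ∧ ∀ (δ : ℝ) (γ : ℝ → ℝ), IsKernel d δ γ → ∀ e : E d, ‖e‖ = 1 →
      κ * weightedVolume d δ γ ≤ ∫ z in cone e η, γ ‖z‖ * ‖z‖ ^ 2 := by
  obtain ⟨t, ht, hcov⟩ := exists_finset_cone_cover (d := d) η hη
  refine ⟨((t.card : ℝ) + 1)⁻¹, by positivity, fun δ γ K e he => ?_⟩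
  have hItg := K.integrable_mul_norm_pow 2
  have hnn : ∀ z : E d, 0 ≤ γ ‖z‖ * ‖z‖ ^ 2 := fun z => mul_nonneg (K.nonneg _) (by positivity)
  have hI : 0 ≤ ∫ z in cone e η, γ ‖z‖ * ‖z‖ ^ 2 := integral_nonneg hnn
  have hsum : weightedVolume d δ γ ≤ ∑ f ∈ t, ∫ z in cone f η, γ ‖z‖ * ‖z‖ ^ 2 := by
    rw [K.weightedVolume_eq]
    simp_rw [← integral_indicator (measurableSet_cone _ _)]
    rw [← integral_finsetSum _ fun f _ => hItg.indicator (measurableSet_cone _ _)]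
    refine integral_mono hItg
      (integrable_finsetSum _ fun f _ => hItg.indicator (measurableSet_cone _ _)) fun z => ?_
    rcases eq_or_ne z 0 with rfl | hz
    · simpa using Finset.sum_nonneg fun f _ => indicator_nonneg (fun z _ => hnn z) _
    · obtain ⟨f, hf, hzf⟩ := hcov z hz
      refine le_trans ?_ (Finset.single_le_sum (fun f _ => indicator_nonneg (fun z _ => hnn z) z) hf)
      simp [indicator_of_mem hzf]
  have heq : ∑ f ∈ t, ∫ z in cone f η, γ ‖z‖ * ‖z‖ ^ 2 =
      t.card * ∫ z in cone e η, γ ‖z‖ * ‖z‖ ^ 2 := by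
    rw [Finset.sum_congr rfl fun f hf =>
      setIntegral_cone_radial (fun r => γ r * r ^ 2) η (ht f hf) he]
    simp
  rw [heq] at hsum
  rw [inv_mul_le_iff₀ (by positivity)]
  linarith

/-- A cone carries a fixed share of the second moment of any kernel, in every direction `v`. -/
theorem exists_le_setIntegral_cone_inner_sq {e : E d} (he : ‖e‖ = 1) {η : ℝ} (hη : 0 < η)
    (hη1 : η ≤ 1) :
    ∃ κ : ℝ, 0 < κ ∧ ∀ (δ : ℝ) (γ : ℝ → ℝ), IsKernel d δ γ → ∀ v : E d,
      κ * weightedVolume d δ γ * ‖v‖ ^ 2 ≤ ∫ z in cone e η, γ ‖z‖ * ⟪v, z⟫ ^ 2 := by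
  obtain ⟨κ, hκ, h⟩ := exists_weightedVolume_le_setIntegral_cone (d := d) (η / 16) (by positivity)
  refine ⟨(η / 16) ^ 2 * κ, by positivity, fun δ γ K v => ?_⟩
  have hnn : ∀ z : E d, 0 ≤ γ ‖z‖ * ⟪v, z⟫ ^ 2 := fun z => mul_nonneg (K.nonneg _) (by positivity)
  rcases eq_or_ne v 0 with rfl | hv
  · simp
  have hv' : 0 < ‖v‖ := norm_pos_iff.2 hv
  -- The axis `e` may be orthogonal to `v`. Tilting it by `η / 4` along `±v`, with the sign of `⟪v,
  -- e⟫`, makes the inner product with `v` at least `η / 4 * ‖v‖` in size. After normalization, a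
  -- cone of aperture `η / 16` around the tilted axis still lies in the given cone and stays away
  -- from the orthogonal complement of `v`.
  have hex : ∃ σ : ℝ, |σ| = 1 ∧ η / 4 * ‖v‖ ≤ |⟪v, e + (σ * η / (4 * ‖v‖)) • v⟫| := by
    have h1 : ∀ σ : ℝ, ⟪v, e + (σ * η / (4 * ‖v‖)) • v⟫ = ⟪v, e⟫ + σ * (η / 4 * ‖v‖) := by
      intro σ
      rw [inner_add_right, inner_smul_right, real_inner_self_eq_norm_sq]
      field_simp
    simp_rw [h1]
    have h2 : 0 ≤ η / 4 * ‖v‖ := by positivity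
    rcases le_total 0 ⟪v, e⟫ with h3 | h3
    · refine ⟨1, by simp, ?_⟩
      rw [abs_of_nonneg (by linarith)]
      linarith
    · refine ⟨-1, by simp, ?_⟩
      rw [abs_of_nonpos (by linarith)]
      linarith
  obtain ⟨σ, hσ, hin⟩ := hex
  set a : E d := e + (σ * η / (4 * ‖v‖)) • v with ha
  have hae : ‖a - e‖ = η / 4 := by
    rw [ha, add_sub_cancel_left, norm_smul, Real.norm_eq_abs, abs_div, abs_mul, hσ,
      abs_of_pos hη, abs_of_pos (by positivity : 0 < 4 * ‖v‖)]
    field_simp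
  have hna : |‖a‖ - 1| ≤ η / 4 := by
    rw [← he, ← hae]
    exact abs_norm_sub_norm_le _ _
  rw [abs_le] at hna
  have ha0 : 0 < ‖a‖ := by linarith
  set f : E d := ‖a‖⁻¹ • a with hf
  have hfn : ‖f‖ = 1 := by simp [hf, norm_smul, ha0.ne']
  have hfa : ‖f - a‖ ≤ η / 4 := by
    have : f - a = (‖a‖⁻¹ - 1) • a := by rw [hf, sub_smul, one_smul]
    rw [this, norm_smul, Real.norm_eq_abs]
    have h2 : |‖a‖⁻¹ - 1| * ‖a‖ = |1 - ‖a‖| := by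
      conv_lhs => rw [← abs_of_pos ha0, ← abs_mul, abs_of_pos ha0]
      rw [sub_mul, inv_mul_cancel₀ ha0.ne', one_mul]
    rw [h2, abs_le]
    constructor <;> linarith
  have hfe : ‖f - e‖ ≤ η / 2 := by
    calc ‖f - e‖ = ‖(f - a) + (a - e)‖ := by congr 1; abel
      _ ≤ ‖f - a‖ + ‖a - e‖ := norm_add_le _ _
      _ ≤ η / 2 := by linarith
  have hvf : η / 8 * ‖v‖ ≤ |⟪v, f⟫| := by
    rw [hf, inner_smul_right, abs_mul, abs_of_pos (inv_pos.2 ha0)]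
    rw [le_inv_mul_iff₀ ha0]
    refine le_trans ?_ hin
    have : ‖a‖ ≤ 2 := by linarith
    have h3 : 0 ≤ η / 8 * ‖v‖ := by positivity
    nlinarith
  have hsub : cone f (η / 16) ⊆ cone e η := by
    intro z hz
    change ‖z - ‖z‖ • e‖ ≤ η * ‖z‖
    have hz' : ‖z - ‖z‖ • f‖ ≤ η / 16 * ‖z‖ := hz
    calc ‖z - ‖z‖ • e‖ = ‖(z - ‖z‖ • f) + ‖z‖ • (f - e)‖ := by rw [smul_sub]; congr 1; abel
      _ ≤ ‖z - ‖z‖ • f‖ + ‖z‖ * ‖f - e‖ := by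
        refine (norm_add_le _ _).trans ?_
        rw [norm_smul, norm_norm]
      _ ≤ η / 16 * ‖z‖ + ‖z‖ * (η / 2) := by gcongr
      _ ≤ η * ‖z‖ := by nlinarith [norm_nonneg z]
  have hlow : ∀ z ∈ cone f (η / 16),
      (η / 16) ^ 2 * ‖v‖ ^ 2 * (γ ‖z‖ * ‖z‖ ^ 2) ≤ γ ‖z‖ * ⟪v, z⟫ ^ 2 := by
    intro z hz
    have hz' : ‖z - ‖z‖ • f‖ ≤ η / 16 * ‖z‖ := hz
    have h1 : ⟪v, z⟫ = ⟪v, z - ‖z‖ • f⟫ + ‖z‖ * ⟪v, f⟫ := by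
      rw [inner_sub_right, inner_smul_right]; ring
    have h2 : |⟪v, z - ‖z‖ • f⟫| ≤ ‖v‖ * (η / 16 * ‖z‖) :=
      (abs_real_inner_le_norm _ _).trans (by gcongr)
    have h3 : ‖z‖ * (η / 8 * ‖v‖) ≤ |‖z‖ * ⟪v, f⟫| := by
      rw [abs_mul, abs_norm]; gcongr
    have h4 : η / 16 * ‖v‖ * ‖z‖ ≤ |⟪v, z⟫| := by
      have h5 : |‖z‖ * ⟪v, f⟫| ≤ |⟪v, z⟫| + |⟪v, z - ‖z‖ • f⟫| := by
        have : ‖z‖ * ⟪v, f⟫ = ⟪v, z⟫ - ⟪v, z - ‖z‖ • f⟫ := by rw [h1]; ring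
        rw [this]
        exact abs_sub _ _
      nlinarith
    have h6 : (η / 16 * ‖v‖ * ‖z‖) ^ 2 ≤ ⟪v, z⟫ ^ 2 := by
      rw [← sq_abs ⟪v, z⟫]
      exact pow_le_pow_left₀ (by positivity) h4 2
    calc (η / 16) ^ 2 * ‖v‖ ^ 2 * (γ ‖z‖ * ‖z‖ ^ 2) = γ ‖z‖ * (η / 16 * ‖v‖ * ‖z‖) ^ 2 := by ring
      _ ≤ _ := mul_le_mul_of_nonneg_left h6 (K.nonneg _)
  have hItg : Integrable fun z : E d => γ ‖z‖ * ⟪v, z⟫ ^ 2 := by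
    refine (K.integrable_mul_inner_mul_inner v v).congr (Filter.Eventually.of_forall fun z => ?_)
    simp only [real_inner_comm z v, pow_two]
  calc (η / 16) ^ 2 * κ * weightedVolume d δ γ * ‖v‖ ^ 2
      = (η / 16) ^ 2 * ‖v‖ ^ 2 * (κ * weightedVolume d δ γ) := by ring
    _ ≤ (η / 16) ^ 2 * ‖v‖ ^ 2 * ∫ z in cone f (η / 16), γ ‖z‖ * ‖z‖ ^ 2 := by
        gcongr
        exact h δ γ K f hfn
    _ = ∫ z in cone f (η / 16), (η / 16) ^ 2 * ‖v‖ ^ 2 * (γ ‖z‖ * ‖z‖ ^ 2) :=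
        (integral_const_mul _ _).symm
    _ ≤ ∫ z in cone f (η / 16), γ ‖z‖ * ⟪v, z⟫ ^ 2 :=
        setIntegral_mono_on ((K.integrable_mul_norm_pow 2).const_mul _).integrableOn
          hItg.integrableOn (measurableSet_cone _ _) hlow
    _ ≤ ∫ z in cone e η, γ ‖z‖ * ⟪v, z⟫ ^ 2 :=
        setIntegral_mono_set hItg.integrableOn (Filter.Eventually.of_forall hnn)
          hsub.eventuallyLE

end Cone

end LPS

noncomputable section

namespace LPS

/-! ### The energy as an integral over shifts. -/

section Energy

variable {d : ℕ}

/-- The unnormalized squared energy of `e` over all pairs of points of `D`. -/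
def pairEnergy (D : Set (E d)) (γ : ℝ → ℝ) (e : E d → E d) : ℝ≥0∞ :=
  ∫⁻ x in D, ∫⁻ y in D, ENNReal.ofReal (γ ‖y - x‖ / ‖y - x‖ ^ 2 * ⟪e y - e x, y - x⟫ ^ 2)

/-- The squared increment of `e` over the shift `z` at the point `x`, for `x` and `x + z` in `D`. -/
def shiftIncrement (D : Set (E d)) (e : E d → E d) (z x : E d) : ℝ≥0∞ :=
  indicator {x | x ∈ D ∧ x + z ∈ D} (fun x => ENNReal.ofReal (⟪e (x + z) - e x, z⟫ ^ 2)) x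

theorem IsKernel.lpsNorm_eq {δ : ℝ} {γ : ℝ → ℝ} (K : IsKernel d δ γ) (Ω : Set (E d))
    (u : E d → E d) : lpsNorm Ω δ γ u =
      (pairEnergy (fullDomain Ω δ) γ u / ENNReal.ofReal (weightedVolume d δ γ)) ^ (1 / 2 : ℝ) := by
  unfold lpsNorm pairEnergy
  congr 3
  ext x
  rw [inter_comm, ← Measure.restrict_restrict measurableSet_ball,
    ← lintegral_indicator measurableSet_ball]
  congr 1
  ext y
  by_cases hy : y ∈ Metric.ball x δ
  · rw [indicator_of_mem hy]
  · rw [indicator_of_notMem hy]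
    rw [Metric.mem_ball, dist_eq_norm, not_lt] at hy
    simp [K.zero _ hy]

theorem measurable_shiftIncrement {D : Set (E d)} (hD : MeasurableSet D) {e : E d → E d}
    (he : Measurable e) : Measurable fun p : E d × E d => shiftIncrement D e p.1 p.2 := by
  have hset : MeasurableSet {p : E d × E d | p.2 ∈ D ∧ p.2 + p.1 ∈ D} :=
    (measurable_snd hD).inter ((measurable_snd.add measurable_fst) hD)
  have hf : Measurable fun p : E d × E d =>
      ENNReal.ofReal (⟪e (p.2 + p.1) - e p.2, p.1⟫ ^ 2) := by fun_prop
  convert hf.indicator hset using 2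
  simp only [shiftIncrement, indicator, mem_ofPred_eq]

/-- Substitute `y = x + z` and exchange the integrals, so that the step `z` can be held fixed while
the base point varies. -/
theorem pairEnergy_eq_lintegral_shift {D : Set (E d)} (hD : MeasurableSet D) {γ : ℝ → ℝ}
    (hγ : Measurable γ) (hγ0 : ∀ r, 0 ≤ γ r) {e : E d → E d} (he : Measurable e) :
    pairEnergy D γ e =
      ∫⁻ z, ENNReal.ofReal (γ ‖z‖ / ‖z‖ ^ 2) * ∫⁻ x, shiftIncrement D e z x := by
  have hm := measurable_shiftIncrement hD he
  have h1 : ∀ x, D.indicator (fun x => ∫⁻ y in D,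
      ENNReal.ofReal (γ ‖y - x‖ / ‖y - x‖ ^ 2 * ⟪e y - e x, y - x⟫ ^ 2)) x =
      ∫⁻ z, ENNReal.ofReal (γ ‖z‖ / ‖z‖ ^ 2) * shiftIncrement D e z x := by
    intro x
    by_cases hx : x ∈ D
    · rw [indicator_of_mem hx, ← lintegral_indicator hD, ← lintegral_add_left_eq_self _ x]
      congr 1
      ext z
      by_cases hz : x + z ∈ D
      · rw [indicator_of_mem hz, shiftIncrement, indicator_of_mem (by exact ⟨hx, hz⟩),
          ← ENNReal.ofReal_mul (div_nonneg (hγ0 _) (by positivity)), add_sub_cancel_left]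
      · rw [indicator_of_notMem hz, shiftIncrement, indicator_of_notMem fun h => hz h.2, mul_zero]
    · rw [indicator_of_notMem hx]
      symm
      simp only [shiftIncrement]
      simp [hx]
  unfold pairEnergy
  rw [← lintegral_indicator hD]
  simp_rw [h1]
  rw [lintegral_lintegral_swap]
  · congr 1
    ext z
    rw [lintegral_const_mul]
    exact hm.comp (measurable_const.prodMk measurable_id)
  · refine Measurable.aemeasurable ?_
    refine Measurable.mul ?_ (hm.comp measurable_swap)
    exact (by fun_prop : Measurable fun p : E d × E d =>
      ENNReal.ofReal (γ ‖p.2‖ / ‖p.2‖ ^ 2))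

end Energy

/-! ### Telescoping along walks with a fixed step. -/

section Transport

variable {d : ℕ}

/-- With `z` fixed, `⟪e (x + j • z), z⟫` telescopes and Cauchy–Schwarz costs a factor `N`. A walk
may stop early only at a zero of `e`; one ending in `B` must take exactly `N` steps, so that its end
point is a translate of `x` by a vector independent of `x`. -/
theorem inner_sq_le_of_path {D B : Set (E d)} {e : E d → E d} {z x : E d} {N : ℕ}
    (h : ∃ k ≤ N, (∀ j ≤ k, x + (j : ℝ) • z ∈ D) ∧
      (e (x + (k : ℝ) • z) = 0 ∨ (k = N ∧ x + (k : ℝ) • z ∈ B))) :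
    ENNReal.ofReal (⟪e x, z⟫ ^ 2) ≤
      ENNReal.ofReal (2 * N) * ∑ j ∈ Finset.range N, shiftIncrement D e z (x + (j : ℝ) • z) +
      ENNReal.ofReal (2 * ‖z‖ ^ 2) *
        B.indicator (fun y => ENNReal.ofReal (‖e y‖ ^ 2)) (x + (N : ℝ) • z) := by
  obtain ⟨k, hkN, hD, hend⟩ := h
  set a : ℕ → ℝ := fun j => ⟪e (x + (j : ℝ) • z), z⟫ with ha
  have hstep : ∀ j < k, shiftIncrement D e z (x + (j : ℝ) • z) =
      ENNReal.ofReal ((a (j + 1) - a j) ^ 2) := by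
    intro j hj
    have h1 : x + (j : ℝ) • z + z = x + ((j + 1 : ℕ) : ℝ) • z := by
      push_cast
      rw [add_smul, one_smul, add_assoc]
    rw [shiftIncrement, indicator_of_mem, h1, ha]
    · simp only [inner_sub_left]
    · exact ⟨hD j hj.le, by rw [h1]; exact hD _ hj⟩
  have hsum : ∑ j ∈ Finset.range k, (a (j + 1) - a j) = a k - ⟪e x, z⟫ := by
    rw [Finset.sum_range_sub]
    simp [ha]
  have hreal : ⟪e x, z⟫ ^ 2 ≤
      2 * N * (∑ j ∈ Finset.range k, (a (j + 1) - a j) ^ 2) + 2 * a k ^ 2 := by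
    have h2 := sq_sum_le_card_mul_sum_sq (s := Finset.range k) (f := fun j => a (j + 1) - a j)
    rw [hsum, Finset.card_range] at h2
    have h3 : 0 ≤ ∑ j ∈ Finset.range k, (a (j + 1) - a j) ^ 2 :=
      Finset.sum_nonneg fun _ _ => sq_nonneg _
    have h4 : (k : ℝ) ≤ N := by exact_mod_cast hkN
    have h5 := mul_le_mul_of_nonneg_right h4 h3
    nlinarith [sq_nonneg (2 * a k - ⟪e x, z⟫)]
  have hak : ENNReal.ofReal (2 * a k ^ 2) ≤ ENNReal.ofReal (2 * ‖z‖ ^ 2) *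
        B.indicator (fun y => ENNReal.ofReal (‖e y‖ ^ 2)) (x + (N : ℝ) • z) := by
    rcases hend with h0 | ⟨rfl, hB⟩
    · simp [ha, h0]
    · rw [indicator_of_mem hB, ← ENNReal.ofReal_mul (by positivity)]
      refine ENNReal.ofReal_le_ofReal ?_
      have : a k ^ 2 ≤ (‖e (x + (k : ℝ) • z)‖ * ‖z‖) ^ 2 := by
        rw [← sq_abs]
        exact pow_le_pow_left₀ (abs_nonneg _) (abs_real_inner_le_norm _ _) 2
      nlinarith
  calc ENNReal.ofReal (⟪e x, z⟫ ^ 2)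
      ≤ ENNReal.ofReal (2 * N * (∑ j ∈ Finset.range k, (a (j + 1) - a j) ^ 2) + 2 * a k ^ 2) :=
        ENNReal.ofReal_le_ofReal hreal
    _ ≤ ENNReal.ofReal (2 * N * (∑ j ∈ Finset.range k, (a (j + 1) - a j) ^ 2)) +
        ENNReal.ofReal (2 * a k ^ 2) := ENNReal.ofReal_add_le
    _ = ENNReal.ofReal (2 * N) *
          (∑ j ∈ Finset.range k, shiftIncrement D e z (x + (j : ℝ) • z)) +
        ENNReal.ofReal (2 * a k ^ 2) := by
        rw [ENNReal.ofReal_mul (by positivity), ENNReal.ofReal_sum_of_nonneg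
          fun _ _ => sq_nonneg _, Finset.sum_congr rfl fun j hj => (hstep j
            (Finset.mem_range.1 hj)).symm]
    _ ≤ _ := by
        gcongr

/-- By translation invariance each of the `N` increments integrates to the same quantity, which
raises the factor `N` to `N ^ 2`. -/
theorem lintegral_inner_sq_le_of_path {A B D : Set (E d)} (hA : MeasurableSet A)
    (hB : MeasurableSet B) (hD : MeasurableSet D) {e : E d → E d} (he : Measurable e) {z : E d}
    {N : ℕ} (h : ∀ x ∈ A, ∃ k ≤ N, (∀ j ≤ k, x + (j : ℝ) • z ∈ D) ∧
      (e (x + (k : ℝ) • z) = 0 ∨ (k = N ∧ x + (k : ℝ) • z ∈ B))) :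
    ∫⁻ x in A, ENNReal.ofReal (⟪e x, z⟫ ^ 2) ≤
      ENNReal.ofReal (2 * N ^ 2) * (∫⁻ x, shiftIncrement D e z x) +
      ENNReal.ofReal (2 * ‖z‖ ^ 2) * ∫⁻ x in B, ENNReal.ofReal (‖e x‖ ^ 2) := by
  have hm : Measurable (shiftIncrement D e z) :=
    (measurable_shiftIncrement hD he).comp (measurable_const.prodMk measurable_id)
  have hmj : ∀ j : ℕ, Measurable fun x => shiftIncrement D e z (x + (j : ℝ) • z) := fun j =>
    hm.comp (by fun_prop)
  have hmB : Measurable (B.indicator fun y => ENNReal.ofReal (‖e y‖ ^ 2)) :=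
    Measurable.indicator (by fun_prop) hB
  have hmBN : Measurable fun x =>
      B.indicator (fun y => ENNReal.ofReal (‖e y‖ ^ 2)) (x + (N : ℝ) • z) :=
    hmB.comp (by fun_prop)
  calc ∫⁻ x in A, ENNReal.ofReal (⟪e x, z⟫ ^ 2)
      ≤ ∫⁻ x in A, (ENNReal.ofReal (2 * N) *
          ∑ j ∈ Finset.range N, shiftIncrement D e z (x + (j : ℝ) • z) +
        ENNReal.ofReal (2 * ‖z‖ ^ 2) *
          B.indicator (fun y => ENNReal.ofReal (‖e y‖ ^ 2)) (x + (N : ℝ) • z)) :=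
        setLIntegral_mono' hA fun x hx => inner_sq_le_of_path (h x hx)
    _ ≤ ∫⁻ x, (ENNReal.ofReal (2 * N) *
          ∑ j ∈ Finset.range N, shiftIncrement D e z (x + (j : ℝ) • z) +
        ENNReal.ofReal (2 * ‖z‖ ^ 2) *
          B.indicator (fun y => ENNReal.ofReal (‖e y‖ ^ 2)) (x + (N : ℝ) • z)) :=
        setLIntegral_le_lintegral _ _
    _ = _ := by
        rw [lintegral_add_left (Measurable.const_mul (Finset.measurable_fun_sum _ fun j _ => hmj j) _),
          lintegral_const_mul _ (Finset.measurable_fun_sum _ fun j _ => hmj j),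
          lintegral_const_mul _ hmBN,
          lintegral_finsetSum _ fun j _ => hmj j]
        simp_rw [lintegral_add_right_eq_self (fun x => shiftIncrement D e z x)]
        rw [lintegral_add_right_eq_self (B.indicator fun y => ENNReal.ofReal (‖e y‖ ^ 2)),
          lintegral_indicator hB]
        congr 1
        rw [Finset.sum_const, Finset.card_range, nsmul_eq_mul, ← mul_assoc]
        congr 1
        rw [← ENNReal.ofReal_natCast, ← ENNReal.ofReal_mul (by positivity)]
        congr 1
        ring

/-- Transport of `L²` control along a cone of directions: if from every point of `A` one can walk
within `D`, along every short step `z` in a cone, up to a zero of `e` or, after a length about `ℓ`,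
into `B`, then `e` on `A` is controlled by its energy and by `e` on `B`. -/
theorem exists_transport {e₀ : E d} (he₀ : ‖e₀‖ = 1) {η : ℝ} (hη : 0 < η) (hη1 : η ≤ 1) :
    ∃ κ : ℝ, 0 < κ ∧ ∀ (δ : ℝ) (γ : ℝ → ℝ), IsKernel d δ γ → ∀ (ℓ : ℝ), 0 ≤ ℓ →
      ∀ (A B D : Set (E d)), MeasurableSet A → MeasurableSet B → MeasurableSet D →
      ∀ e : E d → E d, Measurable e →
      (∀ z ∈ cone e₀ η, 0 < ‖z‖ → ‖z‖ < δ → ∀ x ∈ A, ∃ k ≤ ⌊ℓ / ‖z‖⌋₊,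
        (∀ j ≤ k, x + (j : ℝ) • z ∈ D) ∧
        (e (x + (k : ℝ) • z) = 0 ∨ (k = ⌊ℓ / ‖z‖⌋₊ ∧ x + (k : ℝ) • z ∈ B))) →
      ENNReal.ofReal (κ * weightedVolume d δ γ) * ∫⁻ x in A, ENNReal.ofReal (‖e x‖ ^ 2) ≤
        ENNReal.ofReal (2 * ℓ ^ 2) * pairEnergy D γ e +
        ENNReal.ofReal (2 * weightedVolume d δ γ) * ∫⁻ x in B, ENNReal.ofReal (‖e x‖ ^ 2) := by
  obtain ⟨κ, hκ, hcone⟩ := exists_le_setIntegral_cone_inner_sq he₀ hη hη1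
  refine ⟨κ, hκ, fun δ γ K ℓ hℓ A B D hA hB hD e he hpath => ?_⟩
  have hKm := K.measurable_comp_norm
  have hm0 : 0 ≤ weightedVolume d δ γ := by
    rw [K.weightedVolume_eq]
    exact integral_nonneg fun z => mul_nonneg (K.nonneg _) (by positivity)
  -- The scaling balance: `γ * N ^ 2 ≤ ℓ ^ 2 * (γ / ‖z‖ ^ 2)` with `N = ⌊ℓ / ‖z‖⌋₊`, which is the
  -- energy weight.
  have hz : ∀ z ∈ cone e₀ η, ENNReal.ofReal (γ ‖z‖) * ∫⁻ x in A, ENNReal.ofReal (⟪e x, z⟫ ^ 2) ≤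
      ENNReal.ofReal (2 * ℓ ^ 2) *
        (ENNReal.ofReal (γ ‖z‖ / ‖z‖ ^ 2) * ∫⁻ x, shiftIncrement D e z x) +
      ENNReal.ofReal (2 * (γ ‖z‖ * ‖z‖ ^ 2)) * ∫⁻ x in B, ENNReal.ofReal (‖e x‖ ^ 2) := by
    intro z hzc
    rcases eq_or_lt_of_le (norm_nonneg z) with h0 | h0
    · have : z = 0 := norm_eq_zero.1 h0.symm
      simp [this]
    rcases le_or_gt δ ‖z‖ with h1 | h1
    · simp [K.zero _ h1]
    have hN : (⌊ℓ / ‖z‖⌋₊ : ℝ) ≤ ℓ / ‖z‖ := Nat.floor_le (by positivity)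
    calc ENNReal.ofReal (γ ‖z‖) * ∫⁻ x in A, ENNReal.ofReal (⟪e x, z⟫ ^ 2)
        ≤ ENNReal.ofReal (γ ‖z‖) *
          (ENNReal.ofReal (2 * (⌊ℓ / ‖z‖⌋₊ : ℝ) ^ 2) * (∫⁻ x, shiftIncrement D e z x) +
          ENNReal.ofReal (2 * ‖z‖ ^ 2) * ∫⁻ x in B, ENNReal.ofReal (‖e x‖ ^ 2)) := by
          gcongr
          exact lintegral_inner_sq_le_of_path hA hB hD he (hpath z hzc h0 h1)
      _ ≤ ENNReal.ofReal (γ ‖z‖) *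
          (ENNReal.ofReal (2 * (ℓ / ‖z‖) ^ 2) * (∫⁻ x, shiftIncrement D e z x) +
          ENNReal.ofReal (2 * ‖z‖ ^ 2) * ∫⁻ x in B, ENNReal.ofReal (‖e x‖ ^ 2)) := by
          gcongr
      _ = _ := by
          rw [mul_add, ← mul_assoc, ← mul_assoc, ← mul_assoc, ← ENNReal.ofReal_mul (K.nonneg _),
            ← ENNReal.ofReal_mul (K.nonneg _), ← ENNReal.ofReal_mul (by positivity)]
          congr 3
          · ring
          · ring
  have hswap : ∫⁻ x in A, ∫⁻ z in cone e₀ η, ENNReal.ofReal (γ ‖z‖) *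
      ENNReal.ofReal (⟪e x, z⟫ ^ 2) = ∫⁻ z in cone e₀ η, ENNReal.ofReal (γ ‖z‖) *
        ∫⁻ x in A, ENNReal.ofReal (⟪e x, z⟫ ^ 2) := by
    rw [lintegral_lintegral_swap]
    · congr 1
      ext z
      rw [lintegral_const_mul _ (by fun_prop)]
    · exact Measurable.aemeasurable (((hKm.comp measurable_snd).ennreal_ofReal).mul (by fun_prop))
  calc ENNReal.ofReal (κ * weightedVolume d δ γ) * ∫⁻ x in A, ENNReal.ofReal (‖e x‖ ^ 2)
      = ∫⁻ x in A, ENNReal.ofReal (κ * weightedVolume d δ γ * ‖e x‖ ^ 2) := by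
        rw [← lintegral_const_mul _ (by fun_prop)]
        congr 1
        ext x
        rw [← ENNReal.ofReal_mul (by positivity)]
    -- The cone bound with `v = e x` recovers the full vector from its components along the steps.
    _ ≤ ∫⁻ x in A, ∫⁻ z in cone e₀ η, ENNReal.ofReal (γ ‖z‖) *
          ENNReal.ofReal (⟪e x, z⟫ ^ 2) := by
        refine lintegral_mono fun x => ?_
        refine (ENNReal.ofReal_le_ofReal (hcone δ γ K (e x))).trans ?_
        rw [ofReal_integral_eq_lintegral_ofReal]
        · refine lintegral_mono fun z => ?_
          rw [ENNReal.ofReal_mul (K.nonneg _)]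
        · refine Integrable.integrableOn ((K.integrable_mul_inner_mul_inner (e x) (e x)).congr
            (Filter.Eventually.of_forall fun z => ?_))
          simp only [real_inner_comm z (e x), pow_two]
        · exact Filter.Eventually.of_forall fun z => mul_nonneg (K.nonneg _) (by positivity)
    _ ≤ ∫⁻ z in cone e₀ η, (ENNReal.ofReal (2 * ℓ ^ 2) *
        (ENNReal.ofReal (γ ‖z‖ / ‖z‖ ^ 2) * ∫⁻ x, shiftIncrement D e z x) +
      ENNReal.ofReal (2 * (γ ‖z‖ * ‖z‖ ^ 2)) * ∫⁻ x in B, ENNReal.ofReal (‖e x‖ ^ 2)) := by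
        rw [hswap]
        exact setLIntegral_mono' (measurableSet_cone _ _) hz
    _ ≤ ∫⁻ z, (ENNReal.ofReal (2 * ℓ ^ 2) *
        (ENNReal.ofReal (γ ‖z‖ / ‖z‖ ^ 2) * ∫⁻ x, shiftIncrement D e z x) +
      ENNReal.ofReal (2 * (γ ‖z‖ * ‖z‖ ^ 2)) * ∫⁻ x in B, ENNReal.ofReal (‖e x‖ ^ 2)) :=
        setLIntegral_le_lintegral _ _
    _ = _ := by
        have hms : Measurable fun z : E d =>
            ENNReal.ofReal (γ ‖z‖ / ‖z‖ ^ 2) * ∫⁻ x, shiftIncrement D e z x :=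
          ((hKm.div (by fun_prop)).ennreal_ofReal).mul
            (measurable_shiftIncrement hD he).lintegral_prod_right'
        have hmk : Measurable fun z : E d => ENNReal.ofReal (2 * (γ ‖z‖ * ‖z‖ ^ 2)) :=
          ((hKm.mul (by fun_prop)).const_mul 2).ennreal_ofReal
        rw [lintegral_add_left (hms.const_mul _), lintegral_const_mul _ hms,
          lintegral_mul_const _ hmk,
          ← pairEnergy_eq_lintegral_shift hD K.measurable K.nonneg he,
          ← ofReal_integral_eq_lintegral_ofReal ((K.integrable_mul_norm_pow 2).const_mul 2)
            (Filter.Eventually.of_forall fun z =>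
              mul_nonneg zero_le_two (mul_nonneg (K.nonneg _) (by positivity))),
          integral_const_mul, ← K.weightedVolume_eq]

end Transport

end LPS

end

/-! ### Poincaré inequalities uniform in the horizon and the kernel. -/

noncomputable section

namespace LPS

variable {d : ℕ}

theorem fullDomain_eq_thickening {Ω : Set (E d)} {δ : ℝ} (hδ : 0 < δ) :
    fullDomain Ω δ = Metric.thickening (2 * δ) Ω := by
  ext y
  simp only [fullDomain, interactionDomain, mem_union, mem_ofPred_eq, Metric.mem_thickening_iff,
    dist_eq_norm]
  constructor
  · rintro (h | h)
    · exact ⟨y, h, by simpa using hδ⟩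
    · exact h.2
  · intro h
    by_cases hy : y ∈ Ω
    · exact Or.inl hy
    · exact Or.inr ⟨hy, h⟩

theorem isOpen_fullDomain {Ω : Set (E d)} {δ : ℝ} (hδ : 0 < δ) : IsOpen (fullDomain Ω δ) := by
  rw [fullDomain_eq_thickening hδ]
  exact Metric.isOpen_thickening

/-- The Poincaré inequality on `A`, uniformly for horizons up to `δ₁` and all kernels, for fields
vanishing on `P δ`. -/
def PoincareOn (Ω : Set (E d)) (P : ℝ → Set (E d)) (δ₁ : ℝ) (A : Set (E d)) : Prop :=
  ∃ C : ℝ, 0 ≤ C ∧ ∀ δ ∈ Ioc 0 δ₁, ∀ γ : ℝ → ℝ, IsKernel d δ γ → ∀ e : E d → E d,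
    Measurable e → (∀ x ∈ P δ, e x = 0) →
    ENNReal.ofReal (weightedVolume d δ γ) * ∫⁻ x in A, ENNReal.ofReal (‖e x‖ ^ 2) ≤
      ENNReal.ofReal C * pairEnergy (fullDomain Ω δ) γ e

section PoincareOn

variable {Ω : Set (E d)} {P : ℝ → Set (E d)}

theorem PoincareOn.empty (δ₁ : ℝ) : PoincareOn Ω P δ₁ ∅ :=
  ⟨0, le_rfl, fun _ _ _ _ _ _ _ => by simp⟩

theorem PoincareOn.mono {δ₁ δ₂ : ℝ} {A B : Set (E d)} (h : PoincareOn Ω P δ₁ B) (hδ : δ₂ ≤ δ₁)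
    (hAB : A ⊆ B) : PoincareOn Ω P δ₂ A := by
  obtain ⟨C, hC, h⟩ := h
  refine ⟨C, hC, fun δ hδ' γ K e he hP => le_trans ?_ (h δ ⟨hδ'.1, hδ'.2.trans hδ⟩ γ K e he hP)⟩
  gcongr

theorem PoincareOn.union {δ₁ : ℝ} {A B : Set (E d)} (hA : PoincareOn Ω P δ₁ A)
    (hB : PoincareOn Ω P δ₁ B) : PoincareOn Ω P δ₁ (A ∪ B) := by
  obtain ⟨C, hC, hA⟩ := hA
  obtain ⟨C', hC', hB⟩ := hB
  refine ⟨C + C', by positivity, fun δ hδ γ K e he hP => ?_⟩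
  calc _ ≤ ENNReal.ofReal (weightedVolume d δ γ) * ((∫⁻ x in A, ENNReal.ofReal (‖e x‖ ^ 2)) +
        ∫⁻ x in B, ENNReal.ofReal (‖e x‖ ^ 2)) := by
        gcongr
        exact lintegral_union_le _ _ _
    _ ≤ _ := by
        rw [mul_add, ENNReal.ofReal_add hC hC', add_mul]
        exact add_le_add (hA δ hδ γ K e he hP) (hB δ hδ γ K e he hP)

/-- The inequality is carried backwards along walks from `B` to `A`. With `B = ∅` every walk must
end in the vanishing set, and this is how the first instances are obtained. -/
theorem PoincareOn.transport {A B : Set (E d)} (hA : MeasurableSet A) (hB : MeasurableSet B)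
    {δ₁ : ℝ} (h : PoincareOn Ω P δ₁ B) {e₀ : E d} (he₀ : ‖e₀‖ = 1) {η : ℝ} (hη : 0 < η)
    (hη1 : η ≤ 1) {ℓ : ℝ} (hℓ : 0 ≤ ℓ)
    (hpath : ∀ δ ∈ Ioc 0 δ₁, ∀ z ∈ cone e₀ η, 0 < ‖z‖ → ‖z‖ < δ → ∀ x ∈ A, ∃ k ≤ ⌊ℓ / ‖z‖⌋₊,
        (∀ j ≤ k, x + (j : ℝ) • z ∈ fullDomain Ω δ) ∧
        (x + (k : ℝ) • z ∈ P δ ∨ (k = ⌊ℓ / ‖z‖⌋₊ ∧ x + (k : ℝ) • z ∈ B))) :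
    PoincareOn Ω P δ₁ A := by
  obtain ⟨κ, hκ, htr⟩ := exists_transport he₀ hη hη1
  obtain ⟨C, hC, h⟩ := h
  refine ⟨κ⁻¹ * (2 * ℓ ^ 2 + 2 * C), by positivity, fun δ hδ γ K e he hP => ?_⟩
  have h1 := htr δ γ K ℓ hℓ A B (fullDomain Ω δ) hA hB (isOpen_fullDomain hδ.1).measurableSet e he
    fun z hz h0 hzδ x hx => by
      obtain ⟨k, hk, hD, hend⟩ := hpath δ hδ z hz h0 hzδ x hx
      exact ⟨k, hk, hD, hend.imp_left (hP _)⟩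
  have h2 := h δ hδ γ K e he hP
  have hκ' : ENNReal.ofReal κ⁻¹ * ENNReal.ofReal κ = 1 := by
    rw [← ENNReal.ofReal_mul (by positivity), inv_mul_cancel₀ hκ.ne', ENNReal.ofReal_one]
  rw [ENNReal.ofReal_mul hκ.le, ENNReal.ofReal_mul zero_le_two (q := weightedVolume d δ γ),
    mul_assoc (ENNReal.ofReal 2)] at h1
  calc ENNReal.ofReal (weightedVolume d δ γ) * ∫⁻ x in A, ENNReal.ofReal (‖e x‖ ^ 2)
      = ENNReal.ofReal κ⁻¹ * (ENNReal.ofReal κ * ENNReal.ofReal (weightedVolume d δ γ) *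
          ∫⁻ x in A, ENNReal.ofReal (‖e x‖ ^ 2)) := by
        rw [mul_assoc (ENNReal.ofReal κ), ← mul_assoc, hκ', one_mul]
    _ ≤ ENNReal.ofReal κ⁻¹ * (ENNReal.ofReal (2 * ℓ ^ 2) * pairEnergy (fullDomain Ω δ) γ e +
          ENNReal.ofReal 2 * (ENNReal.ofReal C * pairEnergy (fullDomain Ω δ) γ e)) := by
        gcongr
        refine h1.trans ?_
        gcongr
    _ = _ := by
        rw [ENNReal.ofReal_mul (p := κ⁻¹) (by positivity),
          ENNReal.ofReal_add (by positivity) (by positivity),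
          ENNReal.ofReal_mul zero_le_two (q := C)]
        ring

end PoincareOn

/-! ### Geometry of discrete walks. -/

section Walk

/-- A walk cannot jump over the layer: its steps are shorter than `δ`, the layer has thickness `2 *
δ`, and the first point outside `Ω` is one step away from a point of `Ω`. -/
theorem exists_first_exit {Ω : Set (E d)} {δ : ℝ} {x z : E d} (hx : x ∈ Ω) (hz0 : 0 < ‖z‖)
    (hz : ‖z‖ < δ) {N : ℕ} (hN : x + (N : ℝ) • z ∉ Ω) :
    ∃ k ≤ N, (∀ j ≤ k, x + (j : ℝ) • z ∈ fullDomain Ω δ) ∧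
      x + (k : ℝ) • z ∈ interactionDomain Ω δ := by
  classical
  have hex : ∃ k : ℕ, x + (k : ℝ) • z ∉ Ω := ⟨N, hN⟩
  have hin : ∀ j < Nat.find hex, x + (j : ℝ) • z ∈ Ω := fun j hj => by
    simpa using Nat.find_min hex hj
  have hlast : x + (Nat.find hex : ℝ) • z ∈ interactionDomain Ω δ := by
    refine ⟨Nat.find_spec hex, ?_⟩
    have hpos : Nat.find hex ≠ 0 := fun h0 => by
      have := Nat.find_spec hex
      rw [h0] at this
      exact this (by simpa using hx)
    obtain ⟨j, hj⟩ := Nat.exists_eq_succ_of_ne_zero hpos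
    refine ⟨x + (j : ℝ) • z, hin j (by omega), ?_⟩
    have : x + (Nat.find hex : ℝ) • z - (x + (j : ℝ) • z) = z := by
      rw [hj]
      push_cast
      rw [add_smul, one_smul]
      abel
    rw [this]
    linarith
  refine ⟨Nat.find hex, Nat.find_min' hex hN, fun j hj => ?_, hlast⟩
  rcases hj.lt_or_eq with h | rfl
  · exact Or.inl (hin j h)
  · exact Or.inr hlast

theorem norm_natCast_smul_le {ℓ : ℝ} (hℓ : 0 ≤ ℓ) {z : E d} (hz : 0 < ‖z‖) {j : ℕ}
    (hj : j ≤ ⌊ℓ / ‖z‖⌋₊) : ‖(j : ℝ) • z‖ ≤ ℓ := by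
  rw [norm_smul, Real.norm_natCast, ← le_div_iff₀ hz]
  exact (Nat.le_floor_iff (by positivity)).1 hj

theorem sub_le_norm_floor_smul {ℓ : ℝ} {z : E d} (hz : 0 < ‖z‖) :
    ℓ - ‖z‖ ≤ ‖(⌊ℓ / ‖z‖⌋₊ : ℝ) • z‖ := by
  rw [norm_smul, Real.norm_natCast]
  have := Nat.lt_floor_add_one (ℓ / ‖z‖)
  rw [div_lt_iff₀ hz] at this
  linarith

theorem natCast_smul_mem_cone {e₀ : E d} {η : ℝ} {z : E d} (hz : z ∈ cone e₀ η) (j : ℕ) :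
    (j : ℝ) • z ∈ cone e₀ η := by
  have hz' : ‖z - ‖z‖ • e₀‖ ≤ η * ‖z‖ := hz
  change ‖(j : ℝ) • z - ‖(j : ℝ) • z‖ • e₀‖ ≤ η * ‖(j : ℝ) • z‖
  rw [norm_smul, Real.norm_natCast, mul_smul, ← smul_sub, norm_smul, Real.norm_natCast]
  calc (j : ℝ) * ‖z - ‖z‖ • e₀‖ ≤ j * (η * ‖z‖) := by gcongr
    _ = _ := by ring

/-- The term `η * ℓ` is the angular deviation; `‖z‖` is the length lost by rounding down to whole
steps. -/
theorem norm_floor_smul_sub_le {e₀ : E d} (he₀ : ‖e₀‖ = 1) {η ℓ : ℝ} (hη : 0 ≤ η) (hℓ : 0 ≤ ℓ)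
    {z : E d} (hzc : z ∈ cone e₀ η) (hz : 0 < ‖z‖) :
    ‖(⌊ℓ / ‖z‖⌋₊ : ℝ) • z - ℓ • e₀‖ ≤ η * ℓ + ‖z‖ := by
  set y := (⌊ℓ / ‖z‖⌋₊ : ℝ) • z with hy
  have h1 : ‖y - ‖y‖ • e₀‖ ≤ η * ‖y‖ := natCast_smul_mem_cone hzc _
  have h2 : ‖y‖ ≤ ℓ := norm_natCast_smul_le hℓ hz le_rfl
  have h3 : ℓ - ‖z‖ ≤ ‖y‖ := sub_le_norm_floor_smul hz
  calc ‖y - ℓ • e₀‖ = ‖(y - ‖y‖ • e₀) + (‖y‖ - ℓ) • e₀‖ := by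
        rw [sub_smul]; congr 1; abel
    _ ≤ η * ‖y‖ + |‖y‖ - ℓ| := by
        refine (norm_add_le _ _).trans (add_le_add h1 ?_)
        rw [norm_smul, he₀, mul_one, Real.norm_eq_abs]
    _ ≤ η * ℓ + ‖z‖ := by
        have : |‖y‖ - ℓ| ≤ ‖z‖ := by rw [abs_le]; constructor <;> linarith
        gcongr

end Walk

/-- Every sufficiently long walk leaves the bounded set `Ω`, and its first point outside is a zero
of `e`. Neither boundary regularity nor connectedness matters. -/
theorem poincareOn_of_vanishing_layer (hd : 1 ≤ d) {Ω : Set (E d)} (hΩo : IsOpen Ω)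
    (hΩb : Bornology.IsBounded Ω) (δ₀ : ℝ) (hδ₀ : 0 < δ₀) :
    PoincareOn Ω (interactionDomain Ω) δ₀ Ω := by
  obtain ⟨R, hR⟩ := hΩb.subset_ball (0 : E d)
  have he : ‖(EuclideanSpace.single ⟨0, hd⟩ 1 : E d)‖ = 1 := by simp
  -- The length is the diameter of the enclosing ball plus `δ₀`, which covers the at most one step
  -- lost in the floor.
  refine PoincareOn.transport (ℓ := 2 * |R| + δ₀) hΩo.measurableSet MeasurableSet.empty
    (PoincareOn.empty δ₀) he one_pos le_rfl (by positivity) ?_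
  intro δ hδ z _ hz0 hz x hx
  have hN : x + (⌊(2 * |R| + δ₀) / ‖z‖⌋₊ : ℝ) • z ∉ Ω := by
    intro hmem
    have h1 : ‖x‖ < |R| := by
      have := hR hx
      rw [mem_ball_zero_iff] at this
      exact this.trans_le (le_abs_self _)
    have h2 := hR hmem
    rw [mem_ball_zero_iff] at h2
    have h3 := sub_le_norm_floor_smul (ℓ := 2 * |R| + δ₀) hz0
    have h4 := norm_sub_norm_le ((⌊(2 * |R| + δ₀) / ‖z‖⌋₊ : ℝ) • z) (-x)
    rw [norm_neg, sub_neg_eq_add, add_comm _ x] at h4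
    have := le_abs_self R
    linarith [hδ.2]
  obtain ⟨k, hk, hD, hlast⟩ := exists_first_exit hx hz0 hz hN
  exact ⟨k, hk, hD, Or.inl hlast⟩

/-! ### Height above a Lipschitz graph. -/

section Graph

/-- Height of `x` above the graph of `φ` in the direction `e`. -/
def graphHeight (e : E d) (φ : E d → ℝ) (x : E d) : ℝ := ⟪e, x⟫ - φ (x - ⟪e, x⟫ • e)

theorem norm_sub_inner_smul_le {e : E d} (he : ‖e‖ = 1) (w : E d) : ‖w - ⟪e, w⟫ • e‖ ≤ ‖w‖ := by
  have h : ‖w - ⟪e, w⟫ • e‖ ^ 2 = ‖w‖ ^ 2 - ⟪e, w⟫ ^ 2 := by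
    rw [norm_sub_sq_real, inner_smul_right, norm_smul, he, real_inner_comm e w, Real.norm_eq_abs,
      mul_one, sq_abs]
    ring
  refine le_of_sq_le_sq ?_ (norm_nonneg _)
  nlinarith [sq_nonneg ⟪e, w⟫]

variable {e : E d} {K : ℝ≥0} {φ : E d → ℝ}

theorem abs_graphHeight_sub_le (he : ‖e‖ = 1) (hφ : LipschitzWith K φ) (x y : E d) :
    |graphHeight e φ x - graphHeight e φ y| ≤ (1 + K) * ‖x - y‖ := by
  have h1 : |⟪e, x⟫ - ⟪e, y⟫| ≤ ‖x - y‖ := by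
    rw [← inner_sub_right]
    simpa [he] using abs_real_inner_le_norm e (x - y)
  have h2 := hφ.dist_le_mul (x - ⟪e, x⟫ • e) (y - ⟪e, y⟫ • e)
  rw [Real.dist_eq, dist_eq_norm] at h2
  have h3 : x - ⟪e, x⟫ • e - (y - ⟪e, y⟫ • e) = (x - y) - ⟪e, x - y⟫ • e := by
    rw [inner_sub_right, sub_smul]; abel
  rw [h3] at h2
  have h4 : (K : ℝ) * ‖(x - y) - ⟪e, x - y⟫ • e‖ ≤ K * ‖x - y‖ := by
    gcongr
    exact norm_sub_inner_smul_le he _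
  unfold graphHeight
  rw [abs_le] at *
  constructor <;> linarith

/-- A step gains at least `(1 - η) * ‖z‖` along `e` and loses at most `K * η * ‖z‖` to the slope of
the graph; the aperture is chosen so that half of `‖z‖` remains. -/
theorem graphHeight_add_ge (he : ‖e‖ = 1) (hφ : LipschitzWith K φ) {η : ℝ}
    (hη : η * (1 + K) ≤ 1 / 2) {z : E d} (hz : z ∈ cone e η) (x : E d) :
    graphHeight e φ x + ‖z‖ / 2 ≤ graphHeight e φ (x + z) := by
  have hz' : ‖z - ‖z‖ • e‖ ≤ η * ‖z‖ := hz
  have h1 : |⟪e, z - ‖z‖ • e⟫| ≤ η * ‖z‖ := by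
    refine (abs_real_inner_le_norm _ _).trans ?_
    rw [he, one_mul]
    exact hz'
  rw [inner_sub_right, inner_smul_right, real_inner_self_eq_norm_sq, he, one_pow, mul_one,
    abs_le] at h1
  have h2 := hφ.dist_le_mul (x + z - ⟪e, x + z⟫ • e) (x - ⟪e, x⟫ • e)
  rw [Real.dist_eq, dist_eq_norm] at h2
  have h3 : x + z - ⟪e, x + z⟫ • e - (x - ⟪e, x⟫ • e) =
      (z - ‖z‖ • e) - ⟪e, z - ‖z‖ • e⟫ • e := by
    rw [inner_add_right, inner_sub_right, inner_smul_right, real_inner_self_eq_norm_sq, he, one_pow,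
      mul_one, add_smul, sub_smul]
    abel
  rw [h3] at h2
  have h4 : (K : ℝ) * ‖(z - ‖z‖ • e) - ⟪e, z - ‖z‖ • e⟫ • e‖ ≤ K * (η * ‖z‖) := by
    gcongr
    exact (norm_sub_inner_smul_le he _).trans hz'
  rw [abs_le] at h2
  unfold graphHeight
  rw [inner_add_right] at *
  nlinarith [norm_nonneg z]

theorem graphHeight_add_le (he : ‖e‖ = 1) (hφ : LipschitzWith K φ) {η : ℝ}
    (hη : η * (1 + K) ≤ 1 / 2) {z : E d} (hz : z ∈ cone (-e) η) (x : E d) :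
    graphHeight e φ (x + z) + ‖z‖ / 2 ≤ graphHeight e φ x := by
  have hz' : -z ∈ cone e η := by
    have h : ‖z - ‖z‖ • (-e)‖ ≤ η * ‖z‖ := hz
    change ‖-z - ‖-z‖ • e‖ ≤ η * ‖-z‖
    rw [smul_neg, sub_neg_eq_add] at h
    rw [norm_neg, ← neg_add', norm_neg]
    exact h
  simpa using graphHeight_add_ge he hφ hη hz' (x + z)

end Graph

/-! ### Spreading the Poincaré inequality from a boundary point to `Ω`. -/

section Propagation

variable {Ω : Set (E d)} {P : ℝ → Set (E d)}

/-- Starting near `b`, walks of length `ℓ` in a narrow cone stay in `Ω` and end near `b + ℓ • e₀`.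
The start, the aperture and the rounding each displace the end point by at most `ρ / 4`, which fixes
the new radius, aperture and maximal horizon. -/
theorem PoincareOn.of_cone (hΩo : IsOpen Ω) {b e₀ : E d} (he₀ : ‖e₀‖ = 1) {ℓ η ρ₁ ρ δ₁ : ℝ}
    (hℓ : 0 < ℓ) (hη : 0 < η) (hρ₁ : 0 < ρ₁) (hρ : 0 < ρ) (hδ₁ : 0 < δ₁)
    (hcone : ∀ x ∈ Ω, ‖x - b‖ < ρ₁ → ∀ z ∈ cone e₀ η, ‖z‖ ≤ ℓ → x + z ∈ Ω)
    (h : PoincareOn Ω P δ₁ (Metric.ball (b + ℓ • e₀) ρ)) :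
    ∃ ρ' > 0, ∃ δ₂ > 0, PoincareOn Ω P δ₂ (Ω ∩ Metric.ball b ρ') := by
  set η' := min (min η 1) (ρ / (4 * ℓ)) with hη'
  have hη'0 : 0 < η' := by positivity
  have h1 : η' ≤ η := (min_le_left _ _).trans (min_le_left _ _)
  have h2 : η' * ℓ ≤ ρ / 4 := by
    have : η' ≤ ρ / (4 * ℓ) := min_le_right _ _
    calc η' * ℓ ≤ ρ / (4 * ℓ) * ℓ := by gcongr
      _ = ρ / 4 := by field_simp
  refine ⟨min ρ₁ (ρ / 4), by positivity, min δ₁ (ρ / 4), by positivity, ?_⟩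
  refine PoincareOn.transport (hΩo.inter Metric.isOpen_ball).measurableSet measurableSet_ball
    (h.mono (min_le_left _ _) subset_rfl) he₀ hη'0 ((min_le_left _ _).trans (min_le_right _ _))
    hℓ.le ?_
  rintro δ hδ z hz hz0 hzδ x ⟨hx, hxb⟩
  rw [Metric.mem_ball, dist_eq_norm] at hxb
  have hzη : z ∈ cone e₀ η :=
    le_trans (show ‖z - ‖z‖ • e₀‖ ≤ η' * ‖z‖ from hz) (by gcongr)
  refine ⟨_, le_rfl, fun j hj => Or.inl ?_, Or.inr ⟨rfl, ?_⟩⟩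
  · exact hcone x hx (hxb.trans_le (min_le_left _ _)) _ (natCast_smul_mem_cone hzη j)
      (norm_natCast_smul_le hℓ.le hz0 hj)
  · rw [Metric.mem_ball, dist_eq_norm]
    have h3 := norm_floor_smul_sub_le he₀ hη'0.le hℓ.le hz hz0
    have h4 : ‖z‖ < ρ / 4 := hzδ.trans_le (hδ.2.trans (min_le_right _ _))
    have h5 : ‖x - b‖ < ρ / 4 := hxb.trans_le (min_le_right _ _)
    calc ‖x + (⌊ℓ / ‖z‖⌋₊ : ℝ) • z - (b + ℓ • e₀)‖
        = ‖(x - b) + ((⌊ℓ / ‖z‖⌋₊ : ℝ) • z - ℓ • e₀)‖ := by congr 1; abel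
      _ ≤ ‖x - b‖ + ‖(⌊ℓ / ‖z‖⌋₊ : ℝ) • z - ℓ • e₀‖ := norm_add_le _ _
      _ < ρ := by linarith

/-- Points near which the Poincaré inequality holds in `Ω`. -/
def poincarePoints (Ω : Set (E d)) (P : ℝ → Set (E d)) : Set (E d) :=
  {a | ∃ ρ > 0, ∃ δ₁ > 0, PoincareOn Ω P δ₁ (Ω ∩ Metric.ball a ρ)}

theorem isOpen_poincarePoints : IsOpen (poincarePoints Ω P) := by
  rw [Metric.isOpen_iff]
  rintro a ⟨ρ, hρ, δ₁, hδ₁, h⟩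
  refine ⟨ρ, hρ, fun b hb => ⟨ρ - dist b a, sub_pos.2 hb, δ₁, hδ₁, h.mono le_rfl ?_⟩⟩
  gcongr
  exact Metric.ball_subset_ball' (by linarith)

theorem exists_poincareOn_ball (hΩo : IsOpen Ω) {a : E d} (ha : a ∈ Ω)
    (h : a ∈ poincarePoints Ω P) :
    ∃ ρ > 0, ∃ δ₁ > 0, PoincareOn Ω P δ₁ (Metric.ball a ρ) := by
  obtain ⟨ρ, hρ, δ₁, hδ₁, h⟩ := h
  obtain ⟨ε, hε, hball⟩ := Metric.isOpen_iff.1 hΩo a ha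
  refine ⟨min ε ρ, by positivity, δ₁, hδ₁, h.mono le_rfl (subset_inter ?_ ?_)⟩
  · exact (Metric.ball_subset_ball (min_le_left _ _)).trans hball
  · exact Metric.ball_subset_ball (min_le_right _ _)

/-- The set of good points is open and relatively closed in the connected set `Ω`: from near a limit
point one walks straight to a nearby good point inside a ball contained in `Ω`. -/
theorem subset_poincarePoints (hΩo : IsOpen Ω) (hΩc : IsPreconnected Ω)
    (h : (Ω ∩ poincarePoints Ω P).Nonempty) : Ω ⊆ poincarePoints Ω P := by
  refine hΩc.subset_of_closure_inter_subset isOpen_poincarePoints h ?_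
  rintro b ⟨hb, hbΩ⟩
  obtain ⟨R, hR, hball⟩ := Metric.isOpen_iff.1 hΩo b hbΩ
  obtain ⟨a, ha, hab⟩ := Metric.mem_closure_iff.1 hb (R / 4) (by positivity)
  rcases eq_or_ne a b with rfl | hne
  · exact ha
  rw [dist_comm, dist_eq_norm] at hab
  have hpos : 0 < ‖a - b‖ := norm_pos_iff.2 (sub_ne_zero.2 hne)
  have haΩ : a ∈ Ω := hball (by rw [Metric.mem_ball, dist_eq_norm]; linarith)
  obtain ⟨ρ, hρ, δ₁, hδ₁, h1⟩ := exists_poincareOn_ball hΩo haΩ ha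
  have hend : b + ‖a - b‖ • (‖a - b‖⁻¹ • (a - b)) = a := by
    rw [smul_smul, mul_inv_cancel₀ hpos.ne', one_smul]
    abel
  refine PoincareOn.of_cone (e₀ := ‖a - b‖⁻¹ • (a - b)) (ℓ := ‖a - b‖) (η := 1) (ρ₁ := R / 4)
    hΩo ?_ hpos one_pos (by positivity) hρ hδ₁ ?_ (by rwa [hend])
  · rw [norm_smul, norm_inv, norm_norm, inv_mul_cancel₀ hpos.ne']
  · intro x _ hx z _ hz
    refine hball ?_
    rw [Metric.mem_ball, dist_eq_norm]
    calc ‖x + z - b‖ = ‖(x - b) + z‖ := by congr 1; abel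
      _ ≤ ‖x - b‖ + ‖z‖ := norm_add_le _ _
      _ < R := by linarith

theorem exists_cone_aperture (K : ℝ≥0) : ∃ η : ℝ, 0 < η ∧ η ≤ 1 ∧ η * (1 + K) ≤ 1 / 2 := by
  refine ⟨1 / (2 * (1 + K)), by positivity, ?_, ?_⟩
  · rw [div_le_one (by positivity)]
    have : (0 : ℝ) ≤ K := K.2
    linarith
  · field_simp
    exact le_rfl

/-- Walks descending from the graph stay inside `Ω` and end near the interior point `b - (R / 2) •
e`, which is already good. -/
theorem mem_poincarePoints_of_frontier (hΩo : IsOpen Ω) (hΩL : HasLipschitzBoundary Ω)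
    (h : Ω ⊆ poincarePoints Ω P) {b : E d} (hb : b ∈ frontier Ω) : b ∈ poincarePoints Ω P := by
  obtain ⟨R, hR, e, he, K, φ, hφ, hloc⟩ := hΩL b hb
  obtain ⟨η, hη, hη1, hηK⟩ := exists_cone_aperture K
  have hlt : ∀ x ∈ Metric.ball b R, (x ∈ Ω ↔ graphHeight e φ x < 0) := fun x hx => by
    rw [hloc x hx, graphHeight, sub_neg]
  have hcont : Continuous (graphHeight e φ) :=
    Continuous.sub (by fun_prop) (hφ.continuous.comp (by fun_prop))
  -- By continuity, since points of `Ω`, where the height is negative, accumulate at `b`.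
  have hb0 : graphHeight e φ b ≤ 0 := by
    by_contra! hpos
    have hnhds : Metric.ball b R ∩ {x | 0 < graphHeight e φ x} ∈ nhds b :=
      Filter.inter_mem (Metric.ball_mem_nhds b hR)
        ((isOpen_lt continuous_const hcont).mem_nhds hpos)
    obtain ⟨x, ⟨hxR, hx0⟩, hxΩ⟩ :=
      mem_closure_iff_nhds.1 (frontier_subset_closure hb) _ hnhds
    exact absurd ((hlt x hxR).1 hxΩ) (not_lt.2 (le_of_lt hx0))
  have hin : ∀ x ∈ Metric.ball b R, graphHeight e φ x ≤ 0 → ∀ z ∈ cone (-e) η, z ≠ 0 →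
      ‖x - b‖ + ‖z‖ < R → x + z ∈ Ω := by
    intro x _ hx0 z hz hz0 hxz
    rw [hlt]
    · have h1 := graphHeight_add_le he hφ hηK hz x
      have : 0 < ‖z‖ := norm_pos_iff.2 hz0
      linarith
    · rw [Metric.mem_ball, dist_eq_norm]
      refine lt_of_le_of_lt ?_ hxz
      calc ‖x + z - b‖ = ‖(x - b) + z‖ := by congr 1; abel
        _ ≤ _ := norm_add_le _ _
  have hne : ‖-e‖ = 1 := by rw [norm_neg, he]
  have hq : b + (R / 2) • (-e) ∈ Ω := by
    refine hin b (Metric.mem_ball_self hR) hb0 _ ?_ ?_ ?_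
    · change ‖_‖ ≤ _
      rw [norm_smul, hne, Real.norm_of_nonneg (by positivity), mul_one, sub_self, norm_zero]
      positivity
    · rw [← norm_ne_zero_iff, norm_smul, hne, Real.norm_of_nonneg (by positivity)]
      positivity
    · rw [sub_self, norm_zero, norm_smul, hne, Real.norm_of_nonneg (by positivity)]
      linarith
  obtain ⟨ρ, hρ, δ₁, hδ₁, h1⟩ := exists_poincareOn_ball hΩo hq (h hq)
  refine PoincareOn.of_cone (ρ₁ := R / 2) hΩo hne (by positivity) hη (by positivity) hρ hδ₁ ?_ h1
  intro x hx hxb z hz hzR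
  rcases eq_or_ne z 0 with rfl | hz0
  · simpa using hx
  have hxR : x ∈ Metric.ball b R := by rw [Metric.mem_ball, dist_eq_norm]; linarith
  exact hin x hxR ((hlt x hxR).1 hx).le z hz hz0 (by linarith)

/-- Near `p`, walks ascending across the graph leave `Ω` before leaving the ball in which the field
vanishes on the layer. -/
theorem mem_poincarePoints_of_vanishing (hΩo : IsOpen Ω) (hΩL : HasLipschitzBoundary Ω) {p : E d}
    (hp : p ∈ frontier Ω) {r : ℝ} (hr : 0 < r) :
    p ∈ poincarePoints Ω fun δ => Metric.ball p r ∩ interactionDomain Ω δ := by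
  obtain ⟨r', hr', e, he, K, φ, hφ, hloc⟩ := hΩL p hp
  obtain ⟨η, hη, hη1, hηK⟩ := exists_cone_aperture K
  set R := min r r' with hR
  have hR0 : 0 < R := by positivity
  have hlt : ∀ x ∈ Metric.ball p R, (x ∈ Ω ↔ graphHeight e φ x < 0) := fun x hx => by
    rw [hloc x (Metric.ball_subset_ball (min_le_right _ _) hx), graphHeight, sub_neg]
  have hp0 : 0 ≤ graphHeight e φ p := by
    rw [← not_lt, ← hlt p (Metric.mem_ball_self hR0)]
    exact fun hpΩ => (hΩo.frontier_eq ▸ hp).2 hpΩ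
  have hK : (0 : ℝ) ≤ K := K.2
  have hρR : R / (16 * (1 + K)) ≤ R / 16 := by
    gcongr
    linarith
  refine ⟨R / (16 * (1 + K)), by positivity, R / 8, by positivity, ?_⟩
  refine PoincareOn.transport (ℓ := R / 2) (hΩo.inter Metric.isOpen_ball).measurableSet
    MeasurableSet.empty (PoincareOn.empty _) he hη hη1 (by positivity) ?_
  rintro δ hδ z hz hz0 hzδ x ⟨hx, hxp⟩
  rw [Metric.mem_ball, dist_eq_norm] at hxp
  have hball : ∀ j ≤ ⌊R / 2 / ‖z‖⌋₊, x + (j : ℝ) • z ∈ Metric.ball p R := fun j hj => by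
    rw [Metric.mem_ball, dist_eq_norm]
    have h1 := norm_natCast_smul_le (by positivity : 0 ≤ R / 2) hz0 hj
    calc ‖x + (j : ℝ) • z - p‖ = ‖(x - p) + (j : ℝ) • z‖ := by congr 1; abel
      _ ≤ ‖x - p‖ + ‖(j : ℝ) • z‖ := norm_add_le _ _
      _ < R := by linarith
  -- The initial height is at least `-R / 16`, and the walk, of length at least `R / 2 - R / 8`,
  -- gains at least `3 * R / 16`.
  have hN : x + (⌊R / 2 / ‖z‖⌋₊ : ℝ) • z ∉ Ω := by
    rw [hlt _ (hball _ le_rfl), not_lt]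
    have h1 := graphHeight_add_ge he hφ hηK (natCast_smul_mem_cone hz ⌊R / 2 / ‖z‖⌋₊) x
    have h2 := sub_le_norm_floor_smul (ℓ := R / 2) hz0
    have h3 := abs_graphHeight_sub_le he hφ x p
    have h4 : (1 + K) * ‖x - p‖ ≤ R / 16 := by
      calc (1 + K) * ‖x - p‖ ≤ (1 + K) * (R / (16 * (1 + K))) := by gcongr
        _ = R / 16 := by field_simp
    rw [abs_le] at h3
    have h5 : ‖z‖ < R / 8 := hzδ.trans_le hδ.2
    linarith [h3.1]
  obtain ⟨k, hk, hD, hlast⟩ := exists_first_exit hx hz0 hzδ hN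
  exact ⟨k, hk, hD, Or.inl ⟨Metric.ball_subset_ball (min_le_left _ _) (hball k hk), hlast⟩⟩

theorem exists_poincareOn_of_vanishing (hΩo : IsOpen Ω) (hΩc : IsConnected Ω)
    (hΩb : Bornology.IsBounded Ω) (hΩL : HasLipschitzBoundary Ω) {p : E d}
    (hp : p ∈ frontier Ω) {r : ℝ} (hr : 0 < r) :
    ∃ δ₁ > 0, PoincareOn Ω (fun δ => Metric.ball p r ∩ interactionDomain Ω δ) δ₁ Ω := by
  set P : ℝ → Set (E d) := fun δ => Metric.ball p r ∩ interactionDomain Ω δ with hP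
  have hpG : p ∈ poincarePoints Ω P := mem_poincarePoints_of_vanishing hΩo hΩL hp hr
  have hΩG : Ω ⊆ poincarePoints Ω P := by
    refine subset_poincarePoints hΩo hΩc.isPreconnected ?_
    obtain ⟨x, hx, hxΩ⟩ := mem_closure_iff.1 (frontier_subset_closure hp) _
      isOpen_poincarePoints hpG
    exact ⟨x, hxΩ, hx⟩
  have hcl : closure Ω ⊆ poincarePoints Ω P := by
    rw [closure_eq_self_union_frontier]
    exact union_subset hΩG fun b hb => mem_poincarePoints_of_frontier hΩo hΩL hΩG hb
  -- Finitely many good balls cover the compact closure, so one constant and one maximal horizon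
  -- suffice.
  have key : ∃ δ₁ > 0, PoincareOn Ω P δ₁ (Ω ∩ closure Ω) := by
    refine IsCompact.induction_on (p := fun t => ∃ δ₁ > 0, PoincareOn Ω P δ₁ (Ω ∩ t))
      hΩb.isCompact_closure ?_ ?_ ?_ ?_
    · exact ⟨1, one_pos, (PoincareOn.empty 1).mono le_rfl (by simp)⟩
    · rintro s t hst ⟨δ₁, hδ₁, h⟩
      exact ⟨δ₁, hδ₁, h.mono le_rfl (inter_subset_inter_right _ hst)⟩
    · rintro s t ⟨δ₁, hδ₁, h⟩ ⟨δ₂, hδ₂, h'⟩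
      refine ⟨min δ₁ δ₂, lt_min hδ₁ hδ₂, ?_⟩
      rw [inter_union_distrib_left]
      exact (h.mono (min_le_left _ _) subset_rfl).union (h'.mono (min_le_right _ _) subset_rfl)
    · intro a ha
      obtain ⟨ρ, hρ, δ₁, hδ₁, h⟩ := hcl ha
      exact ⟨Metric.ball a ρ, mem_nhdsWithin_of_mem_nhds (Metric.ball_mem_nhds a hρ), δ₁, hδ₁, h⟩
  rwa [inter_eq_left.2 subset_closure] at key

end Propagation

end LPS

end

noncomputable section

namespace LPS

variable {d : ℕ}

/-! ### Integrability over pairs of points. -/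

section Pair

variable {δ : ℝ} {γ : ℝ → ℝ} {D : Set (E d)}

theorem IsKernel.measurable_pair (K : IsKernel d δ γ) :
    Measurable fun p : E d × E d => γ ‖p.2 - p.1‖ :=
  K.measurable.comp (by fun_prop)

theorem IsKernel.mul_norm_le (K : IsKernel d δ γ) (z : E d) : γ ‖z‖ * ‖z‖ ≤ γ ‖z‖ * δ := by
  simpa [mul_comm δ] using K.mul_norm_pow_le 1 z

theorem IsKernel.integrable_pair_fst (K : IsKernel d δ γ) {a : E d → ℝ}
    (ha : Integrable a (volume.restrict D)) :
    Integrable (fun p : E d × E d => γ ‖p.2 - p.1‖ * a p.1)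
      ((volume.restrict D).prod (volume.restrict D)) := by
  have hm : AEStronglyMeasurable (fun p : E d × E d => γ ‖p.2 - p.1‖ * a p.1)
      ((volume.restrict D).prod (volume.restrict D)) :=
    K.measurable_pair.aestronglyMeasurable.mul ha.aestronglyMeasurable.comp_fst
  have hk : ∀ x, Integrable (fun y : E d => γ ‖y - x‖) := fun x => K.integrable.comp_sub_right x
  refine (integrable_prod_iff hm).2 ⟨Filter.Eventually.of_forall fun x =>
    (hk x).restrict.mul_const (a x), ?_⟩
  refine (ha.norm.const_mul (∫ z : E d, γ ‖z‖)).mono' hm.norm.integral_prod_right'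
    (Filter.Eventually.of_forall fun x => ?_)
  have h1 : ∀ y, ‖γ ‖y - x‖ * a x‖ = γ ‖y - x‖ * ‖a x‖ := fun y => by
    rw [norm_mul, Real.norm_of_nonneg (K.nonneg _)]
  simp only [h1]
  rw [integral_mul_const, Real.norm_of_nonneg (mul_nonneg (integral_nonneg fun y => K.nonneg _)
    (norm_nonneg _))]
  gcongr
  calc ∫ y in D, γ ‖y - x‖ ≤ ∫ y, γ ‖y - x‖ :=
        setIntegral_le_integral (hk x) (Filter.Eventually.of_forall fun y => K.nonneg _)
    _ = ∫ z : E d, γ ‖z‖ := integral_sub_right_eq_self (fun z : E d => γ ‖z‖) x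

/-- Integrability over pairs of points by domination through the kernel. -/
theorem IsKernel.integrable_pair {G : Type*} [NormedAddCommGroup G] (K : IsKernel d δ γ)
    {F : E d × E d → G}
    (hF : AEStronglyMeasurable F ((volume.restrict D).prod (volume.restrict D))) {a : E d → ℝ}
    (ha : Integrable a (volume.restrict D))
    (h : ∀ x y, ‖F (x, y)‖ ≤ γ ‖y - x‖ * (a x + a y)) :
    Integrable F ((volume.restrict D).prod (volume.restrict D)) := by
  have h1 := K.integrable_pair_fst ha
  have h2 := h1.swap
  refine (h1.add h2).mono' hF (Filter.Eventually.of_forall fun p => (h p.1 p.2).trans (le_of_eq ?_))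
  simp [Function.comp, norm_sub_rev p.1 p.2, mul_add]

end Pair

/-! ### The operator on `L²` fields: congruence, bounds, linearity. -/

section Operator

variable {δ : ℝ} {γ : ℝ → ℝ} {Ω : Set (E d)} {u v e : E d → E d}

theorem memLp_two_integrable_norm_sq {μ : Measure (E d)} (hu : MemLp u 2 μ) :
    Integrable (fun x => ‖u x‖ ^ 2) μ :=
  (memLp_two_iff_integrable_sq_norm hu.aestronglyMeasurable).1 hu

/-- This and the two congruences that follow allow an `L²` solution to be replaced by a measurable
representative. -/
theorem pairEnergy_congr {D : Set (E d)} (h : u =ᵐ[volume.restrict D] v) :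
    pairEnergy D γ u = pairEnergy D γ v := by
  unfold pairEnergy
  refine lintegral_congr_ae ?_
  filter_upwards [h] with x hx
  refine lintegral_congr_ae ?_
  filter_upwards [h] with y hy
  rw [hx, hy]

theorem dilatation_congr (h : u =ᵐ[volume.restrict (fullDomain Ω δ)] v) :
    dilatation Ω δ γ u =ᵐ[volume.restrict (fullDomain Ω δ)] dilatation Ω δ γ v := by
  filter_upwards [h] with x hx
  unfold dilatation
  congr 1
  refine integral_congr_ae ?_
  filter_upwards [h] with y hy
  rw [hx, hy]

theorem lpsOperator_congr {lam mu : ℝ} (h : u =ᵐ[volume.restrict (fullDomain Ω δ)] v) :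
    lpsOperator lam mu Ω δ γ u =ᵐ[volume.restrict (fullDomain Ω δ)]
      lpsOperator lam mu Ω δ γ v := by
  filter_upwards [h, dilatation_congr (γ := γ) h] with x hx hθx
  unfold lpsOperator
  congr 2
  · refine integral_congr_ae ?_
    filter_upwards [dilatation_congr (γ := γ) h] with y hθy
    rw [hθx, hθy]
  · refine integral_congr_ae ?_
    filter_upwards [h] with y hy
    rw [hx, hy]

theorem IsKernel.measurable_dilatation (K : IsKernel d δ γ) (hu : Measurable u) :
    Measurable (dilatation Ω δ γ u) := by
  have hF : StronglyMeasurable (fun p : E d × E d =>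
      γ ‖p.2 - p.1‖ * ⟪p.2 - p.1, u p.2 - u p.1⟫) :=
    (K.measurable_pair.mul (by fun_prop)).stronglyMeasurable
  exact (hF.integral_prod_right' (ν := volume.restrict (fullDomain Ω δ))).measurable.const_mul _

/-- The integrand of the energy over pairs of points. -/
def energyIntegrand (γ : ℝ → ℝ) (e : E d → E d) (p : E d × E d) : ℝ :=
  γ ‖p.2 - p.1‖ / ‖p.2 - p.1‖ ^ 2 * ⟪e p.2 - e p.1, p.2 - p.1⟫ ^ 2

theorem IsKernel.energyIntegrand_nonneg (K : IsKernel d δ γ) (e : E d → E d) (p : E d × E d) :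
    0 ≤ energyIntegrand γ e p :=
  mul_nonneg (div_nonneg (K.nonneg _) (by positivity)) (by positivity)

theorem IsKernel.integrable_energyIntegrand (K : IsKernel d δ γ) {D : Set (E d)}
    (he : Measurable e) (heL : MemLp e 2 (volume.restrict D)) :
    Integrable (energyIntegrand γ e) ((volume.restrict D).prod (volume.restrict D)) := by
  refine K.integrable_pair (a := fun x => 2 * ‖e x‖ ^ 2) (Measurable.aestronglyMeasurable
    ((K.measurable_pair.div (by fun_prop)).mul (by fun_prop)))
    ((memLp_two_integrable_norm_sq heL).const_mul 2) fun x y => ?_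
  rw [Real.norm_of_nonneg (K.energyIntegrand_nonneg _ _)]
  simp only [energyIntegrand]
  rcases eq_or_ne ‖y - x‖ 0 with h0 | h0
  · simp only [h0]
    have := K.nonneg 0
    simpa using (by positivity : 0 ≤ γ 0 * (2 * ‖e x‖ ^ 2 + 2 * ‖e y‖ ^ 2))
  have hpos : 0 < ‖y - x‖ := lt_of_le_of_ne (norm_nonneg _) h0.symm
  have h1 : ⟪e y - e x, y - x⟫ ^ 2 ≤ (‖e y - e x‖ * ‖y - x‖) ^ 2 := by
    rw [← sq_abs]
    exact pow_le_pow_left₀ (abs_nonneg _) (abs_real_inner_le_norm _ _) 2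
  have h2 : ‖e y - e x‖ ^ 2 ≤ 2 * ‖e x‖ ^ 2 + 2 * ‖e y‖ ^ 2 := by
    have := norm_sub_le (e y) (e x)
    nlinarith [norm_nonneg (e y - e x), sq_nonneg (‖e x‖ - ‖e y‖)]
  have hk := K.nonneg ‖y - x‖
  calc γ ‖y - x‖ / ‖y - x‖ ^ 2 * ⟪e y - e x, y - x⟫ ^ 2
      ≤ γ ‖y - x‖ / ‖y - x‖ ^ 2 * (‖e y - e x‖ * ‖y - x‖) ^ 2 := by gcongr
    _ = γ ‖y - x‖ * ‖e y - e x‖ ^ 2 := by field_simp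
    _ ≤ _ := by gcongr

theorem IsKernel.pairEnergy_eq (K : IsKernel d δ γ) {D : Set (E d)}
    (he : Measurable e) (heL : MemLp e 2 (volume.restrict D)) :
    pairEnergy D γ e = ENNReal.ofReal
      (∫ p, energyIntegrand γ e p ∂((volume.restrict D).prod (volume.restrict D))) := by
  have hm : Measurable fun p => ENNReal.ofReal (energyIntegrand γ e p) :=
    ((K.measurable_pair.div (by fun_prop)).mul (by fun_prop)).ennreal_ofReal
  rw [ofReal_integral_eq_lintegral_ofReal (K.integrable_energyIntegrand he heL)
    (Filter.Eventually.of_forall (K.energyIntegrand_nonneg e)), lintegral_prod _ hm.aemeasurable]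
  rfl

theorem IsKernel.integrable_pair_inner (K : IsKernel d δ γ) {D : Set (E d)}
    [IsFiniteMeasure (volume.restrict D)] (he : Measurable e)
    (heL : MemLp e 2 (volume.restrict D)) :
    Integrable (fun p : E d × E d => γ ‖p.2 - p.1‖ * ⟪p.2 - p.1, e p.2 - e p.1⟫)
      ((volume.restrict D).prod (volume.restrict D)) := by
  refine K.integrable_pair (a := fun x => δ * ‖e x‖) (Measurable.aestronglyMeasurable
    (K.measurable_pair.mul (by fun_prop)))
    ((heL.integrable one_le_two).norm.const_mul δ) fun x y => ?_
  rw [norm_mul, Real.norm_of_nonneg (K.nonneg _)]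
  have hk := K.nonneg ‖y - x‖
  calc γ ‖y - x‖ * ‖⟪y - x, e y - e x⟫‖ ≤ γ ‖y - x‖ * (‖y - x‖ * (‖e x‖ + ‖e y‖)) := by
        gcongr
        refine (norm_inner_le_norm _ _).trans ?_
        gcongr
        rw [add_comm]
        exact norm_sub_le _ _
    _ = (γ ‖y - x‖ * ‖y - x‖) * (‖e x‖ + ‖e y‖) := by ring
    _ ≤ (γ ‖y - x‖ * δ) * (‖e x‖ + ‖e y‖) :=
        mul_le_mul_of_nonneg_right (K.mul_norm_le _) (by positivity)
    _ = _ := by ring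

/-- Cauchy–Schwarz with the factors `√γ * ‖y - x‖` and `√γ * ⟪e y - e x, y - x⟫ / ‖y - x‖`; the
square of the first integrates to at most `m`. -/
theorem IsKernel.dilatation_sq_le (K : IsKernel d δ γ) (hd : 1 ≤ d) (hδ : 0 < δ)
    [IsFiniteMeasure (volume.restrict (fullDomain Ω δ))] (he : Measurable e)
    (heL : MemLp e 2 (volume.restrict (fullDomain Ω δ))) :
    ∀ᵐ x ∂(volume.restrict (fullDomain Ω δ)), dilatation Ω δ γ e x ^ 2 ≤
      (d : ℝ) ^ 2 / weightedVolume d δ γ * ∫ y in fullDomain Ω δ, energyIntegrand γ e (x, y) := by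
  have hm := K.weightedVolume_pos hd hδ
  filter_upwards [(K.integrable_energyIntegrand he heL).prod_right_ae,
    (K.integrable_pair_inner he heL).prod_right_ae] with x h1 h2
  set A := ∫ y in fullDomain Ω δ, γ ‖y - x‖ * ⟪y - x, e y - e x⟫ with hA
  set S := ∫ y in fullDomain Ω δ, energyIntegrand γ e (x, y) with hS
  have hk : Integrable fun y : E d => γ ‖y - x‖ * ‖y - x‖ ^ 2 :=
    (K.integrable_mul_norm_pow 2).comp_sub_right x
  have hkm : ∫ y in fullDomain Ω δ, γ ‖y - x‖ * ‖y - x‖ ^ 2 ≤ weightedVolume d δ γ := by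
    rw [K.weightedVolume_eq, ← integral_sub_right_eq_self (fun z : E d => γ ‖z‖ * ‖z‖ ^ 2) x]
    exact setIntegral_le_integral hk (Filter.Eventually.of_forall fun y =>
      mul_nonneg (K.nonneg _) (by positivity))
  -- Cauchy–Schwarz in quadratic form; the optimal value `t = A / m` is inserted below.
  have key : ∀ t : ℝ, 2 * t * A ≤ t ^ 2 * weightedVolume d δ γ + S := by
    intro t
    have h3 : 2 * t * A ≤ t ^ 2 * (∫ y in fullDomain Ω δ, γ ‖y - x‖ * ‖y - x‖ ^ 2) + S := by
      rw [hA, hS, ← integral_const_mul, ← integral_const_mul, ← integral_add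
        (hk.restrict.const_mul _) h1]
      refine integral_mono (h2.const_mul _) ((hk.restrict.const_mul _).add h1) fun y => ?_
      simp only [energyIntegrand]
      rw [real_inner_comm]
      rcases eq_or_ne ‖y - x‖ 0 with h0 | h0
      · rw [norm_eq_zero.1 h0]
        simp
      · have h4 : t ^ 2 * (γ ‖y - x‖ * ‖y - x‖ ^ 2) +
            γ ‖y - x‖ / ‖y - x‖ ^ 2 * ⟪e y - e x, y - x⟫ ^ 2 -
            2 * t * (γ ‖y - x‖ * ⟪e y - e x, y - x⟫) =
            γ ‖y - x‖ * (t * ‖y - x‖ - ⟪e y - e x, y - x⟫ / ‖y - x‖) ^ 2 := by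
          field_simp
          ring
        have h5 := mul_nonneg (K.nonneg ‖y - x‖)
          (sq_nonneg (t * ‖y - x‖ - ⟪e y - e x, y - x⟫ / ‖y - x‖))
        linarith
    have : t ^ 2 * (∫ y in fullDomain Ω δ, γ ‖y - x‖ * ‖y - x‖ ^ 2) ≤
        t ^ 2 * weightedVolume d δ γ := by gcongr
    linarith
  have h6 : A ^ 2 ≤ weightedVolume d δ γ * S := by
    have := key (A / weightedVolume d δ γ)
    field_simp at this
    linarith
  have h7 : dilatation Ω δ γ e x = d / weightedVolume d δ γ * A := rfl
  rw [h7]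
  calc (d / weightedVolume d δ γ * A) ^ 2 = (d : ℝ) ^ 2 / weightedVolume d δ γ ^ 2 * A ^ 2 := by
        ring
    _ ≤ (d : ℝ) ^ 2 / weightedVolume d δ γ ^ 2 * (weightedVolume d δ γ * S) := by gcongr
    _ = _ := by field_simp

theorem IsKernel.integrable_dilatation_sq (K : IsKernel d δ γ) (hd : 1 ≤ d) (hδ : 0 < δ)
    [IsFiniteMeasure (volume.restrict (fullDomain Ω δ))] (he : Measurable e)
    (heL : MemLp e 2 (volume.restrict (fullDomain Ω δ))) :
    Integrable (fun x => dilatation Ω δ γ e x ^ 2) (volume.restrict (fullDomain Ω δ)) := by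
  refine ((K.integrable_energyIntegrand he heL).integral_prod_left.const_mul
    ((d : ℝ) ^ 2 / weightedVolume d δ γ)).mono'
    ((K.measurable_dilatation he).pow_const 2).aestronglyMeasurable ?_
  filter_upwards [K.dilatation_sq_le hd hδ he heL] with x hx
  rwa [Real.norm_of_nonneg (sq_nonneg _)]

theorem IsKernel.integral_dilatation_sq_le (K : IsKernel d δ γ) (hd : 1 ≤ d) (hδ : 0 < δ)
    [IsFiniteMeasure (volume.restrict (fullDomain Ω δ))] (he : Measurable e)
    (heL : MemLp e 2 (volume.restrict (fullDomain Ω δ))) :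
    ∫ x in fullDomain Ω δ, dilatation Ω δ γ e x ^ 2 ≤ (d : ℝ) ^ 2 / weightedVolume d δ γ *
      ∫ p, energyIntegrand γ e p
        ∂((volume.restrict (fullDomain Ω δ)).prod (volume.restrict (fullDomain Ω δ))) := by
  have hI := K.integrable_energyIntegrand he heL
  rw [integral_prod _ hI, ← integral_const_mul]
  exact integral_mono_ae (K.integrable_dilatation_sq hd hδ he heL)
    (hI.integral_prod_left.const_mul _) (K.dilatation_sq_le hd hδ he heL)

theorem IsKernel.integrable_dilatationForce (K : IsKernel d δ γ) (hd : 1 ≤ d) (hδ : 0 < δ)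
    [IsFiniteMeasure (volume.restrict (fullDomain Ω δ))] (he : Measurable e)
    (heL : MemLp e 2 (volume.restrict (fullDomain Ω δ))) (c : ℝ) :
    Integrable (fun p : E d × E d => (c * γ ‖p.2 - p.1‖ *
      (dilatation Ω δ γ e p.1 + dilatation Ω δ γ e p.2)) • (p.2 - p.1))
      ((volume.restrict (fullDomain Ω δ)).prod (volume.restrict (fullDomain Ω δ))) := by
  have hθm := K.measurable_dilatation (Ω := Ω) he
  refine K.integrable_pair (a := fun x => |c| * δ * (1 + dilatation Ω δ γ e x ^ 2))
    (Measurable.aestronglyMeasurable ?_)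
    (((integrable_const 1).add (K.integrable_dilatation_sq hd hδ he heL)).const_mul _)
    fun x y => ?_
  · exact Measurable.smul (((K.measurable_pair.const_mul c)).mul
      ((hθm.comp measurable_fst).add (hθm.comp measurable_snd))) (by fun_prop)
  · set a := dilatation Ω δ γ e x
    set b := dilatation Ω δ γ e y
    have h1 : |a + b| ≤ (1 + a ^ 2) + (1 + b ^ 2) := by
      rw [abs_le]
      constructor <;> nlinarith [sq_nonneg (a + 1), sq_nonneg (b + 1), sq_nonneg (a - 1),
        sq_nonneg (b - 1)]
    rw [norm_smul, norm_mul, norm_mul, Real.norm_eq_abs c, Real.norm_of_nonneg (K.nonneg _),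
      Real.norm_eq_abs]
    calc |c| * γ ‖y - x‖ * |a + b| * ‖y - x‖ = |c| * |a + b| * (γ ‖y - x‖ * ‖y - x‖) := by ring
      _ ≤ |c| * ((1 + a ^ 2) + (1 + b ^ 2)) * (γ ‖y - x‖ * δ) :=
          mul_le_mul (mul_le_mul_of_nonneg_left h1 (abs_nonneg _)) (K.mul_norm_le _)
            (mul_nonneg (K.nonneg _) (norm_nonneg _)) (by positivity)
      _ = _ := by ring

theorem IsKernel.norm_bondForce_le (K : IsKernel d δ γ) (c : ℝ) (e : E d → E d) (x y : E d) :
    ‖(c * γ ‖y - x‖ * (⟪y - x, e y - e x⟫ / ‖y - x‖ ^ 2)) • (y - x)‖ ≤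
      γ ‖y - x‖ * (|c| * (‖e x‖ + ‖e y‖)) := by
  have hk := K.nonneg ‖y - x‖
  rw [norm_smul, norm_mul, norm_mul, Real.norm_eq_abs c, Real.norm_of_nonneg hk, norm_div,
    norm_pow, norm_norm]
  have h1 : ‖⟪y - x, e y - e x⟫‖ ≤ ‖y - x‖ * (‖e x‖ + ‖e y‖) := by
    refine (norm_inner_le_norm _ _).trans ?_
    gcongr
    rw [add_comm]
    exact norm_sub_le _ _
  rcases eq_or_ne ‖y - x‖ 0 with h0 | h0
  · rw [h0, mul_zero]
    have := K.nonneg 0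
    positivity
  have hpos : 0 < ‖y - x‖ := lt_of_le_of_ne (norm_nonneg _) h0.symm
  calc |c| * γ ‖y - x‖ * (‖⟪y - x, e y - e x⟫‖ / ‖y - x‖ ^ 2) * ‖y - x‖
      ≤ |c| * γ ‖y - x‖ * (‖y - x‖ * (‖e x‖ + ‖e y‖) / ‖y - x‖ ^ 2) * ‖y - x‖ := by gcongr
    _ = _ := by field_simp

theorem IsKernel.integrable_bondForce (K : IsKernel d δ γ) {D : Set (E d)}
    [IsFiniteMeasure (volume.restrict D)] (he : Measurable e)
    (heL : MemLp e 2 (volume.restrict D)) (c : ℝ) :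
    Integrable (fun p : E d × E d => (c * γ ‖p.2 - p.1‖ *
      (⟪p.2 - p.1, e p.2 - e p.1⟫ / ‖p.2 - p.1‖ ^ 2)) • (p.2 - p.1))
      ((volume.restrict D).prod (volume.restrict D)) := by
  refine K.integrable_pair (a := fun x => |c| * ‖e x‖) (Measurable.aestronglyMeasurable
    (Measurable.smul ((K.measurable_pair.const_mul c).mul (by fun_prop)) (by fun_prop)))
    ((heL.integrable one_le_two).norm.const_mul _) fun x y => ?_
  rw [← mul_add]
  exact K.norm_bondForce_le c e x y

theorem IsKernel.dilatation_sub (K : IsKernel d δ γ)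
    [IsFiniteMeasure (volume.restrict (fullDomain Ω δ))] (hu : Measurable u) (hv : Measurable v)
    (huL : MemLp u 2 (volume.restrict (fullDomain Ω δ)))
    (hvL : MemLp v 2 (volume.restrict (fullDomain Ω δ))) :
    dilatation Ω δ γ (u - v) =ᵐ[volume.restrict (fullDomain Ω δ)]
      dilatation Ω δ γ u - dilatation Ω δ γ v := by
  filter_upwards [(K.integrable_pair_inner hu huL).prod_right_ae,
    (K.integrable_pair_inner hv hvL).prod_right_ae] with x h1 h2
  simp only [dilatation, Pi.sub_apply]
  rw [← mul_sub, ← integral_sub h1 h2]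
  congr 2
  ext y
  rw [← mul_sub, ← inner_sub_right]
  congr 2
  abel

theorem IsKernel.lpsOperator_sub (K : IsKernel d δ γ) (hd : 1 ≤ d) (hδ : 0 < δ) (lam mu : ℝ)
    [IsFiniteMeasure (volume.restrict (fullDomain Ω δ))] (hu : Measurable u) (hv : Measurable v)
    (huL : MemLp u 2 (volume.restrict (fullDomain Ω δ)))
    (hvL : MemLp v 2 (volume.restrict (fullDomain Ω δ))) :
    lpsOperator lam mu Ω δ γ (u - v) =ᵐ[volume.restrict (fullDomain Ω δ)]
      lpsOperator lam mu Ω δ γ u - lpsOperator lam mu Ω δ γ v := by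
  have hθ := K.dilatation_sub hu hv huL hvL
  filter_upwards [hθ, (K.integrable_dilatationForce hd hδ hu huL (lam - mu)).prod_right_ae,
    (K.integrable_dilatationForce hd hδ hv hvL (lam - mu)).prod_right_ae,
    (K.integrable_bondForce hu huL mu).prod_right_ae,
    (K.integrable_bondForce hv hvL mu).prod_right_ae] with x hθx h1 h2 h3 h4
  rw [Pi.sub_apply]
  unfold lpsOperator
  rw [add_sub_add_comm, ← smul_sub, ← smul_sub, ← integral_sub h1 h2, ← integral_sub h3 h4]
  congr 2
  · refine integral_congr_ae ?_
    filter_upwards [hθ] with y hθy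
    simp only [hθx, hθy, Pi.sub_apply]
    rw [← sub_smul]
    congr 1
    ring
  · refine integral_congr_ae (Filter.Eventually.of_forall fun y => ?_)
    simp only [Pi.sub_apply]
    rw [← sub_smul]
    congr 1
    rw [show u y - v y - (u x - v x) = (u y - u x) - (v y - v x) by abel, inner_sub_right]
    ring

end Operator

end LPS

end

/-! ### Summation by parts and coercivity. -/

noncomputable section

namespace LPS

variable {d : ℕ} {δ : ℝ} {γ : ℝ → ℝ} {Ω : Set (E d)} {e : E d → E d}

theorem integral_inner_left_of_pair {D : Set (E d)} {F : E d × E d → E d}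
    (hF : Integrable F ((volume.restrict D).prod (volume.restrict D)))
    (hFe : Integrable (fun p => ⟪F p, e p.1⟫) ((volume.restrict D).prod (volume.restrict D))) :
    Integrable (fun x => ⟪∫ y in D, F (x, y), e x⟫) (volume.restrict D) ∧
    ∫ x in D, ⟪∫ y in D, F (x, y), e x⟫ =
      ∫ p, ⟪F p, e p.1⟫ ∂((volume.restrict D).prod (volume.restrict D)) := by
  have h : ∀ᵐ x ∂(volume.restrict D), ∫ y in D, ⟪F (x, y), e x⟫ =
      ⟪∫ y in D, F (x, y), e x⟫ := by
    filter_upwards [hF.prod_right_ae] with x hx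
    simp_rw [real_inner_comm (e x)]
    exact integral_inner hx (e x)
  refine ⟨hFe.integral_prod_left.congr h, ?_⟩
  rw [integral_prod _ hFe]
  exact (integral_congr_ae h).symm

theorem abs_mul_le_sq_add_sq (a b : ℝ) : |a * b| ≤ a ^ 2 + b ^ 2 := by
  rw [abs_le]
  constructor <;> nlinarith [sq_nonneg (a + b), sq_nonneg (a - b)]

/-- The selectors `f` and `g` treat at once the products in which `θ` and `e` are evaluated at
either end of the bond. -/
theorem IsKernel.integrable_pair_mul_inner (K : IsKernel d δ γ) (hδ : 0 < δ) {D : Set (E d)}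
    {θ : E d → ℝ} (hθ : Measurable θ)
    (hθ2 : Integrable (fun x => θ x ^ 2) (volume.restrict D)) (he : Measurable e)
    (heL : MemLp e 2 (volume.restrict D)) {f g : E d × E d → E d} (hf : Measurable f)
    (hg : Measurable g) (hfp : ∀ p, f p = p.1 ∨ f p = p.2) (hgp : ∀ p, g p = p.1 ∨ g p = p.2) :
    Integrable (fun p : E d × E d => γ ‖p.2 - p.1‖ * θ (f p) * ⟪p.2 - p.1, e (g p)⟫)
      ((volume.restrict D).prod (volume.restrict D)) := by
  refine K.integrable_pair (a := fun x => δ * (θ x ^ 2 + ‖e x‖ ^ 2))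
    (Measurable.aestronglyMeasurable ((K.measurable_pair.mul (hθ.comp hf)).mul
      ((measurable_snd.sub measurable_fst).inner (he.comp hg))))
    ((hθ2.add (memLp_two_integrable_norm_sq heL)).const_mul δ) fun x y => ?_
  have h1 : θ (f (x, y)) ^ 2 ≤ θ x ^ 2 + θ y ^ 2 := by
    rcases hfp (x, y) with h | h <;> rw [h] <;> nlinarith [sq_nonneg (θ x), sq_nonneg (θ y)]
  have h2 : ‖e (g (x, y))‖ ^ 2 ≤ ‖e x‖ ^ 2 + ‖e y‖ ^ 2 := by
    rcases hgp (x, y) with h | h <;> rw [h] <;> nlinarith [sq_nonneg ‖e x‖, sq_nonneg ‖e y‖]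
  have h3 := abs_mul_le_sq_add_sq (θ (f (x, y))) ‖e (g (x, y))‖
  rw [abs_mul, abs_norm] at h3
  rw [norm_mul, norm_mul, Real.norm_of_nonneg (K.nonneg _), Real.norm_eq_abs (θ _)]
  have hk := K.nonneg ‖y - x‖
  calc γ ‖y - x‖ * |θ (f (x, y))| * ‖⟪y - x, e (g (x, y))⟫‖
      ≤ γ ‖y - x‖ * |θ (f (x, y))| * (‖y - x‖ * ‖e (g (x, y))‖) := by
        gcongr
        exact norm_inner_le_norm _ _
    _ = (γ ‖y - x‖ * ‖y - x‖) * (|θ (f (x, y))| * ‖e (g (x, y))‖) := by ring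
    _ ≤ (γ ‖y - x‖ * δ) * ((θ x ^ 2 + θ y ^ 2) + (‖e x‖ ^ 2 + ‖e y‖ ^ 2)) := by
        refine mul_le_mul (K.mul_norm_le _) (by linarith) (by positivity) (by positivity)
    _ = _ := by ring

/-- Summation by parts for the dilatational part of the operator. -/
theorem IsKernel.integral_inner_dilatationForce (K : IsKernel d δ γ) (hd : 1 ≤ d) (hδ : 0 < δ)
    [IsFiniteMeasure (volume.restrict (fullDomain Ω δ))] (he : Measurable e)
    (heL : MemLp e 2 (volume.restrict (fullDomain Ω δ))) (c : ℝ) :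
    Integrable (fun x => ⟪∫ y in fullDomain Ω δ, (c * γ ‖y - x‖ *
      (dilatation Ω δ γ e x + dilatation Ω δ γ e y)) • (y - x), e x⟫)
      (volume.restrict (fullDomain Ω δ)) ∧
    d / weightedVolume d δ γ * ∫ x in fullDomain Ω δ, ⟪∫ y in fullDomain Ω δ, (c * γ ‖y - x‖ *
      (dilatation Ω δ γ e x + dilatation Ω δ γ e y)) • (y - x), e x⟫ =
      -c * ∫ x in fullDomain Ω δ, dilatation Ω δ γ e x ^ 2 := by
  set D := fullDomain Ω δ with hD
  set θ := dilatation Ω δ γ e with hθ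
  have hm := K.weightedVolume_pos hd hδ
  have hθm : Measurable θ := K.measurable_dilatation he
  have hθ2 : Integrable (fun x => θ x ^ 2) (volume.restrict D) :=
    K.integrable_dilatation_sq hd hδ he heL
  have h11 := K.integrable_pair_mul_inner hδ hθm hθ2 he heL measurable_fst measurable_fst
    (fun _ => Or.inl rfl) (fun _ => Or.inl rfl)
  have h12 := K.integrable_pair_mul_inner hδ hθm hθ2 he heL measurable_fst measurable_snd
    (fun _ => Or.inl rfl) (fun _ => Or.inr rfl)
  have h21 := K.integrable_pair_mul_inner hδ hθm hθ2 he heL measurable_snd measurable_fst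
    (fun _ => Or.inr rfl) (fun _ => Or.inl rfl)
  have hF := K.integrable_dilatationForce hd hδ he heL c
  have hsplit : (fun p : E d × E d => ⟪(c * γ ‖p.2 - p.1‖ * (θ p.1 + θ p.2)) • (p.2 - p.1),
      e p.1⟫) = fun p => c * (γ ‖p.2 - p.1‖ * θ p.1 * ⟪p.2 - p.1, e p.1⟫ +
        γ ‖p.2 - p.1‖ * θ p.2 * ⟪p.2 - p.1, e p.1⟫) := by
    ext p
    rw [real_inner_smul_left]
    ring
  have hFe : Integrable (fun p : E d × E d =>
      ⟪(c * γ ‖p.2 - p.1‖ * (θ p.1 + θ p.2)) • (p.2 - p.1), e p.1⟫)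
      ((volume.restrict D).prod (volume.restrict D)) := by
    rw [hsplit]
    exact (h11.add h21).const_mul c
  obtain ⟨hItg, heq⟩ := integral_inner_left_of_pair hF hFe
  refine ⟨hItg, ?_⟩
  -- Exchanging the two points moves `θ` to the first one and `e` to the second with a sign; the two
  -- terms then combine into `-θ x` times the integrand that defines `θ x`.
  have hsw : ∫ p : E d × E d, γ ‖p.2 - p.1‖ * θ p.2 * ⟪p.2 - p.1, e p.1⟫
        ∂((volume.restrict D).prod (volume.restrict D)) =
      -∫ p : E d × E d, γ ‖p.2 - p.1‖ * θ p.1 * ⟪p.2 - p.1, e p.2⟫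
        ∂((volume.restrict D).prod (volume.restrict D)) := by
    rw [← integral_prod_swap, ← integral_neg]
    congr 1
    ext p
    simp only [Prod.fst_swap, Prod.snd_swap]
    rw [norm_sub_rev, ← neg_sub p.2 p.1, inner_neg_left]
    ring
  have hcomb : ∫ p : E d × E d, (γ ‖p.2 - p.1‖ * θ p.1 * ⟪p.2 - p.1, e p.1⟫ +
        γ ‖p.2 - p.1‖ * θ p.2 * ⟪p.2 - p.1, e p.1⟫)
        ∂((volume.restrict D).prod (volume.restrict D)) =
      -∫ p : E d × E d, θ p.1 * (γ ‖p.2 - p.1‖ * ⟪p.2 - p.1, e p.2 - e p.1⟫)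
        ∂((volume.restrict D).prod (volume.restrict D)) := by
    rw [integral_add h11 h21, hsw, ← sub_eq_add_neg, ← integral_sub h11 h12, ← integral_neg]
    congr 1
    ext p
    rw [inner_sub_right]
    ring
  have hI : Integrable (fun p : E d × E d =>
      θ p.1 * (γ ‖p.2 - p.1‖ * ⟪p.2 - p.1, e p.2 - e p.1⟫))
      ((volume.restrict D).prod (volume.restrict D)) := by
    refine (h12.sub h11).congr (Filter.Eventually.of_forall fun p => ?_)
    simp only [Pi.sub_apply, inner_sub_right]
    ring
  have hlast : ∫ p : E d × E d, θ p.1 * (γ ‖p.2 - p.1‖ * ⟪p.2 - p.1, e p.2 - e p.1⟫)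
        ∂((volume.restrict D).prod (volume.restrict D)) =
      weightedVolume d δ γ / d * ∫ x in D, θ x ^ 2 := by
    rw [integral_prod _ hI, ← integral_const_mul]
    congr 1
    ext x
    simp only
    rw [integral_const_mul]
    have : θ x = d / weightedVolume d δ γ * ∫ y in D, γ ‖y - x‖ * ⟪y - x, e y - e x⟫ := rfl
    have hd0 : (d : ℝ) ≠ 0 := by positivity
    have h2 : ∫ y in D, γ ‖y - x‖ * ⟪y - x, e y - e x⟫ = weightedVolume d δ γ / d * θ x := by
      rw [this]
      field_simp
    rw [h2]
    ring
  have hd0 : (d : ℝ) ≠ 0 := by positivity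
  rw [heq, hsplit, integral_const_mul, hcomb, hlast]
  field_simp

/-- Summation by parts for the bond part of the operator. -/
theorem IsKernel.integral_inner_bondForce (K : IsKernel d δ γ) {D : Set (E d)}
    [IsFiniteMeasure (volume.restrict D)] (he : Measurable e)
    (heL : MemLp e 2 (volume.restrict D)) (c : ℝ) :
    Integrable (fun x => ⟪∫ y in D, (c * γ ‖y - x‖ *
      (⟪y - x, e y - e x⟫ / ‖y - x‖ ^ 2)) • (y - x), e x⟫) (volume.restrict D) ∧
    2 * ∫ x in D, ⟪∫ y in D, (c * γ ‖y - x‖ *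
      (⟪y - x, e y - e x⟫ / ‖y - x‖ ^ 2)) • (y - x), e x⟫ =
      -c * ∫ p, energyIntegrand γ e p ∂((volume.restrict D).prod (volume.restrict D)) := by
  have hF := K.integrable_bondForce he heL c
  have hFe : Integrable (fun p : E d × E d =>
      ⟪(c * γ ‖p.2 - p.1‖ * (⟪p.2 - p.1, e p.2 - e p.1⟫ / ‖p.2 - p.1‖ ^ 2)) • (p.2 - p.1), e p.1⟫)
      ((volume.restrict D).prod (volume.restrict D)) := by
    refine K.integrable_pair (a := fun x => |c| * (2 * ‖e x‖ ^ 2))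
      (hF.aestronglyMeasurable.inner (he.comp measurable_fst).aestronglyMeasurable)
      (((memLp_two_integrable_norm_sq heL).const_mul 2).const_mul _) fun x y => ?_
    have hk := K.nonneg ‖y - x‖
    calc _ ≤ γ ‖y - x‖ * (|c| * (‖e x‖ + ‖e y‖)) * ‖e x‖ :=
          (norm_inner_le_norm _ _).trans
            (mul_le_mul_of_nonneg_right (K.norm_bondForce_le c e x y) (norm_nonneg _))
      _ = γ ‖y - x‖ * (|c| * ((‖e x‖ + ‖e y‖) * ‖e x‖)) := by ring
      _ ≤ γ ‖y - x‖ * (|c| * (2 * ‖e x‖ ^ 2 + 2 * ‖e y‖ ^ 2)) := by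
          gcongr
          nlinarith [sq_nonneg (‖e x‖ - ‖e y‖), sq_nonneg ‖e y‖]
      _ = _ := by ring
  obtain ⟨hItg, heq⟩ := integral_inner_left_of_pair hF hFe
  refine ⟨hItg, ?_⟩
  -- Averaging with the exchanged pair replaces `e x` by half of `-(e y - e x)`, which completes the
  -- square.
  have hsw := integral_prod_swap (μ := volume.restrict D) (ν := volume.restrict D)
    (fun p : E d × E d =>
      ⟪(c * γ ‖p.2 - p.1‖ * (⟪p.2 - p.1, e p.2 - e p.1⟫ / ‖p.2 - p.1‖ ^ 2)) • (p.2 - p.1), e p.1⟫)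
  rw [heq, two_mul]
  nth_rewrite 1 [← hsw]
  refine (integral_add hFe.swap hFe).symm.trans ?_
  rw [← integral_const_mul]
  congr 1
  ext p
  simp only [Function.comp_apply, Prod.fst_swap, Prod.snd_swap, energyIntegrand]
  rw [real_inner_smul_left, real_inner_smul_left, norm_sub_rev p.1 p.2, ← neg_sub p.2 p.1,
    ← neg_sub (e p.2) (e p.1), inner_neg_neg, inner_neg_left,
    real_inner_comm (p.2 - p.1) (e p.2 - e p.1)]
  simp only [inner_sub_right]
  ring

/-- The energy identity for the peridynamic operator. -/
theorem IsKernel.energy_identity (K : IsKernel d δ γ) (hd : 1 ≤ d) (hδ : 0 < δ) (lam mu : ℝ)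
    [IsFiniteMeasure (volume.restrict (fullDomain Ω δ))] (he : Measurable e)
    (heL : MemLp e 2 (volume.restrict (fullDomain Ω δ))) :
    ∫ x in fullDomain Ω δ, ⟪-lpsOperator lam mu Ω δ γ e x, e x⟫ =
      (lam - mu) * (∫ x in fullDomain Ω δ, dilatation Ω δ γ e x ^ 2) +
      d * (d + 2) * mu / weightedVolume d δ γ * ∫ p, energyIntegrand γ e p
        ∂((volume.restrict (fullDomain Ω δ)).prod (volume.restrict (fullDomain Ω δ))) := by
  obtain ⟨h1, h1'⟩ := K.integral_inner_dilatationForce hd hδ he heL (lam - mu)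
  obtain ⟨h2, h2'⟩ := K.integral_inner_bondForce he heL mu
  simp only [lpsOperator, inner_neg_left, inner_add_left, real_inner_smul_left]
  rw [integral_neg, integral_add (h1.const_mul _) (h2.const_mul _), integral_const_mul,
    integral_const_mul, h1']
  have h3 : 2 * (d : ℝ) * (d + 2) / weightedVolume d δ γ *
      (∫ x in fullDomain Ω δ, ⟪∫ y in fullDomain Ω δ, (mu * γ ‖y - x‖ *
      (⟪y - x, e y - e x⟫ / ‖y - x‖ ^ 2)) • (y - x), e x⟫) =
      d * (d + 2) / weightedVolume d δ γ * (2 * ∫ x in fullDomain Ω δ,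
        ⟪∫ y in fullDomain Ω δ, (mu * γ ‖y - x‖ *
      (⟪y - x, e y - e x⟫ / ‖y - x‖ ^ 2)) • (y - x), e x⟫) := by ring
  rw [h3, h2']
  ring

/-- If `λ ≥ μ`, the dilatation term is dropped. Otherwise it is bounded below through `∫ θ² ≤ d² S /
m`, and `d² (λ - μ) + d (d + 2) μ = d (d λ + 2 μ)`. -/
theorem IsKernel.coercive (K : IsKernel d δ γ) (hd : 1 ≤ d) (hδ : 0 < δ) {lam mu : ℝ}
    [IsFiniteMeasure (volume.restrict (fullDomain Ω δ))] (he : Measurable e)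
    (heL : MemLp e 2 (volume.restrict (fullDomain Ω δ))) :
    min ((d : ℝ) * (d + 2) * mu) (d * (d * lam + 2 * mu)) / weightedVolume d δ γ *
      ∫ p, energyIntegrand γ e p
        ∂((volume.restrict (fullDomain Ω δ)).prod (volume.restrict (fullDomain Ω δ))) ≤
    ∫ x in fullDomain Ω δ, ⟪-lpsOperator lam mu Ω δ γ e x, e x⟫ := by
  rw [K.energy_identity hd hδ lam mu he heL]
  have hm := K.weightedVolume_pos hd hδ
  have hθ := K.integral_dilatation_sq_le hd hδ he heL
  set S := ∫ p, energyIntegrand γ e p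
        ∂((volume.restrict (fullDomain Ω δ)).prod (volume.restrict (fullDomain Ω δ)))
  set T := ∫ x in fullDomain Ω δ, dilatation Ω δ γ e x ^ 2
  have hS : 0 ≤ S := integral_nonneg (K.energyIntegrand_nonneg e)
  have hT : 0 ≤ T := integral_nonneg fun x => sq_nonneg _
  have hSm : 0 ≤ S / weightedVolume d δ γ := by positivity
  rw [div_mul_eq_mul_div, mul_div_assoc, div_mul_eq_mul_div, mul_div_assoc]
  rw [div_mul_eq_mul_div, mul_div_assoc] at hθ
  rcases le_total mu lam with h | h
  · have h1 := mul_le_mul_of_nonneg_right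
      (min_le_left ((d : ℝ) * (d + 2) * mu) (d * (d * lam + 2 * mu))) hSm
    have h2 := mul_nonneg (sub_nonneg.2 h) hT
    linarith
  · have h1 := mul_le_mul_of_nonneg_right
      (min_le_right ((d : ℝ) * (d + 2) * mu) (d * (d * lam + 2 * mu))) hSm
    have h2 := mul_le_mul_of_nonneg_left hθ (sub_nonneg.2 h)
    linarith

end LPS

end

noncomputable section

namespace LPS

/-! ### One-dimensional Taylor estimates and symmetric differences. -/

section Taylor

theorem abs_sub_zero_le_of_hasDerivAt {g g' : ℝ → ℝ} {C : ℝ}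
    (hg : ∀ t ∈ Icc (-1 : ℝ) 1, HasDerivAt g (g' t) t) (hC : ∀ t ∈ Icc (-1 : ℝ) 1, |g' t| ≤ C)
    {t : ℝ} (ht : t ∈ Icc (-1 : ℝ) 1) : |g t - g 0| ≤ C := by
  have h0 : (0 : ℝ) ∈ Icc (-1 : ℝ) 1 := by constructor <;> norm_num
  have h := (convex_Icc (-1 : ℝ) 1).norm_image_sub_le_of_norm_hasDerivWithin_le
    (fun s hs => (hg s hs).hasDerivWithinAt) (fun s hs => hC s hs) h0 ht
  have hC0 : 0 ≤ C := (abs_nonneg _).trans (hC 0 h0)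
  have h1 : |t| ≤ 1 := abs_le.2 ht
  rw [Real.norm_eq_abs, Real.norm_eq_abs, sub_zero] at h
  nlinarith

/-- Differentiating a Taylor remainder gives the remainder of lower order, so the mean value bound
can be iterated. No factorials are gained, as constants are immaterial here. -/
theorem abs_second_order_taylor_le {f f₁ f₂ f₃ : ℝ → ℝ} {C : ℝ}
    (h₁ : ∀ t ∈ Icc (-1 : ℝ) 1, HasDerivAt f (f₁ t) t)
    (h₂ : ∀ t ∈ Icc (-1 : ℝ) 1, HasDerivAt f₁ (f₂ t) t)
    (h₃ : ∀ t ∈ Icc (-1 : ℝ) 1, HasDerivAt f₂ (f₃ t) t)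
    (hC : ∀ t ∈ Icc (-1 : ℝ) 1, |f₃ t| ≤ C) {t : ℝ} (ht : t ∈ Icc (-1 : ℝ) 1) :
    |f t - f 0 - t * f₁ 0 - t ^ 2 / 2 * f₂ 0| ≤ C := by
  have a2 : ∀ t ∈ Icc (-1 : ℝ) 1, |f₂ t - f₂ 0| ≤ C := fun t ht =>
    abs_sub_zero_le_of_hasDerivAt h₃ hC ht
  have a1 : ∀ t ∈ Icc (-1 : ℝ) 1, |f₁ t - f₁ 0 - t * f₂ 0| ≤ C := fun t ht => by
    have := abs_sub_zero_le_of_hasDerivAt (g := fun t => f₁ t - t * f₂ 0)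
      (g' := fun t => f₂ t - f₂ 0)
      (fun s hs => ((h₂ s hs).sub ((hasDerivAt_id s).mul_const (f₂ 0))).congr_deriv (by simp))
      a2 ht
    convert this using 2
    ring
  have := abs_sub_zero_le_of_hasDerivAt (g := fun t => f t - t * f₁ 0 - t ^ 2 / 2 * f₂ 0)
      (g' := fun t => f₁ t - f₁ 0 - t * f₂ 0)
      (fun s hs => by
        have h4 := (((hasDerivAt_pow 2 s).div_const 2).mul_const (f₂ 0))
        have h5 := ((h₁ s hs).sub ((hasDerivAt_id s).mul_const (f₁ 0))).sub h4
        exact h5.congr_deriv (by simp)) a1 ht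
  convert this using 2
  ring

theorem abs_third_order_taylor_le {f f₁ f₂ f₃ f₄ : ℝ → ℝ} {C : ℝ}
    (h₁ : ∀ t ∈ Icc (-1 : ℝ) 1, HasDerivAt f (f₁ t) t)
    (h₂ : ∀ t ∈ Icc (-1 : ℝ) 1, HasDerivAt f₁ (f₂ t) t)
    (h₃ : ∀ t ∈ Icc (-1 : ℝ) 1, HasDerivAt f₂ (f₃ t) t)
    (h₄ : ∀ t ∈ Icc (-1 : ℝ) 1, HasDerivAt f₃ (f₄ t) t)
    (hC : ∀ t ∈ Icc (-1 : ℝ) 1, |f₄ t| ≤ C) {t : ℝ} (ht : t ∈ Icc (-1 : ℝ) 1) :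
    |f t - f 0 - t * f₁ 0 - t ^ 2 / 2 * f₂ 0 - t ^ 3 / 6 * f₃ 0| ≤ C := by
  have := abs_sub_zero_le_of_hasDerivAt
      (g := fun t => f t - t * f₁ 0 - t ^ 2 / 2 * f₂ 0 - t ^ 3 / 6 * f₃ 0)
      (g' := fun t => f₁ t - f₁ 0 - t * f₂ 0 - t ^ 2 / 2 * f₃ 0)
      (fun s hs => by
        have h4 := (((hasDerivAt_pow 2 s).div_const 2).mul_const (f₂ 0))
        have h5 := (((hasDerivAt_pow 3 s).div_const 6).mul_const (f₃ 0))
        have h6 := (((h₁ s hs).sub ((hasDerivAt_id s).mul_const (f₁ 0))).sub h4).sub h5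
        exact h6.congr_deriv (by
          push_cast
          simp only [pow_one]
          ring)) (fun s hs => abs_second_order_taylor_le h₂ h₃ h₄ hC hs) ht
  convert this using 2
  ring

theorem abs_central_difference_sub_le {f f₁ f₂ f₃ : ℝ → ℝ} {C : ℝ}
    (h₁ : ∀ t ∈ Icc (-1 : ℝ) 1, HasDerivAt f (f₁ t) t)
    (h₂ : ∀ t ∈ Icc (-1 : ℝ) 1, HasDerivAt f₁ (f₂ t) t)
    (h₃ : ∀ t ∈ Icc (-1 : ℝ) 1, HasDerivAt f₂ (f₃ t) t)
    (hC : ∀ t ∈ Icc (-1 : ℝ) 1, |f₃ t| ≤ C) : |f 1 - f (-1) - 2 * f₁ 0| ≤ 2 * C := by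
  have hp := abs_second_order_taylor_le h₁ h₂ h₃ hC (t := 1) (by constructor <;> norm_num)
  have hn := abs_second_order_taylor_le h₁ h₂ h₃ hC (t := -1) (by constructor <;> norm_num)
  rw [abs_le] at *
  constructor <;> linarith

theorem abs_second_difference_sub_le {f f₁ f₂ f₃ f₄ : ℝ → ℝ} {C : ℝ}
    (h₁ : ∀ t ∈ Icc (-1 : ℝ) 1, HasDerivAt f (f₁ t) t)
    (h₂ : ∀ t ∈ Icc (-1 : ℝ) 1, HasDerivAt f₁ (f₂ t) t)
    (h₃ : ∀ t ∈ Icc (-1 : ℝ) 1, HasDerivAt f₂ (f₃ t) t)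
    (h₄ : ∀ t ∈ Icc (-1 : ℝ) 1, HasDerivAt f₃ (f₄ t) t)
    (hC : ∀ t ∈ Icc (-1 : ℝ) 1, |f₄ t| ≤ C) : |f 1 + f (-1) - 2 * f 0 - f₂ 0| ≤ 2 * C := by
  have hp := abs_third_order_taylor_le h₁ h₂ h₃ h₄ hC (t := 1) (by constructor <;> norm_num)
  have hn := abs_third_order_taylor_le h₁ h₂ h₃ h₄ hC (t := -1) (by constructor <;> norm_num)
  rw [abs_le] at *
  constructor <;> linarith

end Taylor

/-! ### Symmetric differences of the displacement along lines. -/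

section Lines

variable {d : ℕ} {D : Set (E d)} {u : E d → E d} {M : ℝ}

theorem hasDerivAt_inner_iteratedFDeriv_line (hD : IsOpen D) (hu : ContDiffOn ℝ 4 u D) {n : ℕ}
    (hn : n < 4) (a x z : E d) (v : Fin n → E d) {t : ℝ} (ht : x + t • z ∈ D) :
    HasDerivAt (fun s : ℝ => ⟪a, iteratedFDeriv ℝ n u (x + s • z) v⟫)
      ⟪a, iteratedFDeriv ℝ (n + 1) u (x + t • z) (Fin.cons z v)⟫ t := by
  have hat : ContDiffAt ℝ 4 u (x + t • z) := hu.contDiffAt (hD.mem_nhds ht)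
  have hdiff : DifferentiableAt ℝ (iteratedFDeriv ℝ n u) (x + t • z) :=
    hat.differentiableAt_iteratedFDeriv (by exact_mod_cast hn)
  have hline : HasDerivAt (fun s : ℝ => x + s • z) z t := by
    simpa using ((hasDerivAt_id t).smul_const z).const_add x
  have h1 := hdiff.hasFDerivAt.comp_hasDerivAt t hline
  have h2 := (ContinuousMultilinearMap.apply ℝ (fun _ : Fin n => E d) (E d) v).hasFDerivAt
    (x := iteratedFDeriv ℝ n u (x + t • z)) |>.comp_hasDerivAt t h1
  have h3 := (innerSL ℝ a).hasFDerivAt (x := iteratedFDeriv ℝ n u (x + t • z) v)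
    |>.comp_hasDerivAt t h2
  exact h3

theorem abs_inner_iteratedFDeriv_le (hM : ∀ k ≤ 4, ∀ x ∈ D, ‖iteratedFDeriv ℝ k u x‖ ≤ M) {n : ℕ}
    (hn : n ≤ 4) (a : E d) {x : E d} (hx : x ∈ D) (v : Fin n → E d) :
    |⟪a, iteratedFDeriv ℝ n u x v⟫| ≤ ‖a‖ * (M * ∏ i, ‖v i‖) := by
  refine (abs_real_inner_le_norm _ _).trans ?_
  gcongr
  refine ((iteratedFDeriv ℝ n u x).le_opNorm v).trans ?_
  gcongr
  exact hM n hn x hx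

theorem second_difference_le (hD : IsOpen D) (hu : ContDiffOn ℝ 4 u D)
    (hM : ∀ k ≤ 4, ∀ x ∈ D, ‖iteratedFDeriv ℝ k u x‖ ≤ M) {x z : E d}
    (hx : ∀ t ∈ Icc (-1 : ℝ) 1, x + t • z ∈ D) :
    |⟪z, u (x + z) + u (x - z) - (2 : ℝ) • u x⟫ - ⟪z, fderiv ℝ (fderiv ℝ u) x z z⟫| ≤
      2 * (M * ‖z‖ ^ 5) := by
  have key := abs_second_difference_sub_le (C := M * ‖z‖ ^ 5)
    (fun t ht => hasDerivAt_inner_iteratedFDeriv_line hD hu (by norm_num : 0 < 4) z x z ![]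
      (hx t ht))
    (fun t ht => hasDerivAt_inner_iteratedFDeriv_line hD hu (by norm_num : 1 < 4) z x z _
      (hx t ht))
    (fun t ht => hasDerivAt_inner_iteratedFDeriv_line hD hu (by norm_num : 2 < 4) z x z _
      (hx t ht))
    (fun t ht => hasDerivAt_inner_iteratedFDeriv_line hD hu (by norm_num : 3 < 4) z x z _
      (hx t ht))
    (fun t ht => (abs_inner_iteratedFDeriv_le hM le_rfl z (hx t ht) _).trans (by
      simp [Fin.prod_univ_succ]
      apply le_of_eq
      ring))
  simp only [iteratedFDeriv_zero_apply, one_smul, neg_smul, zero_smul, add_zero,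
    ← sub_eq_add_neg] at key
  have hH : iteratedFDeriv ℝ (1 + 1) u x (Fin.cons z (Fin.cons z ![])) =
      fderiv ℝ (fderiv ℝ u) x z z := iteratedFDeriv_two_apply u x _
  rw [hH] at key
  simpa only [inner_sub_right, inner_add_right, real_inner_smul_right] using key

/-- Central difference first in `z`, then in `w`. The third `z`-derivative is itself differenced
across `±w`, so four derivatives suffice and the error keeps the factor `‖w‖ ^ 2 * ‖z‖`. A bound by
a pure power of `δ` would not do: a kernel concentrated near the origin has lower moments not
controlled by `m(δ)`. -/
theorem mixed_difference_le (hD : IsOpen D) (hu : ContDiffOn ℝ 4 u D)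
    (hM : ∀ k ≤ 4, ∀ x ∈ D, ‖iteratedFDeriv ℝ k u x‖ ≤ M) {x z w : E d} {δ : ℝ}
    (hz : ‖z‖ ≤ δ) (hw : ‖w‖ ≤ δ) (hM0 : 0 ≤ M)
    (hx : ∀ s ∈ Icc (-1 : ℝ) 1, ∀ t ∈ Icc (-1 : ℝ) 1, x + s • z + t • w ∈ D) :
    |⟪w, u (x + z + w) - u (x + z - w) - (u (x - z + w) - u (x - z - w))⟫ -
      4 * ⟪w, fderiv ℝ (fderiv ℝ u) x w z⟫| ≤ 8 * M * δ ^ 2 * ‖w‖ ^ 2 * ‖z‖ := by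
  have h0 : (0 : ℝ) ∈ Icc (-1 : ℝ) 1 := by constructor <;> norm_num
  have h1 : (1 : ℝ) ∈ Icc (-1 : ℝ) 1 := by constructor <;> norm_num
  have hn1 : (-1 : ℝ) ∈ Icc (-1 : ℝ) 1 := by constructor <;> norm_num
  have hxp : ∀ t ∈ Icc (-1 : ℝ) 1, x + w + t • z ∈ D := fun t ht => by
    have := hx t ht 1 h1
    rwa [one_smul, add_right_comm] at this
  have hxn : ∀ t ∈ Icc (-1 : ℝ) 1, x - w + t • z ∈ D := fun t ht => by
    have := hx t ht (-1) hn1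
    rwa [neg_one_smul, ← sub_eq_add_neg, add_sub_right_comm] at this
  have hw2 : ‖w‖ ^ 2 ≤ δ ^ 2 := by gcongr
  have hz2 : ‖z‖ ^ 2 ≤ δ ^ 2 := by gcongr
  have key := abs_central_difference_sub_le (C := 2 * (M * ‖w‖ ^ 2 * ‖z‖ ^ 3))
    (fun t ht => (hasDerivAt_inner_iteratedFDeriv_line hD hu (by norm_num : 0 < 4) w (x + w) z ![]
      (hxp t ht)).sub (hasDerivAt_inner_iteratedFDeriv_line hD hu (by norm_num : 0 < 4) w (x - w) z
        ![] (hxn t ht)))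
    (fun t ht => (hasDerivAt_inner_iteratedFDeriv_line hD hu (by norm_num : 1 < 4) w (x + w) z _
      (hxp t ht)).sub (hasDerivAt_inner_iteratedFDeriv_line hD hu (by norm_num : 1 < 4) w (x - w) z
        _ (hxn t ht)))
    (fun t ht => (hasDerivAt_inner_iteratedFDeriv_line hD hu (by norm_num : 2 < 4) w (x + w) z _
      (hxp t ht)).sub (hasDerivAt_inner_iteratedFDeriv_line hD hu (by norm_num : 2 < 4) w (x - w) z
        _ (hxn t ht)))
    (fun t ht => by
      have hd3 : ∀ s ∈ Icc (-1 : ℝ) 1, HasDerivAt (fun s : ℝ => ⟪w, iteratedFDeriv ℝ 3 u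
          (x + t • z + s • w) (Fin.cons z (Fin.cons z (Fin.cons z ![])))⟫) _ s := fun s hs =>
        hasDerivAt_inner_iteratedFDeriv_line hD hu (by norm_num : 3 < 4) w (x + t • z) w _
          (hx t ht s hs)
      have hb : ∀ s ∈ Icc (-1 : ℝ) 1, _ := fun s hs =>
        abs_inner_iteratedFDeriv_le hM le_rfl w (hx t ht s hs)
          (Fin.cons w (Fin.cons z (Fin.cons z (Fin.cons z ![]))))
      have e1 := abs_sub_zero_le_of_hasDerivAt hd3 hb h1
      have e2 := abs_sub_zero_le_of_hasDerivAt hd3 hb hn1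
      simp only [one_smul, neg_one_smul, ← sub_eq_add_neg, zero_smul, add_zero] at e1 e2
      rw [add_right_comm] at e1
      rw [add_sub_right_comm] at e2
      have hprod : ‖w‖ * (M * ∏ i : Fin 4, ‖(Fin.cons w (Fin.cons z (Fin.cons z (Fin.cons z ![]))) :
          Fin 4 → E d) i‖) = M * ‖w‖ ^ 2 * ‖z‖ ^ 3 := by
        simp [Fin.prod_univ_succ]
        ring
      rw [hprod] at e1 e2
      rw [abs_le] at *
      constructor <;> linarith)
  have key2 := abs_central_difference_sub_le (C := M * ‖w‖ ^ 4 * ‖z‖)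
    (fun t ht => hasDerivAt_inner_iteratedFDeriv_line hD hu (by norm_num : 1 < 4) w x w
      (Fin.cons z ![]) (by simpa using hx 0 h0 t ht))
    (fun t ht => hasDerivAt_inner_iteratedFDeriv_line hD hu (by norm_num : 2 < 4) w x w _
      (by simpa using hx 0 h0 t ht))
    (fun t ht => hasDerivAt_inner_iteratedFDeriv_line hD hu (by norm_num : 3 < 4) w x w _
      (by simpa using hx 0 h0 t ht))
    (fun t ht => (abs_inner_iteratedFDeriv_le hM le_rfl w (by simpa using hx 0 h0 t ht) _).trans (by
      simp [Fin.prod_univ_succ]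
      apply le_of_eq
      ring))
  simp only [iteratedFDeriv_zero_apply, one_smul, neg_smul, zero_smul, add_zero,
    ← sub_eq_add_neg, Pi.sub_apply] at key key2
  have hH : iteratedFDeriv ℝ (1 + 1) u x (Fin.cons w (Fin.cons z ![])) =
      fderiv ℝ (fderiv ℝ u) x w z := iteratedFDeriv_two_apply u x _
  rw [hH] at key2
  have hexp : ⟪w, u (x + z + w) - u (x + z - w) - (u (x - z + w) - u (x - z - w))⟫ =
      ⟪w, u (x + w + z)⟫ - ⟪w, u (x - w + z)⟫ - (⟪w, u (x + w - z)⟫ - ⟪w, u (x - w - z)⟫) := by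
    simp only [inner_sub_right]
    rw [add_right_comm x z w, add_sub_right_comm x z w, add_sub_right_comm x w z,
      sub_right_comm x z w]
  rw [hexp]
  have b1 : M * ‖w‖ ^ 2 * ‖z‖ ^ 3 ≤ M * δ ^ 2 * ‖w‖ ^ 2 * ‖z‖ := by
    calc M * ‖w‖ ^ 2 * ‖z‖ ^ 3 = M * ‖z‖ ^ 2 * ‖w‖ ^ 2 * ‖z‖ := by ring
      _ ≤ _ := by gcongr
  have b2 : M * ‖w‖ ^ 4 * ‖z‖ ≤ M * δ ^ 2 * ‖w‖ ^ 2 * ‖z‖ := by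
    calc M * ‖w‖ ^ 4 * ‖z‖ = M * ‖w‖ ^ 2 * ‖w‖ ^ 2 * ‖z‖ := by ring
      _ ≤ _ := by gcongr
  rw [abs_le] at *
  constructor <;> linarith

end Lines

end LPS

end

noncomputable section

namespace LPS

variable {d : ℕ}

/-! ### Contractions of the second derivative against the moments. -/

section Contraction

theorem sum_inner_single_smul (w : E d) :
    ∑ i, ⟪w, EuclideanSpace.single i (1 : ℝ)⟫ • (EuclideanSpace.single i (1 : ℝ) : E d) = w := by
  have h := (EuclideanSpace.basisFun (Fin d) ℝ).sum_repr' w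
  simp only [EuclideanSpace.basisFun_apply] at h
  conv_rhs => rw [← h]
  exact Finset.sum_congr rfl fun i _ => by rw [real_inner_comm]

/-- The contraction `∑ᵢ H(eᵢ, ·)ᵢ` of a bilinear map, as a vector: the gradient of the divergence if
`H` is a second derivative. -/
def gradDiv (H : E d →L[ℝ] E d →L[ℝ] E d) : E d :=
  ∑ j, (∑ i, ⟪(EuclideanSpace.single i (1 : ℝ) : E d),
    H (EuclideanSpace.single i 1) (EuclideanSpace.single j 1)⟫) • EuclideanSpace.single j 1

/-- The contraction `∑ᵢ H(eᵢ, eᵢ)`: the Laplacian if `H` is a second derivative. -/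
def laplace (H : E d →L[ℝ] E d →L[ℝ] E d) : E d :=
  ∑ i, H (EuclideanSpace.single i 1) (EuclideanSpace.single i 1)

theorem inner_gradDiv (H : E d →L[ℝ] E d →L[ℝ] E d) (z : E d) :
    ⟪gradDiv H, z⟫ = ∑ i, ⟪(EuclideanSpace.single i (1 : ℝ) : E d),
      H (EuclideanSpace.single i 1) z⟫ := by
  conv_rhs =>
    enter [2, i]
    rw [← sum_inner_single_smul z, map_sum, inner_sum]
  rw [Finset.sum_comm, gradDiv, sum_inner]
  refine Finset.sum_congr rfl fun j _ => ?_
  rw [real_inner_smul_left, Finset.sum_mul]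
  refine Finset.sum_congr rfl fun i _ => ?_
  rw [map_smul, real_inner_smul_right, real_inner_comm z]
  ring

variable {δ : ℝ} {γ : ℝ → ℝ}

theorem IsKernel.integrable_inner_clm (K : IsKernel d δ γ) (B : E d →L[ℝ] E d) :
    Integrable fun w : E d => γ ‖w‖ * ⟪w, B w⟫ := by
  refine K.integrable_of_norm_le (Measurable.aestronglyMeasurable
    (K.measurable_comp_norm.mul (by fun_prop))) (δ ^ 2 * ‖B‖) fun w => ?_
  rw [norm_mul, Real.norm_of_nonneg (K.nonneg _)]
  have hk := K.nonneg ‖w‖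
  calc γ ‖w‖ * ‖⟪w, B w⟫‖ ≤ γ ‖w‖ * (‖w‖ * (‖B‖ * ‖w‖)) := by
        gcongr
        exact (norm_inner_le_norm _ _).trans (by gcongr; exact B.le_opNorm w)
    _ = (γ ‖w‖ * ‖w‖ ^ 2) * ‖B‖ := by ring
    _ ≤ (δ ^ 2 * γ ‖w‖) * ‖B‖ :=
        mul_le_mul_of_nonneg_right (K.mul_norm_pow_le 2 w) (norm_nonneg _)
    _ = _ := by ring

theorem IsKernel.integral_inner_clm (K : IsKernel d δ γ) (B : E d →L[ℝ] E d) :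
    d * ∫ w : E d, γ ‖w‖ * ⟪w, B w⟫ = weightedVolume d δ γ *
      ∑ i, ⟪(EuclideanSpace.single i (1 : ℝ) : E d), B (EuclideanSpace.single i 1)⟫ := by
  have h : ∀ w : E d, γ ‖w‖ * ⟪w, B w⟫ = ∑ i, γ ‖w‖ *
      (⟪w, EuclideanSpace.single i (1 : ℝ)⟫ * ⟪w, B (EuclideanSpace.single i 1)⟫) := fun w => by
    conv_lhs => rw [← sum_inner_single_smul w]
    rw [map_sum, inner_sum, sum_inner_single_smul, Finset.mul_sum]
    refine Finset.sum_congr rfl fun i _ => ?_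
    rw [map_smul, real_inner_smul_right]
  simp_rw [h]
  rw [integral_finsetSum _ fun i _ => K.integrable_mul_inner_mul_inner _ _, Finset.mul_sum,
    Finset.mul_sum]
  exact Finset.sum_congr rfl fun i _ => K.second_moment _ _

theorem IsKernel.integrable_fourth (K : IsKernel d δ γ) (a b c e : E d) :
    Integrable fun z : E d => γ ‖z‖ / ‖z‖ ^ 2 * (⟪z, a⟫ * ⟪z, b⟫ * ⟪z, c⟫ * ⟪z, e⟫) := by
  refine K.integrable_of_norm_le (Measurable.aestronglyMeasurable
    ((K.measurable_comp_norm.div (by fun_prop)).mul (by fun_prop)))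
    (δ ^ 2 * (‖a‖ * ‖b‖ * ‖c‖ * ‖e‖)) fun z => ?_
  have hk := K.nonneg ‖z‖
  rw [norm_mul, Real.norm_of_nonneg (div_nonneg hk (by positivity)), norm_mul, norm_mul, norm_mul]
  calc γ ‖z‖ / ‖z‖ ^ 2 * (‖⟪z, a⟫‖ * ‖⟪z, b⟫‖ * ‖⟪z, c⟫‖ * ‖⟪z, e⟫‖)
      ≤ γ ‖z‖ / ‖z‖ ^ 2 * ((‖z‖ * ‖a‖) * (‖z‖ * ‖b‖) * (‖z‖ * ‖c‖) * (‖z‖ * ‖e‖)) := by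
        gcongr <;> exact norm_inner_le_norm _ _
    _ = (γ ‖z‖ * ‖z‖ ^ 2) * (‖a‖ * ‖b‖ * ‖c‖ * ‖e‖) := by
        rcases eq_or_ne ‖z‖ 0 with h | h
        · simp [h]
        · field_simp
    _ ≤ (δ ^ 2 * γ ‖z‖) * (‖a‖ * ‖b‖ * ‖c‖ * ‖e‖) :=
        mul_le_mul_of_nonneg_right (K.mul_norm_pow_le 2 z) (by positivity)
    _ = _ := by ring

/-- Of the three pairings in the isotropic 4-tensor one gives the Laplacian; the other two both give
the gradient of the divergence, by symmetry of `H`. -/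
theorem IsKernel.integral_bilinear (K : IsKernel d δ γ) {H : E d →L[ℝ] E d →L[ℝ] E d}
    (hH : ∀ v w, H v w = H w v) (a : E d) :
    (Integrable fun z : E d => γ ‖z‖ / ‖z‖ ^ 2 * (⟪z, H z z⟫ * ⟪z, a⟫)) ∧
    d * (d + 2) * ∫ z : E d, γ ‖z‖ / ‖z‖ ^ 2 * (⟪z, H z z⟫ * ⟪z, a⟫) =
      weightedVolume d δ γ * (⟪laplace H, a⟫ + 2 * ⟪gradDiv H, a⟫) := by
  set b : Fin d → E d := fun i => EuclideanSpace.single i (1 : ℝ) with hb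
  have h : (fun z : E d => γ ‖z‖ / ‖z‖ ^ 2 * (⟪z, H z z⟫ * ⟪z, a⟫)) = fun z : E d =>
      ∑ i, ∑ j, γ ‖z‖ / ‖z‖ ^ 2 * (⟪z, b i⟫ * ⟪z, b j⟫ * ⟪z, H (b i) (b j)⟫ * ⟪z, a⟫) := by
    ext z
    have h1 : ⟪z, H z z⟫ = ∑ i, ∑ j, ⟪z, b i⟫ * ⟪z, b j⟫ * ⟪z, H (b i) (b j)⟫ := by
      have h2 : H z z = ∑ i, ∑ j, (⟪z, b i⟫ * ⟪z, b j⟫) • H (b i) (b j) := by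
        have h3 : ∀ B : E d →L[ℝ] E d, B z = ∑ j, ⟪z, b j⟫ • B (b j) := fun B => by
          conv_lhs => rw [← sum_inner_single_smul z]
          rw [map_sum]
          exact Finset.sum_congr rfl fun j _ => map_smul _ _ _
        have h4 := h3 (H.flip z)
        simp only [ContinuousLinearMap.flip_apply] at h4
        rw [h4]
        refine Finset.sum_congr rfl fun i _ => ?_
        rw [h3 (H (b i)), Finset.smul_sum]
        exact Finset.sum_congr rfl fun j _ => smul_smul _ _ _
      rw [h2, inner_sum]
      refine Finset.sum_congr rfl fun i _ => ?_
      rw [inner_sum]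
      exact Finset.sum_congr rfl fun j _ => real_inner_smul_right _ _ _
    rw [h1, Finset.sum_mul, Finset.mul_sum]
    refine Finset.sum_congr rfl fun i _ => ?_
    rw [Finset.sum_mul, Finset.mul_sum]
  have hItg : ∀ i j, Integrable fun z : E d =>
      γ ‖z‖ / ‖z‖ ^ 2 * (⟪z, b i⟫ * ⟪z, b j⟫ * ⟪z, H (b i) (b j)⟫ * ⟪z, a⟫) := fun i j =>
    K.integrable_fourth _ _ _ _
  rw [h]
  refine ⟨integrable_finsetSum _ fun i _ => integrable_finsetSum _ fun j _ => hItg i j, ?_⟩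
  rw [integral_finsetSum _ fun i _ => integrable_finsetSum _ fun j _ => hItg i j]
  simp_rw [integral_finsetSum _ fun j _ => hItg _ j, Finset.mul_sum, K.fourth_moment]
  simp_rw [← Finset.mul_sum]
  congr 1
  simp_rw [Finset.sum_add_distrib]
  have hbb : ∀ i j, ⟪b i, b j⟫ = if i = j then (1 : ℝ) else 0 := fun i j => by
    simp [hb, EuclideanSpace.inner_single_right, eq_comm]
  have e1 : ∑ i, ∑ j, ⟪b i, b j⟫ * ⟪H (b i) (b j), a⟫ = ⟪laplace H, a⟫ := by
    rw [laplace, sum_inner]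
    refine Finset.sum_congr rfl fun i _ => ?_
    simp only [hbb, ite_mul, one_mul, zero_mul, Finset.sum_ite_eq, Finset.mem_univ, if_true]
    rfl
  have e2 : ∑ i, ∑ j, ⟪b i, H (b i) (b j)⟫ * ⟪b j, a⟫ = ⟪gradDiv H, a⟫ := by
    rw [Finset.sum_comm, gradDiv, sum_inner]
    refine Finset.sum_congr rfl fun j _ => ?_
    rw [real_inner_smul_left, Finset.sum_mul]
  have e3 : ∑ i, ∑ j, ⟪b i, a⟫ * ⟪b j, H (b i) (b j)⟫ = ⟪gradDiv H, a⟫ := by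
    rw [← e2, Finset.sum_comm]
    refine Finset.sum_congr rfl fun i _ => Finset.sum_congr rfl fun j _ => ?_
    rw [hH (b j) (b i), mul_comm]
  rw [e1, e2, e3]
  ring

end Contraction

/-! ### Central symmetrization of the integrals. -/

section Symmetrize

/-- If the whole horizon is available the domain no longer matters, and the integral becomes one
over a symmetric set of bonds. -/
theorem setIntegral_eq_integral_shift {G : Type*} [NormedAddCommGroup G] [NormedSpace ℝ G]
    {D : Set (E d)} {x : E d} {δ : ℝ} (hx : Metric.ball x δ ⊆ D) {f : E d → G}
    (hf : ∀ y, δ ≤ ‖y - x‖ → f y = 0) : ∫ y in D, f y = ∫ z, f (x + z) := by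
  rw [integral_add_left_eq_self f x]
  refine setIntegral_eq_integral_of_forall_compl_eq_zero fun y hy => hf y ?_
  by_contra! h
  exact hy (hx (by rwa [Metric.mem_ball, dist_eq_norm]))

theorem integral_eq_integral_symm {f : E d → ℝ} (hf : Integrable f) :
    ∫ z, f z = ∫ z, (f z + f (-z)) / 2 := by
  have h := integral_neg_eq_self f volume
  rw [integral_div, integral_add hf hf.comp_neg, h]
  ring

variable {δ : ℝ} {γ : ℝ → ℝ} {Ω : Set (E d)} {u : E d → E d} {M : ℝ}

theorem IsKernel.integrable_mul_inner_of_bounded (K : IsKernel d δ γ) {g : E d → E d}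
    (hg : Measurable g) {B : ℝ} (hB : ∀ w, ‖g w‖ ≤ B) :
    Integrable fun w : E d => γ ‖w‖ * ⟪w, g w⟫ := by
  have hB0 : 0 ≤ B := (norm_nonneg _).trans (hB 0)
  refine K.integrable_of_norm_le (Measurable.aestronglyMeasurable
    (K.measurable_comp_norm.mul (by fun_prop))) (δ * B) fun w => ?_
  rw [norm_mul, Real.norm_of_nonneg (K.nonneg _)]
  have hk := K.nonneg ‖w‖
  calc γ ‖w‖ * ‖⟪w, g w⟫‖ ≤ γ ‖w‖ * (‖w‖ * B) := by
        gcongr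
        exact (norm_inner_le_norm _ _).trans (by gcongr; exact hB w)
    _ = (γ ‖w‖ * ‖w‖) * B := by ring
    _ ≤ (γ ‖w‖ * δ) * B := mul_le_mul_of_nonneg_right (K.mul_norm_le w) hB0
    _ = _ := by ring

/-- The dilatation of `u` at a point whose whole horizon is available, in symmetrized form. -/
def symDilatation (δ : ℝ) (γ : ℝ → ℝ) (u : E d → E d) (x : E d) : ℝ :=
  d / (2 * weightedVolume d δ γ) * ∫ w : E d, γ ‖w‖ * ⟪w, u (x + w) - u (x - w)⟫

theorem IsKernel.integrable_symDilatation (K : IsKernel d δ γ) (hu : Measurable u)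
    (hub : ∀ x, ‖u x‖ ≤ M) (x : E d) :
    Integrable fun w : E d => γ ‖w‖ * ⟪w, u (x + w) - u (x - w)⟫ :=
  K.integrable_mul_inner_of_bounded (B := M + M) (by fun_prop)
    fun w => (norm_sub_le _ _).trans (add_le_add (hub _) (hub _))

theorem IsKernel.dilatation_eq_symDilatation (K : IsKernel d δ γ) (hu : Measurable u)
    (hub : ∀ x, ‖u x‖ ≤ M) {x : E d} (hx : Metric.ball x δ ⊆ fullDomain Ω δ) :
    dilatation Ω δ γ u x = symDilatation δ γ u x := by
  have hItg : Integrable fun w : E d => γ ‖w‖ * ⟪w, u (x + w) - u x⟫ :=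
    K.integrable_mul_inner_of_bounded (B := M + M) (by fun_prop)
      fun w => (norm_sub_le _ _).trans (add_le_add (hub _) (hub _))
  unfold dilatation symDilatation
  rw [setIntegral_eq_integral_shift hx fun y hy => by rw [K.zero _ hy, zero_mul]]
  simp only [add_sub_cancel_left]
  rw [integral_eq_integral_symm hItg, integral_div, mul_div_assoc', div_mul_eq_mul_div,
    div_mul_eq_mul_div, div_div, mul_comm 2]
  congr 3
  ext w
  simp only [norm_neg, inner_neg_left, inner_sub_right, ← sub_eq_add_neg]
  ring

theorem IsKernel.measurable_symDilatation (K : IsKernel d δ γ) (hu : Measurable u) :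
    Measurable (symDilatation δ γ u) := by
  have hF : StronglyMeasurable (fun p : E d × E d =>
      γ ‖p.2‖ * ⟪p.2, u (p.1 + p.2) - u (p.1 - p.2)⟫) :=
    ((K.measurable_comp_norm.comp measurable_snd).mul (by fun_prop)).stronglyMeasurable
  exact (hF.integral_prod_right' (ν := volume)).measurable.const_mul _

theorem IsKernel.exists_abs_symDilatation_le (K : IsKernel d δ γ)
    (hub : ∀ x, ‖u x‖ ≤ M) : ∃ B : ℝ, ∀ x, |symDilatation δ γ u x| ≤ B := by
  refine ⟨|d / (2 * weightedVolume d δ γ)| * ∫ w : E d, δ * (M + M) * γ ‖w‖, fun x => ?_⟩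
  have hM : 0 ≤ M := (norm_nonneg _).trans (hub 0)
  rw [symDilatation, abs_mul]
  gcongr
  rw [← Real.norm_eq_abs]
  refine norm_integral_le_of_norm_le (K.integrable.const_mul _)
    (Filter.Eventually.of_forall fun w => ?_)
  rw [norm_mul, Real.norm_of_nonneg (K.nonneg _)]
  have hk := K.nonneg ‖w‖
  calc γ ‖w‖ * ‖⟪w, u (x + w) - u (x - w)⟫‖ ≤ γ ‖w‖ * (‖w‖ * (M + M)) := by
        gcongr
        refine (norm_inner_le_norm _ _).trans ?_
        gcongr
        exact (norm_sub_le _ _).trans (add_le_add (hub _) (hub _))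
    _ = (γ ‖w‖ * ‖w‖) * (M + M) := by ring
    _ ≤ (γ ‖w‖ * δ) * (M + M) := mul_le_mul_of_nonneg_right (K.mul_norm_le w) (by positivity)
    _ = _ := by ring

end Symmetrize

end LPS

end

/-! ### Consistency with the Navier operator. -/

noncomputable section

namespace LPS

variable {d : ℕ} {δ : ℝ} {γ : ℝ → ℝ} {Ω : Set (E d)} {u : E d → E d} {M : ℝ} {x : E d}

theorem add_smul_mem_of_ball_subset {D : Set (E d)} (hx : Metric.ball x (2 * δ) ⊆ D)
    {z w : E d} (hz : ‖z‖ < δ) (hw : ‖w‖ < δ) {s t : ℝ} (hs : s ∈ Icc (-1 : ℝ) 1)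
    (ht : t ∈ Icc (-1 : ℝ) 1) : x + s • z + t • w ∈ D := by
  refine hx ?_
  have hsmul : ∀ (r : ℝ) (v : E d), r ∈ Icc (-1 : ℝ) 1 → ‖r • v‖ ≤ ‖v‖ := fun r v hr => by
    rw [norm_smul]
    exact mul_le_of_le_one_left (norm_nonneg _) (abs_le.2 hr)
  rw [Metric.mem_ball, dist_eq_norm, add_assoc, add_sub_cancel_left]
  have h1 := hsmul s z hs
  have h2 := hsmul t w ht
  have h3 := norm_add_le (s • z) (t • w)
  linarith

/-- The difference of dilatations is a kernel average of mixed differences of `u`, whose leading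
part is evaluated by the second moment. Estimating the difference directly, and not each dilatation,
is what keeps the factor `‖z‖`. -/
theorem IsKernel.abs_symDilatation_sub_le (K : IsKernel d δ γ) (hd : 1 ≤ d) (hδ : 0 < δ)
    (hu : Measurable u) (hub : ∀ x, ‖u x‖ ≤ M) {D : Set (E d)} (hD : IsOpen D)
    (huC : ContDiffOn ℝ 4 u D) (hM : ∀ k ≤ 4, ∀ x ∈ D, ‖iteratedFDeriv ℝ k u x‖ ≤ M)
    (hx : Metric.ball x (2 * δ) ⊆ D) {z : E d} (hz : ‖z‖ < δ) :
    |symDilatation δ γ u (x + z) - symDilatation δ γ u (x - z) -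
      2 * ⟪gradDiv (fderiv ℝ (fderiv ℝ u) x), z⟫| ≤ 4 * d * M * δ ^ 2 * ‖z‖ := by
  have hM0 : 0 ≤ M := (norm_nonneg _).trans (hub 0)
  have hm := K.weightedVolume_pos hd hδ
  set m := weightedVolume d δ γ with hmdef
  set H := fderiv ℝ (fderiv ℝ u) x with hH
  have hd0 : (0 : ℝ) < d := by exact_mod_cast hd
  have i1 := K.integrable_symDilatation hu hub (x + z)
  have i2 := K.integrable_symDilatation hu hub (x - z)
  have i3 : Integrable fun w : E d => 4 * (γ ‖w‖ * ⟪w, H.flip z w⟫) :=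
    (K.integrable_inner_clm (H.flip z)).const_mul 4
  have hlin : 2 * ⟪gradDiv H, z⟫ =
      d / (2 * m) * ∫ w : E d, 4 * (γ ‖w‖ * ⟪w, H.flip z w⟫) := by
    rw [integral_const_mul, inner_gradDiv]
    have := K.integral_inner_clm (H.flip z)
    simp only [ContinuousLinearMap.flip_apply] at this ⊢
    rw [← hmdef] at this
    field_simp
    linarith
  have i12 : Integrable fun w : E d => γ ‖w‖ * ⟪w, u (x + z + w) - u (x + z - w)⟫ -
      γ ‖w‖ * ⟪w, u (x - z + w) - u (x - z - w)⟫ := i1.sub i2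
  rw [hlin, symDilatation, symDilatation, ← hmdef, ← mul_sub, ← mul_sub, ← integral_sub i1 i2,
    ← integral_sub i12 i3, abs_mul, abs_of_pos (by positivity)]
  have hb : ∀ w : E d, ‖(γ ‖w‖ * ⟪w, u (x + z + w) - u (x + z - w)⟫ -
      γ ‖w‖ * ⟪w, u (x - z + w) - u (x - z - w)⟫) - 4 * (γ ‖w‖ * ⟪w, H.flip z w⟫)‖ ≤
      8 * M * δ ^ 2 * ‖z‖ * (γ ‖w‖ * ‖w‖ ^ 2) := by
    intro w
    rcases le_or_gt δ ‖w‖ with hw | hw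
    · simp [K.zero _ hw]
    have h := mixed_difference_le hD huC hM hz.le hw.le hM0 fun s hs t ht =>
      add_smul_mem_of_ball_subset hx hz hw hs ht
    have h1 : (γ ‖w‖ * ⟪w, u (x + z + w) - u (x + z - w)⟫ -
      γ ‖w‖ * ⟪w, u (x - z + w) - u (x - z - w)⟫) - 4 * (γ ‖w‖ * ⟪w, H.flip z w⟫) =
      γ ‖w‖ * (⟪w, u (x + z + w) - u (x + z - w) - (u (x - z + w) - u (x - z - w))⟫ -
        4 * ⟪w, H w z⟫) := by
      rw [inner_sub_right w (u (x + z + w) - u (x + z - w)), ContinuousLinearMap.flip_apply]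
      ring
    rw [h1, norm_mul, Real.norm_of_nonneg (K.nonneg _), Real.norm_eq_abs]
    calc _ ≤ γ ‖w‖ * (8 * M * δ ^ 2 * ‖w‖ ^ 2 * ‖z‖) :=
          mul_le_mul_of_nonneg_left h (K.nonneg _)
      _ = _ := by ring
  have hle := norm_integral_le_of_norm_le
    ((K.integrable_mul_norm_pow 2).const_mul (8 * M * δ ^ 2 * ‖z‖)) (Filter.Eventually.of_forall hb)
  rw [integral_const_mul, ← K.weightedVolume_eq, Real.norm_eq_abs] at hle
  calc _ ≤ d / (2 * m) * (8 * M * δ ^ 2 * ‖z‖ * m) :=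
        mul_le_mul_of_nonneg_left hle (by positivity)
    _ = _ := by
        field_simp
        ring

/-- Symmetrization leaves only the odd part `(Θ (x + z) - Θ (x - z)) / 2`; its linear approximation
against `z` is once more a second moment. -/
theorem IsKernel.abs_inner_dilatationForce_sub_le (K : IsKernel d δ γ) (hd : 1 ≤ d) (hδ : 0 < δ)
    (hu : Measurable u) (hub : ∀ x, ‖u x‖ ≤ M) (huC : ContDiffOn ℝ 4 u (fullDomain Ω δ))
    (hM : ∀ k ≤ 4, ∀ x ∈ fullDomain Ω δ, ‖iteratedFDeriv ℝ k u x‖ ≤ M)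
    (hx : Metric.ball x (2 * δ) ⊆ fullDomain Ω δ) (c : ℝ) (a : E d) :
    |d / weightedVolume d δ γ * ⟪a, ∫ y in fullDomain Ω δ, (c * γ ‖y - x‖ *
        (dilatation Ω δ γ u x + dilatation Ω δ γ u y)) • (y - x)⟫ -
      c * ⟪gradDiv (fderiv ℝ (fderiv ℝ u) x), a⟫| ≤ 2 * d ^ 2 * |c| * M * δ ^ 2 * ‖a‖ := by
  have hM0 : 0 ≤ M := (norm_nonneg _).trans (hub 0)
  have hm := K.weightedVolume_pos hd hδ
  set m := weightedVolume d δ γ with hmdef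
  set H := fderiv ℝ (fderiv ℝ u) x with hH
  set Θ := symDilatation δ γ u with hΘ
  have hd0 : (0 : ℝ) < d := by exact_mod_cast hd
  obtain ⟨B, hB⟩ := K.exists_abs_symDilatation_le hub
  have hΘm : Measurable Θ := K.measurable_symDilatation hu
  have hball : ∀ z : E d, ‖z‖ < δ → dilatation Ω δ γ u (x + z) = Θ (x + z) := fun z hz => by
    refine K.dilatation_eq_symDilatation hu hub (subset_trans ?_ hx)
    refine Metric.ball_subset_ball' ?_
    rw [dist_eq_norm, add_sub_cancel_left]
    linarith
  have hx0 : dilatation Ω δ γ u x = Θ x := by simpa using hball 0 (by simpa using hδ)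
  have hshift : ∫ y in fullDomain Ω δ, (c * γ ‖y - x‖ *
        (dilatation Ω δ γ u x + dilatation Ω δ γ u y)) • (y - x) =
      ∫ z : E d, (c * γ ‖z‖ * (Θ x + Θ (x + z))) • z := by
    rw [setIntegral_eq_integral_shift
      ((Metric.ball_subset_ball (by linarith)).trans hx : Metric.ball x δ ⊆ _)
      fun y hy => by rw [K.zero _ hy, mul_zero, zero_mul, zero_smul]]
    congr 1
    ext1 z
    rw [add_sub_cancel_left, hx0]
    rcases lt_or_ge ‖z‖ δ with hz | hz
    · rw [hball z hz]
    · rw [K.zero _ hz, mul_zero, zero_mul, zero_mul]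
  have hItg : Integrable fun z : E d => (c * γ ‖z‖ * (Θ x + Θ (x + z))) • z := by
    refine K.integrable_of_norm_le (Measurable.aestronglyMeasurable
      (Measurable.smul ((K.measurable_comp_norm.const_mul c).mul
        (measurable_const.add (hΘm.comp (by fun_prop)))) measurable_id)) (|c| * (B + B) * δ)
      fun z => ?_
    rw [norm_smul, norm_mul, norm_mul, Real.norm_eq_abs c, Real.norm_of_nonneg (K.nonneg _)]
    have h1 : ‖Θ x + Θ (x + z)‖ ≤ B + B :=
      (norm_add_le _ _).trans (add_le_add (hB _) (hB _))
    have hk := K.nonneg ‖z‖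
    calc |c| * γ ‖z‖ * ‖Θ x + Θ (x + z)‖ * ‖z‖ = |c| * ‖Θ x + Θ (x + z)‖ * (γ ‖z‖ * ‖z‖) := by
          ring
      _ ≤ |c| * (B + B) * (γ ‖z‖ * δ) :=
          mul_le_mul (mul_le_mul_of_nonneg_left h1 (abs_nonneg _)) (K.mul_norm_le z)
            (by positivity) (mul_nonneg (abs_nonneg _) ((norm_nonneg _).trans h1))
      _ = _ := by ring
  have hinner : ⟪a, ∫ z : E d, (c * γ ‖z‖ * (Θ x + Θ (x + z))) • z⟫ =
      ∫ z : E d, c / 2 * (γ ‖z‖ * ((Θ (x + z) - Θ (x - z)) * ⟪z, a⟫)) := by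
    rw [← integral_inner hItg a, integral_eq_integral_symm (hItg.const_inner (𝕜 := ℝ) a)]
    congr 1
    ext1 z
    simp only [norm_neg, real_inner_smul_right, inner_neg_right, ← sub_eq_add_neg,
      real_inner_comm a z]
    ring
  have hItg' : Integrable fun z : E d =>
      c / 2 * (γ ‖z‖ * ((Θ (x + z) - Θ (x - z)) * ⟪z, a⟫)) := by
    have h1 := hItg.const_inner (𝕜 := ℝ) a
    refine ((h1.add h1.comp_neg).div_const 2).congr (Filter.Eventually.of_forall fun z => ?_)
    simp only [norm_neg, real_inner_smul_right, inner_neg_right, ← sub_eq_add_neg,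
      real_inner_comm a z, Pi.add_apply]
    ring
  have hlin : c * ⟪gradDiv H, a⟫ =
      d / m * ∫ z : E d, c * (γ ‖z‖ * (⟪z, gradDiv H⟫ * ⟪z, a⟫)) := by
    rw [integral_const_mul]
    have := K.second_moment (gradDiv H) a
    rw [← hmdef] at this
    generalize ∫ z : E d, γ ‖z‖ * (⟪z, gradDiv H⟫ * ⟪z, a⟫) = I at this ⊢
    field_simp
    linear_combination (-c) * this
  rw [hshift, hinner, hlin, ← mul_sub, ← integral_sub hItg'
    ((K.integrable_mul_inner_mul_inner _ _).const_mul c), abs_mul, abs_of_pos (by positivity)]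
  have hb : ∀ z : E d, ‖c / 2 * (γ ‖z‖ * ((Θ (x + z) - Θ (x - z)) * ⟪z, a⟫)) -
      c * (γ ‖z‖ * (⟪z, gradDiv H⟫ * ⟪z, a⟫))‖ ≤
      2 * d * |c| * M * δ ^ 2 * ‖a‖ * (γ ‖z‖ * ‖z‖ ^ 2) := by
    intro z
    rcases le_or_gt δ ‖z‖ with hz | hz
    · simp [K.zero _ hz]
    have h := K.abs_symDilatation_sub_le hd hδ hu hub (isOpen_fullDomain hδ) huC hM hx hz
    rw [real_inner_comm (gradDiv H) z]
    have h1 : c / 2 * (γ ‖z‖ * ((Θ (x + z) - Θ (x - z)) * ⟪z, a⟫)) -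
      c * (γ ‖z‖ * (⟪gradDiv H, z⟫ * ⟪z, a⟫)) =
      c / 2 * γ ‖z‖ * (Θ (x + z) - Θ (x - z) - 2 * ⟪gradDiv H, z⟫) * ⟪z, a⟫ := by ring
    rw [h1, norm_mul, norm_mul, norm_mul, Real.norm_of_nonneg (K.nonneg _), Real.norm_eq_abs,
      Real.norm_eq_abs (_ - _), abs_div, abs_two]
    have hk := K.nonneg ‖z‖
    calc |c| / 2 * γ ‖z‖ * |Θ (x + z) - Θ (x - z) - 2 * ⟪gradDiv H, z⟫| * ‖⟪z, a⟫‖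
        ≤ |c| / 2 * γ ‖z‖ * (4 * d * M * δ ^ 2 * ‖z‖) * (‖z‖ * ‖a‖) := by
          gcongr
          exact norm_inner_le_norm _ _
      _ = _ := by ring
  have hle := norm_integral_le_of_norm_le
    ((K.integrable_mul_norm_pow 2).const_mul (2 * d * |c| * M * δ ^ 2 * ‖a‖))
    (Filter.Eventually.of_forall hb)
  rw [integral_const_mul, ← K.weightedVolume_eq, Real.norm_eq_abs] at hle
  calc _ ≤ d / m * (2 * d * |c| * M * δ ^ 2 * ‖a‖ * m) :=
        mul_le_mul_of_nonneg_left hle (by positivity)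
    _ = _ := by
        field_simp

/-- Symmetrization produces second differences of `u`, whose leading part is a fourth moment. The
remainder of order `‖z‖ ^ 5`, times `‖z‖ / ‖z‖ ^ 2`, is at most `δ ^ 2 * ‖z‖ ^ 2`. -/
theorem IsKernel.abs_inner_bondForce_sub_le (K : IsKernel d δ γ) (hd : 1 ≤ d) (hδ : 0 < δ)
    (hu : Measurable u) (hub : ∀ x, ‖u x‖ ≤ M) {D : Set (E d)} (hD : IsOpen D)
    (huC : ContDiffOn ℝ 4 u D) (hM : ∀ k ≤ 4, ∀ x ∈ D, ‖iteratedFDeriv ℝ k u x‖ ≤ M)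
    (hx : Metric.ball x (2 * δ) ⊆ D) (c : ℝ) (a : E d) :
    |2 * (d : ℝ) * (d + 2) / weightedVolume d δ γ * ⟪a, ∫ y in D, (c * γ ‖y - x‖ *
        (⟪y - x, u y - u x⟫ / ‖y - x‖ ^ 2)) • (y - x)⟫ -
      c * (⟪laplace (fderiv ℝ (fderiv ℝ u) x), a⟫ +
        2 * ⟪gradDiv (fderiv ℝ (fderiv ℝ u) x), a⟫)| ≤
      2 * d * (d + 2) * |c| * M * δ ^ 2 * ‖a‖ := by
  have hM0 : 0 ≤ M := (norm_nonneg _).trans (hub 0)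
  have hm := K.weightedVolume_pos hd hδ
  set m := weightedVolume d δ γ with hmdef
  set H := fderiv ℝ (fderiv ℝ u) x with hH
  have hd0 : (0 : ℝ) < d := by exact_mod_cast hd
  have hxD : x ∈ D := hx (Metric.mem_ball_self (by linarith))
  have hsymm : ∀ v w, H v w = H w v := fun v w =>
    (huC.contDiffAt (hD.mem_nhds hxD)).isSymmSndFDerivAt
      (by rw [minSmoothness_of_isRCLikeNormedField]; norm_num) v w
  have hshift : ∫ y in D, (c * γ ‖y - x‖ * (⟪y - x, u y - u x⟫ / ‖y - x‖ ^ 2)) • (y - x) =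
      ∫ z : E d, (c * γ ‖z‖ * (⟪z, u (x + z) - u x⟫ / ‖z‖ ^ 2)) • z := by
    rw [setIntegral_eq_integral_shift
      ((Metric.ball_subset_ball (by linarith)).trans hx : Metric.ball x δ ⊆ _)
      fun y hy => by rw [K.zero _ hy, mul_zero, zero_mul, zero_smul]]
    simp only [add_sub_cancel_left]
  have hItg : Integrable fun z : E d =>
      (c * γ ‖z‖ * (⟪z, u (x + z) - u x⟫ / ‖z‖ ^ 2)) • z := by
    refine K.integrable_of_norm_le (Measurable.aestronglyMeasurable
      (Measurable.smul ((K.measurable_comp_norm.const_mul c).mul (by fun_prop)) measurable_id))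
      (|c| * (M + M)) fun z => ?_
    have h := K.norm_bondForce_le c u x (x + z)
    rw [add_sub_cancel_left] at h
    refine h.trans ?_
    have hk := K.nonneg ‖z‖
    calc γ ‖z‖ * (|c| * (‖u x‖ + ‖u (x + z)‖)) ≤ γ ‖z‖ * (|c| * (M + M)) := by
          gcongr <;> exact hub _
      _ = _ := by ring
  have hinner : ⟪a, ∫ z : E d, (c * γ ‖z‖ * (⟪z, u (x + z) - u x⟫ / ‖z‖ ^ 2)) • z⟫ =
      ∫ z : E d, c / 2 * (γ ‖z‖ / ‖z‖ ^ 2 *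
        (⟪z, u (x + z) + u (x - z) - (2 : ℝ) • u x⟫ * ⟪z, a⟫)) := by
    rw [← integral_inner hItg a, integral_eq_integral_symm (hItg.const_inner (𝕜 := ℝ) a)]
    congr 1
    ext1 z
    simp only [norm_neg, real_inner_smul_right, inner_neg_right, inner_neg_left,
      ← sub_eq_add_neg, real_inner_comm a z, inner_add_right, inner_sub_right]
    ring
  have hItg' : Integrable fun z : E d => c / 2 * (γ ‖z‖ / ‖z‖ ^ 2 *
        (⟪z, u (x + z) + u (x - z) - (2 : ℝ) • u x⟫ * ⟪z, a⟫)) := by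
    have h1 := hItg.const_inner (𝕜 := ℝ) a
    refine ((h1.add h1.comp_neg).div_const 2).congr (Filter.Eventually.of_forall fun z => ?_)
    simp only [norm_neg, real_inner_smul_right, inner_neg_right, inner_neg_left,
      ← sub_eq_add_neg, real_inner_comm a z, inner_add_right, inner_sub_right, Pi.add_apply]
    ring
  obtain ⟨hbi, hbil⟩ := K.integral_bilinear hsymm a
  have hlin : c * (⟪laplace H, a⟫ + 2 * ⟪gradDiv H, a⟫) = 2 * (d : ℝ) * (d + 2) / m *
      ∫ z : E d, c / 2 * (γ ‖z‖ / ‖z‖ ^ 2 * (⟪z, H z z⟫ * ⟪z, a⟫)) := by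
    rw [integral_const_mul]
    rw [← hmdef] at hbil
    generalize ∫ z : E d, γ ‖z‖ / ‖z‖ ^ 2 * (⟪z, H z z⟫ * ⟪z, a⟫) = I at hbil ⊢
    field_simp
    linear_combination (-c) * hbil
  rw [hshift, hinner, hlin, ← mul_sub, ← integral_sub hItg' (hbi.const_mul _), abs_mul,
    abs_of_pos (by positivity)]
  have hb : ∀ z : E d, ‖c / 2 * (γ ‖z‖ / ‖z‖ ^ 2 *
        (⟪z, u (x + z) + u (x - z) - (2 : ℝ) • u x⟫ * ⟪z, a⟫)) -
      c / 2 * (γ ‖z‖ / ‖z‖ ^ 2 * (⟪z, H z z⟫ * ⟪z, a⟫))‖ ≤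
      |c| * M * δ ^ 2 * ‖a‖ * (γ ‖z‖ * ‖z‖ ^ 2) := by
    intro z
    rcases le_or_gt δ ‖z‖ with hz | hz
    · simp [K.zero _ hz]
    have h := second_difference_le hD huC hM (x := x) (z := z) fun t ht => by
      have h0 : (0 : ℝ) ∈ Icc (-1 : ℝ) 1 := by constructor <;> norm_num
      simpa using add_smul_mem_of_ball_subset hx hz (w := 0) (by simpa using hδ) ht h0
    have h1 : c / 2 * (γ ‖z‖ / ‖z‖ ^ 2 *
        (⟪z, u (x + z) + u (x - z) - (2 : ℝ) • u x⟫ * ⟪z, a⟫)) -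
      c / 2 * (γ ‖z‖ / ‖z‖ ^ 2 * (⟪z, H z z⟫ * ⟪z, a⟫)) = c / 2 * (γ ‖z‖ / ‖z‖ ^ 2) *
        (⟪z, u (x + z) + u (x - z) - (2 : ℝ) • u x⟫ - ⟪z, H z z⟫) * ⟪z, a⟫ := by ring
    have hk := K.nonneg ‖z‖
    rw [h1, norm_mul, norm_mul, norm_mul, Real.norm_of_nonneg (div_nonneg hk (by positivity)),
      Real.norm_eq_abs, Real.norm_eq_abs (_ - _), abs_div, abs_two]
    calc |c| / 2 * (γ ‖z‖ / ‖z‖ ^ 2) *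
          |⟪z, u (x + z) + u (x - z) - (2 : ℝ) • u x⟫ - ⟪z, H z z⟫| * ‖⟪z, a⟫‖
        ≤ |c| / 2 * (γ ‖z‖ / ‖z‖ ^ 2) * (2 * (M * ‖z‖ ^ 5)) * (‖z‖ * ‖a‖) := by
          gcongr
          exact norm_inner_le_norm _ _
      _ = |c| * M * ‖z‖ ^ 2 * ‖a‖ * (γ ‖z‖ * ‖z‖ ^ 2) := by
          rcases eq_or_ne ‖z‖ 0 with h0 | h0
          · simp [h0]
          · field_simp
      _ ≤ _ := by gcongr
  have hle := norm_integral_le_of_norm_le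
    ((K.integrable_mul_norm_pow 2).const_mul (|c| * M * δ ^ 2 * ‖a‖))
    (Filter.Eventually.of_forall hb)
  rw [integral_const_mul, ← K.weightedVolume_eq, Real.norm_eq_abs] at hle
  calc _ ≤ 2 * (d : ℝ) * (d + 2) / m * (|c| * M * δ ^ 2 * ‖a‖ * m) :=
        mul_le_mul_of_nonneg_left hle (by positivity)
    _ = _ := by
        field_simp

/-- Consistency of the peridynamic operator with the Navier operator, up to `O(δ²)`. -/
theorem IsKernel.norm_lpsOperator_sub_le (K : IsKernel d δ γ) (hd : 1 ≤ d) (hδ : 0 < δ)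
    (hu : Measurable u) (hub : ∀ x, ‖u x‖ ≤ M) (huC : ContDiffOn ℝ 4 u (fullDomain Ω δ))
    (hM : ∀ k ≤ 4, ∀ x ∈ fullDomain Ω δ, ‖iteratedFDeriv ℝ k u x‖ ≤ M)
    (hx : Metric.ball x (2 * δ) ⊆ fullDomain Ω δ) (lam mu : ℝ) :
    ‖lpsOperator lam mu Ω δ γ u x - ((lam + mu) • gradDiv (fderiv ℝ (fderiv ℝ u) x) +
      mu • laplace (fderiv ℝ (fderiv ℝ u) x))‖ ≤
      (2 * d ^ 2 * |lam - mu| + 2 * d * (d + 2) * |mu|) * M * δ ^ 2 := by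
  -- Testing the two scalar estimates against the consistency error itself yields its norm. The
  -- limits add up because `(λ - μ) + 2 μ = λ + μ`.
  set a := lpsOperator lam mu Ω δ γ u x - ((lam + mu) • gradDiv (fderiv ℝ (fderiv ℝ u) x) +
      mu • laplace (fderiv ℝ (fderiv ℝ u) x)) with ha
  have h1 := K.abs_inner_dilatationForce_sub_le hd hδ hu hub huC hM hx (lam - mu) a
  have h2 := K.abs_inner_bondForce_sub_le hd hδ hu hub (isOpen_fullDomain hδ) huC hM hx mu a
  have h3 : ‖a‖ ^ 2 = ⟪a, lpsOperator lam mu Ω δ γ u x⟫ -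
      ((lam + mu) * ⟪gradDiv (fderiv ℝ (fderiv ℝ u) x), a⟫ +
        mu * ⟪laplace (fderiv ℝ (fderiv ℝ u) x), a⟫) := by
    rw [← real_inner_self_eq_norm_sq]
    conv_lhs => rw [ha, inner_sub_left, ← ha, inner_add_left, real_inner_smul_left,
      real_inner_smul_left, real_inner_comm]
  rw [lpsOperator, inner_add_right, real_inner_smul_right, real_inner_smul_right] at h3
  have h4 : ‖a‖ ^ 2 ≤ (2 * d ^ 2 * |lam - mu| + 2 * d * (d + 2) * |mu|) * M * δ ^ 2 * ‖a‖ := by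
    rw [h3]
    rw [abs_le] at h1 h2
    linarith [h1.2, h2.2]
  rcases eq_or_lt_of_le (norm_nonneg a) with h0 | h0
  · rw [← h0]
    have hM0 : 0 ≤ M := (norm_nonneg _).trans (hub 0)
    positivity
  · rw [pow_two] at h4
    exact le_of_mul_le_mul_right h4 h0

end LPS

end

noncomputable section

namespace LPS

variable {d : ℕ}

/-! ### The Navier operator in terms of second derivatives. -/

section Navier

variable {D : Set (E d)} {u : E d → E d} {x : E d}

theorem partialDeriv_apply {y : E d} (h : DifferentiableAt ℝ u y) (i j : Fin d) :
    partialDeriv j (fun y => u y i) y = (fderiv ℝ u y (EuclideanSpace.single j 1)) i := by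
  have h1 := ((EuclideanSpace.proj i : E d →L[ℝ] ℝ).hasFDerivAt (x := u y)).comp y h.hasFDerivAt
  have h2 : HasFDerivAt (fun y => u y i)
      ((EuclideanSpace.proj i : E d →L[ℝ] ℝ).comp (fderiv ℝ u y)) y := h1
  rw [partialDeriv, h2.fderiv]
  rfl

theorem hasFDerivAt_fderiv_apply (h : DifferentiableAt ℝ (fderiv ℝ u) x) (i j : Fin d) :
    HasFDerivAt (fun y => (fderiv ℝ u y (EuclideanSpace.single j 1)) i)
      ((EuclideanSpace.proj i : E d →L[ℝ] ℝ).comp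
        ((fderiv ℝ (fderiv ℝ u) x).flip (EuclideanSpace.single j 1))) x := by
  have h1 := ((ContinuousLinearMap.apply ℝ (E d) (EuclideanSpace.single j (1 : ℝ))).hasFDerivAt
    (x := fderiv ℝ u x)).comp x h.hasFDerivAt
  have h2 := ((EuclideanSpace.proj i : E d →L[ℝ] ℝ).hasFDerivAt
    (x := fderiv ℝ u x (EuclideanSpace.single j 1))).comp x h1
  exact h2

theorem navierOperator_eq (hD : IsOpen D) (hu : ContDiffOn ℝ 4 u D) (hx : x ∈ D) (lam mu : ℝ) :
    navierOperator lam mu u x = (lam + mu) • gradDiv (fderiv ℝ (fderiv ℝ u) x) +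
      mu • laplace (fderiv ℝ (fderiv ℝ u) x) := by
  set H := fderiv ℝ (fderiv ℝ u) x with hH
  set b : Fin d → E d := fun i => EuclideanSpace.single i (1 : ℝ) with hb
  have hat : ∀ y ∈ D, ContDiffAt ℝ 4 u y := fun y hy => hu.contDiffAt (hD.mem_nhds hy)
  have hdiff : ∀ y ∈ D, DifferentiableAt ℝ u y := fun y hy =>
    (hat y hy).differentiableAt (by norm_num)
  have hdd : DifferentiableAt ℝ (fderiv ℝ u) x :=
    ((hat x hx).fderiv_right (m := 1) (by norm_num)).differentiableAt (by norm_num)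
  have hsymm : ∀ v w, H v w = H w v := fun v w =>
    (hat x hx).isSymmSndFDerivAt (by rw [minSmoothness_of_isRCLikeNormedField]; norm_num) v w
  have hpart : ∀ i j, partialDeriv j (fun y => stress lam mu u y i j) x =
      lam * (∑ l, H (b j) (b l) l) * (1 : Matrix (Fin d) (Fin d) ℝ) i j +
        mu * (H (b j) (b j) i + H (b j) (b i) j) := by
    intro i j
    have hev : (fun y => stress lam mu u y i j) =ᶠ[nhds x] fun y =>
        lam * (∑ l, (fderiv ℝ u y (b l)) l) * (1 : Matrix (Fin d) (Fin d) ℝ) i j +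
          mu * ((fderiv ℝ u y (b j)) i + (fderiv ℝ u y (b i)) j) := by
      filter_upwards [hD.mem_nhds hx] with y hy
      simp only [stress, strain, Matrix.trace, Matrix.diag, Matrix.add_apply, Matrix.smul_apply,
        Matrix.of_apply, smul_eq_mul, partialDeriv_apply (hdiff y hy), hb]
      have : ∀ l : Fin d, (1 / 2 : ℝ) * ((fderiv ℝ u y (EuclideanSpace.single l 1)) l +
          (fderiv ℝ u y (EuclideanSpace.single l 1)) l) =
          (fderiv ℝ u y (EuclideanSpace.single l 1)) l := fun l => by ring
      simp only [this]
      ring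
    have hsum := HasFDerivAt.fun_sum (u := Finset.univ)
      fun l _ => hasFDerivAt_fderiv_apply hdd l l
    have hder := ((hsum.const_mul lam).mul_const ((1 : Matrix (Fin d) (Fin d) ℝ) i j)).add
      (((hasFDerivAt_fderiv_apply hdd i j).add (hasFDerivAt_fderiv_apply hdd j i)).const_mul mu)
    rw [partialDeriv, hev.fderiv_eq]
    erw [hder.fderiv]
    simp [hb, hH]
    ring
  ext k
  have h1 : gradDiv H k = ∑ i, H (b i) (b k) i := by
    have h := inner_gradDiv H (b k)
    simpa [hb, EuclideanSpace.inner_single_right, EuclideanSpace.inner_single_left] using h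
  have h2 : laplace H k = ∑ i, H (b i) (b i) k := by
    simp [laplace, hb]
  have h3 : navierOperator lam mu u x k =
      ∑ j, partialDeriv j (fun y => stress lam mu u y k j) x := rfl
  rw [h3, PiLp.add_apply, PiLp.smul_apply, PiLp.smul_apply, h1, h2]
  simp only [hpart, Finset.sum_add_distrib, Matrix.one_apply, mul_ite, mul_one, mul_zero,
    Finset.sum_ite_eq, Finset.mem_univ, if_true, mul_add, ← Finset.mul_sum, smul_eq_mul]
  have h4 : ∑ l, H (b k) (b l) l = ∑ i, H (b i) (b k) i :=
    Finset.sum_congr rfl fun i _ => by rw [hsymm]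
  rw [h4]
  ring

end Navier

/-! ### From residual to energy error. -/

section Estimate

variable {δ : ℝ} {γ : ℝ → ℝ} {Ω : Set (E d)} {e : E d → E d} {lam mu : ℝ}

theorem IsKernel.integrable_inner_lpsOperator (K : IsKernel d δ γ) (hd : 1 ≤ d) (hδ : 0 < δ)
    (lam mu : ℝ) [IsFiniteMeasure (volume.restrict (fullDomain Ω δ))] (he : Measurable e)
    (heL : MemLp e 2 (volume.restrict (fullDomain Ω δ))) :
    Integrable (fun x => ⟪-lpsOperator lam mu Ω δ γ e x, e x⟫)
      (volume.restrict (fullDomain Ω δ)) := by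
  have h1 := (K.integral_inner_dilatationForce hd hδ he heL (lam - mu)).1
  have h2 := (K.integral_inner_bondForce he heL mu).1
  simp only [lpsOperator, inner_neg_left, inner_add_left, real_inner_smul_left]
  exact ((h1.const_mul _).add (h2.const_mul _)).neg

/-- A priori estimate for the energy norm in terms of the residual and a Poincaré constant. -/
theorem IsKernel.lpsNorm_le_of_residual (K : IsKernel d δ γ) (hd : 1 ≤ d) (hδ : 0 < δ)
    (hmu : 0 < mu) (hlam : 0 < d * lam + 2 * mu) (hΩ : MeasurableSet Ω)
    [IsFiniteMeasure (volume.restrict (fullDomain Ω δ))] (he : Measurable e)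
    (heL : MemLp e 2 (volume.restrict (fullDomain Ω δ))) {C B : ℝ} (hC : 0 ≤ C) (hB : 0 ≤ B)
    (hP : ENNReal.ofReal (weightedVolume d δ γ) * ∫⁻ x in Ω, ENNReal.ofReal (‖e x‖ ^ 2) ≤
      ENNReal.ofReal C * pairEnergy (fullDomain Ω δ) γ e)
    (hres : ∀ᵐ x ∂(volume.restrict (fullDomain Ω δ)),
      ⟪-lpsOperator lam mu Ω δ γ e x, e x⟫ ≤ Ω.indicator (fun x => B * ‖e x‖) x) :
    lpsNorm Ω δ γ e ≤ ENNReal.ofReal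
      (√(volume.real Ω * (C + 1)) / min ((d : ℝ) * (d + 2) * mu) (d * (d * lam + 2 * mu)) * B) := by
  have hm := K.weightedVolume_pos hd hδ
  have hd0 : (0 : ℝ) < d := by exact_mod_cast hd
  set m := weightedVolume d δ γ with hmdef
  set D := fullDomain Ω δ with hD
  set c := min ((d : ℝ) * (d + 2) * mu) (d * (d * lam + 2 * mu)) with hc
  have hc0 : 0 < c := lt_min (by positivity) (by positivity)
  have hΩD : Ω ⊆ D := subset_union_left
  have hcoer := K.coercive (lam := lam) (mu := mu) hd hδ he heL
  rw [K.pairEnergy_eq he heL] at hP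
  rw [K.lpsNorm_eq, K.pairEnergy_eq he heL]
  have hS : 0 ≤ ∫ p, energyIntegrand γ e p ∂((volume.restrict D).prod (volume.restrict D)) :=
    integral_nonneg (K.energyIntegrand_nonneg e)
  set S := ∫ p, energyIntegrand γ e p ∂((volume.restrict D).prod (volume.restrict D)) with hSdef
  have hsq : Integrable (fun x => ‖e x‖ ^ 2) (volume.restrict Ω) :=
    (memLp_two_integrable_norm_sq heL).mono_measure (Measure.restrict_mono hΩD le_rfl)
  have hI : m * ∫ x in Ω, ‖e x‖ ^ 2 ≤ C * S := by
    rw [← ofReal_integral_eq_lintegral_ofReal hsq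
      (Filter.Eventually.of_forall fun x => sq_nonneg _), ← ENNReal.ofReal_mul hm.le,
      ← ENNReal.ofReal_mul hC] at hP
    exact (ENNReal.ofReal_le_ofReal_iff (by positivity)).1 hP
  have hfin : volume Ω ≠ ⊤ := by
    refine ne_top_of_le_ne_top ?_ (measure_mono hΩD)
    rw [← Measure.restrict_apply_univ]
    exact measure_ne_top _ _
  have hfinΩ : IsFiniteMeasure (volume.restrict Ω) :=
    ⟨by rw [Measure.restrict_apply_univ]; exact lt_top_iff_ne_top.2 hfin⟩
  -- Young's weight, chosen so that the Poincaré inequality absorbs half of the coercive term; the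
  -- `+ 1` avoids dividing by zero.
  set ε := c / (C + 1) with hε
  have hε0 : 0 < ε := by positivity
  have hItgΩ : Integrable (fun x => ε / 2 * ‖e x‖ ^ 2 + B ^ 2 / (2 * ε)) (volume.restrict Ω) :=
    (hsq.const_mul _).add (integrable_const _)
  have hup : ∫ x in D, ⟪-lpsOperator lam mu Ω δ γ e x, e x⟫ ≤
      ε / 2 * (∫ x in Ω, ‖e x‖ ^ 2) + B ^ 2 / (2 * ε) * volume.real Ω := by
    calc ∫ x in D, ⟪-lpsOperator lam mu Ω δ γ e x, e x⟫
        ≤ ∫ x in D, Ω.indicator (fun x => ε / 2 * ‖e x‖ ^ 2 + B ^ 2 / (2 * ε)) x := by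
          refine integral_mono_ae (K.integrable_inner_lpsOperator hd hδ lam mu he heL) ?_ ?_
          · rw [integrable_indicator_iff hΩ, IntegrableOn, Measure.restrict_restrict hΩ,
              inter_eq_left.2 hΩD]
            exact hItgΩ
          · filter_upwards [hres] with x hx
            refine hx.trans (indicator_le_indicator ?_)
            have h1 : ε / 2 * ‖e x‖ ^ 2 + B ^ 2 / (2 * ε) - B * ‖e x‖ =
                (ε * ‖e x‖ - B) ^ 2 / (2 * ε) := by
              field_simp
              ring
            have h2 : 0 ≤ (ε * ‖e x‖ - B) ^ 2 / (2 * ε) := by positivity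
            linarith
      _ = ∫ x in Ω, (ε / 2 * ‖e x‖ ^ 2 + B ^ 2 / (2 * ε)) := by
          rw [integral_indicator hΩ, Measure.restrict_restrict hΩ, inter_eq_left.2 hΩD]
      _ = _ := by
          rw [integral_add (hsq.const_mul _) (integrable_const _), integral_const_mul,
            setIntegral_const, smul_eq_mul, mul_comm (volume.real Ω)]
  have hX : S / m ≤ volume.real Ω * (C + 1) / c ^ 2 * B ^ 2 := by
    have h1 : c * (S / m) ≤ ε / 2 * (∫ x in Ω, ‖e x‖ ^ 2) + B ^ 2 / (2 * ε) * volume.real Ω := by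
      refine le_trans (le_of_eq ?_) (hcoer.trans hup)
      ring
    have h2 : ∫ x in Ω, ‖e x‖ ^ 2 ≤ (C + 1) * (S / m) := by
      rw [mul_div_assoc', le_div_iff₀ hm]
      linarith
    have h3 : ε / 2 * (∫ x in Ω, ‖e x‖ ^ 2) ≤ c / 2 * (S / m) := by
      calc ε / 2 * (∫ x in Ω, ‖e x‖ ^ 2) ≤ ε / 2 * ((C + 1) * (S / m)) := by gcongr
        _ = _ := by rw [hε]; field_simp
    have h4 : c / 2 * (S / m) ≤ B ^ 2 / (2 * ε) * volume.real Ω := by linarith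
    have h5 : B ^ 2 / (2 * ε) * volume.real Ω =
        c / 2 * (volume.real Ω * (C + 1) / c ^ 2 * B ^ 2) := by
      rw [hε]
      field_simp
    rw [h5] at h4
    exact le_of_mul_le_mul_left h4 (by positivity)
  rw [← ENNReal.ofReal_div_of_pos hm, ENNReal.ofReal_rpow_of_nonneg (by positivity) (by norm_num),
    ← Real.sqrt_eq_rpow]
  refine ENNReal.ofReal_le_ofReal (Real.sqrt_le_iff.2 ⟨by positivity, hX.trans (le_of_eq ?_)⟩)
  rw [mul_pow, div_pow, Real.sq_sqrt (by positivity)]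

/-- This is why the layer has thickness `2 * δ`: the operator at a point of `Ω` uses dilatations at
distance up to `δ`, which look a further `δ` away. -/
theorem ball_subset_fullDomain {x : E d} (hx : x ∈ Ω) (hδ : 0 < δ) :
    Metric.ball x (2 * δ) ⊆ fullDomain Ω δ := by
  rw [fullDomain_eq_thickening hδ]
  exact Metric.ball_subset_thickening hx _

/-- Error estimate for a nonlocal problem whose solution agrees with the local solution on `Z` and
whose flux agrees with that of the local solution on the rest of the interaction domain. -/
theorem IsKernel.lpsNorm_sub_le (K : IsKernel d δ γ) (hd : 1 ≤ d) (hδ : 0 < δ)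
    (hmu : 0 < mu) (hlam : 0 < d * lam + 2 * mu) (hΩ : MeasurableSet Ω) (hΩne : Ω.Nonempty)
    [IsFiniteMeasure (volume.restrict (fullDomain Ω δ))] {ul un s : E d → E d} {M : ℝ}
    (hulC : ContDiffOn ℝ 4 ul (fullDomain Ω δ))
    (hul : ∀ x ∈ fullDomain Ω δ, -navierOperator lam mu ul x = s x)
    (hM : ∀ k ≤ 4, ∀ x ∈ fullDomain Ω δ, ‖iteratedFDeriv ℝ k ul x‖ ≤ M)
    (hun : MemEnergySpace Ω δ γ un)
    (heq : ∀ᵐ x ∂(volume.restrict Ω), -lpsOperator lam mu Ω δ γ un x = s x)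
    {Z Y : Set (E d)} (hZ : MeasurableSet Z) (hY : MeasurableSet Y)
    (hZY : interactionDomain Ω δ ⊆ Y ∪ Z)
    (hunZ : ∀ᵐ x ∂(volume.restrict Z), un x = ul x)
    (hunY : ∀ᵐ x ∂(volume.restrict Y),
      lpsOperator lam mu Ω δ γ un x = lpsOperator lam mu Ω δ γ ul x)
    {C : ℝ} (hC : 0 ≤ C)
    (hP : ∀ e : E d → E d, Measurable e → (∀ x ∈ Z, e x = 0) →
      ENNReal.ofReal (weightedVolume d δ γ) * ∫⁻ x in Ω, ENNReal.ofReal (‖e x‖ ^ 2) ≤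
      ENNReal.ofReal C * pairEnergy (fullDomain Ω δ) γ e) :
    lpsNorm Ω δ γ (un - ul) ≤ ENNReal.ofReal
      (√(volume.real Ω * (C + 1)) / min ((d : ℝ) * (d + 2) * mu) (d * (d * lam + 2 * mu)) *
        ((2 * d ^ 2 * |lam - mu| + 2 * d * (d + 2) * |mu|) * M) * δ ^ 2) := by
  set D := fullDomain Ω δ with hD
  have hDo : IsOpen D := isOpen_fullDomain hδ
  have hΩD : Ω ⊆ D := subset_union_left
  have hM0 : 0 ≤ M := (norm_nonneg _).trans (hM 0 (by norm_num) _ (hΩD hΩne.some_mem))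
  classical
  -- Nothing is known of `ul` off the closure of the domain; the extension by zero is measurable and
  -- globally bounded, and agrees with `ul` near each point of the open set `D`.
  set v : E d → E d := D.piecewise ul 0 with hv
  have hvD : ∀ x ∈ D, v x = ul x := fun x hx => piecewise_eq_of_mem _ _ _ hx
  have hvm : Measurable v :=
    hulC.continuousOn.measurable_piecewise continuousOn_const hDo.measurableSet
  have hvM : ∀ x, ‖v x‖ ≤ M := fun x => by
    by_cases hx : x ∈ D
    · rw [hvD x hx, ← norm_iteratedFDeriv_zero (𝕜 := ℝ)]
      exact hM 0 (by norm_num) x hx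
    · rw [hv, piecewise_eq_of_notMem _ _ _ hx]
      simpa using hM0
  have hveq : ∀ x ∈ D, v =ᶠ[nhds x] ul := fun x hx => by
    filter_upwards [hDo.mem_nhds hx] with y hy using hvD y hy
  have hvC : ContDiffOn ℝ 4 v D := hulC.congr hvD
  have hvit : ∀ k ≤ 4, ∀ x ∈ D, ‖iteratedFDeriv ℝ k v x‖ ≤ M := fun k hk x hx => by
    rw [((hveq x hx).iteratedFDeriv ℝ k).eq_of_nhds]
    exact hM k hk x hx
  have hvL : MemLp v 2 (volume.restrict D) :=
    MemLp.of_bound hvm.aestronglyMeasurable M (Filter.Eventually.of_forall hvM)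
  obtain ⟨hunL, -⟩ := hun
  set w := hunL.aestronglyMeasurable.mk un with hw
  have hwm : Measurable w := hunL.aestronglyMeasurable.stronglyMeasurable_mk.measurable
  have hwu : un =ᵐ[volume.restrict D] w := hunL.aestronglyMeasurable.ae_eq_mk
  have hwL : MemLp w 2 (volume.restrict D) := (memLp_congr_ae hwu).1 hunL
  have hvu : ul =ᵐ[volume.restrict D] v := by
    filter_upwards [ae_restrict_mem hDo.measurableSet] with x hx using (hvD x hx).symm
  -- The Poincaré inequality asks for vanishing at every point of `Z`, whereas the constraint holds
  -- almost everywhere.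
  set e : E d → E d := Zᶜ.indicator (w - v) with he
  have hem : Measurable e := (hwm.sub hvm).indicator hZ.compl
  have heL : MemLp e 2 (volume.restrict D) := (hwL.sub hvL).indicator hZ.compl
  have hewv : e =ᵐ[volume.restrict D] w - v := by
    have hZ' := ae_restrict_of_ae (s := D) ((ae_restrict_iff' hZ).1 hunZ)
    filter_upwards [hZ', hwu, hvu] with x hx hxw hxv
    by_cases hxZ : x ∈ Z
    · rw [he, indicator_of_notMem (by simpa using hxZ), Pi.sub_apply, ← hxw, ← hxv, hx hxZ,
        sub_self]
    · rw [he, indicator_of_mem (by simpa using hxZ)]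
  have heu : (un - ul) =ᵐ[volume.restrict D] e := by
    filter_upwards [hewv, hwu, hvu] with x h1 h2 h3
    rw [h1, Pi.sub_apply, Pi.sub_apply, h2, h3]
  have hLe : ∀ᵐ x ∂(volume.restrict D), lpsOperator lam mu Ω δ γ e x =
      lpsOperator lam mu Ω δ γ un x - lpsOperator lam mu Ω δ γ v x ∧
      lpsOperator lam mu Ω δ γ ul x = lpsOperator lam mu Ω δ γ v x := by
    filter_upwards [lpsOperator_congr (γ := γ) (lam := lam) (mu := mu) hewv,
      K.lpsOperator_sub hd hδ lam mu hwm hvm hwL hvL,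
      lpsOperator_congr (γ := γ) (lam := lam) (mu := mu) hwu,
      lpsOperator_congr (γ := γ) (lam := lam) (mu := mu) hvu] with x h1 h2 h3 h4
    rw [h1, h2, Pi.sub_apply, h3]
    exact ⟨rfl, h4⟩
  have hnorm : lpsNorm Ω δ γ (un - ul) = lpsNorm Ω δ γ e := by
    rw [K.lpsNorm_eq, K.lpsNorm_eq, pairEnergy_congr heu]
  rw [hnorm, mul_assoc (√_ / _)]
  have hres : ∀ᵐ x ∂(volume.restrict D), ⟪-lpsOperator lam mu Ω δ γ e x, e x⟫ ≤
      Ω.indicator (fun x => (2 * d ^ 2 * |lam - mu| + 2 * d * (d + 2) * |mu|) * M * δ ^ 2 *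
        ‖e x‖) x := by
    have hΩ' := ae_restrict_of_ae (s := D) ((ae_restrict_iff' hΩ).1 heq)
    have hY' := ae_restrict_of_ae (s := D) ((ae_restrict_iff' hY).1 hunY)
    filter_upwards [hLe, hΩ', hY', ae_restrict_mem hDo.measurableSet] with x hLx hxΩ hxY hxD
    -- In `Ω` the residual is the consistency error. On the layer the product vanishes, through the
    -- operator on `Y` and through `e` on `Z`.
    by_cases hx : x ∈ Ω
    · rw [indicator_of_mem hx]
      refine (real_inner_le_norm _ _).trans (mul_le_mul_of_nonneg_right ?_ (norm_nonneg _))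
      have h1 := K.norm_lpsOperator_sub_le hd hδ hvm hvM hvC hvit (ball_subset_fullDomain hx hδ)
        lam mu
      rw [← navierOperator_eq hDo hvC hxD] at h1
      have h2 : navierOperator lam mu v x = navierOperator lam mu ul x := by
        rw [navierOperator_eq hDo hvC hxD, navierOperator_eq hDo hulC hxD,
          (hveq x hxD).fderiv.fderiv_eq]
      have h3 : lpsOperator lam mu Ω δ γ un x = navierOperator lam mu ul x :=
        neg_injective ((hxΩ hx).trans (hul x hxD).symm)
      rw [hLx.1, neg_sub, h3, ← h2]
      exact h1
    · rw [indicator_of_notMem hx]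
      rcases hZY (hxD.resolve_left hx) with hxY' | hxZ
      · rw [hLx.1, hxY hxY', hLx.2, sub_self, neg_zero, inner_zero_left]
      · rw [he, indicator_of_notMem (by simpa using hxZ), inner_zero_right]
  exact K.lpsNorm_le_of_residual hd hδ hmu hlam hΩ hem heL hC (by positivity)
    (hP e hem fun x hx => indicator_of_notMem (by simpa using hx) _) hres

end Estimate

end LPS

end

/-! ### The two coupling strategies. -/

theorem theorem4p2 (d : ℕ) (hd : 1 ≤ d) (hd3 : d ≤ 3) (Ω : Set (LPS.E d))
    (hΩo : IsOpen Ω) (hΩc : IsConnected Ω) (hΩb : Bornology.IsBounded Ω)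
    (hΩL : LPS.HasLipschitzBoundary Ω)
    (lam mu : ℝ) (hmu : 0 < mu) (hlam : 0 < d * lam + 2 * mu)
    (δ₀ : ℝ) (hδ₀ : 0 < δ₀)
    (γ : ℝ → ℝ → ℝ) (hγ : ∀ δ ∈ Set.Ioc 0 δ₀, LPS.IsKernel d δ (γ δ))
    (Ωloc Ωnloc : ℝ → Set (LPS.E d))
    (hpart : ∀ δ ∈ Set.Ioc 0 δ₀, LPS.IsInteractionPartition Ω δ (Ωloc δ) (Ωnloc δ))
    (s w v ul : ℝ → LPS.E d → LPS.E d)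
    (hul : ∀ δ ∈ Set.Ioc 0 δ₀,
      LPS.IsNavierSolution lam mu Ω δ (Ωloc δ) (Ωnloc δ) (s δ) (w δ) (v δ) (ul δ))
    (hC4 : ∃ M : ℝ, ∀ δ ∈ Set.Ioc 0 δ₀, ∀ k ≤ 4, ∀ x ∈ LPS.fullDomain Ω δ,
      ‖iteratedFDeriv ℝ k (ul δ) x‖ ≤ M)
    (hcompat : ∀ δ ∈ Set.Ioc 0 δ₀,
      ∀ᵐ x ∂(MeasureTheory.volume.restrict (Ωnloc δ)), v δ x = ul δ x) :
    (∀ un : ℝ → LPS.E d → LPS.E d,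
      (∀ δ ∈ Set.Ioc 0 δ₀,
        LPS.IsDtDSolution lam mu Ω δ (γ δ) (Ωloc δ) (Ωnloc δ) (s δ) (v δ) (ul δ) (un δ)) →
      ∃ C : ℝ, ∀ δ ∈ Set.Ioc 0 δ₀,
        LPS.lpsNorm Ω δ (γ δ) (un δ - ul δ) ≤ ENNReal.ofReal (C * δ ^ 2)) ∧
    ((∃ p ∈ frontier Ω, ∃ r : ℝ, 0 < r ∧ ∀ δ ∈ Set.Ioc 0 δ₀,
        Metric.ball p r ∩ LPS.interactionDomain Ω δ ⊆ Ωnloc δ) →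
      ∀ un : ℝ → LPS.E d → LPS.E d,
      (∀ δ ∈ Set.Ioc 0 δ₀,
        LPS.IsDtNSolution lam mu Ω δ (γ δ) (Ωloc δ) (Ωnloc δ) (s δ) (v δ) (ul δ) (un δ)) →
      ∃ C : ℝ, ∃ δ₁ ∈ Set.Ioc 0 δ₀, ∀ δ ∈ Set.Ioc 0 δ₁,
        LPS.lpsNorm Ω δ (γ δ) (un δ - ul δ) ≤ ENNReal.ofReal (C * δ ^ 2)) := by
  obtain ⟨M, hM⟩ := hC4
  have hfin : ∀ δ ∈ Set.Ioc 0 δ₀,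
      IsFiniteMeasure (volume.restrict (LPS.fullDomain Ω δ)) := fun δ hδ => by
    refine ⟨?_⟩
    rw [Measure.restrict_apply_univ, LPS.fullDomain_eq_thickening hδ.1]
    exact hΩb.thickening.measure_lt_top
  refine ⟨fun un hun => ?_, ?_⟩
  · obtain ⟨C, hC, hP⟩ := LPS.poincareOn_of_vanishing_layer hd hΩo hΩb δ₀ hδ₀
    refine ⟨√(volume.real Ω * (C + 1)) / min ((d : ℝ) * (d + 2) * mu) (d * (d * lam + 2 * mu)) *
      ((2 * d ^ 2 * |lam - mu| + 2 * d * (d + 2) * |mu|) * M),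
      fun δ hδ => ?_⟩
    have := hfin δ hδ
    have hpt := hpart δ hδ
    have hsol := hun δ hδ
    -- Dirichlet data on both parts: the error vanishes on the whole layer, so no flux condition is
    -- needed.
    refine (hγ δ hδ).lpsNorm_sub_le hd hδ.1 hmu hlam hΩo.measurableSet hΩc.nonempty
      (hul δ hδ).contDiffOn (hul δ hδ).equation (hM δ hδ) hsol.mem hsol.equation
      (Z := LPS.interactionDomain Ω δ) (Y := ∅)
      (by rw [← hpt.union_eq]; exact hpt.measurable_loc.union hpt.measurable_nloc)
      MeasurableSet.empty subset_union_right ?_ (by simp) hC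
      fun e he hez => hP δ hδ (γ δ) (hγ δ hδ) e he hez
    rw [← hpt.union_eq, ae_restrict_union_iff]
    refine ⟨hsol.constraint_loc, ?_⟩
    filter_upwards [hsol.constraint_nloc, hcompat δ hδ] with x h1 h2 using h1.trans h2
  · rintro ⟨p, hp, r, hr, hsub⟩ un hun
    obtain ⟨δ₁, hδ₁, C, hC, hP⟩ := LPS.exists_poincareOn_of_vanishing hΩo hΩc hΩb hΩL hp hr
    refine ⟨√(volume.real Ω * (C + 1)) / min ((d : ℝ) * (d + 2) * mu) (d * (d * lam + 2 * mu)) *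
      ((2 * d ^ 2 * |lam - mu| + 2 * d * (d + 2) * |mu|) * M),
      min δ₀ δ₁, ⟨lt_min hδ₀ hδ₁, min_le_left _ _⟩, fun δ hδ' => ?_⟩
    have hδ : δ ∈ Set.Ioc 0 δ₀ := ⟨hδ'.1, hδ'.2.trans (min_le_left _ _)⟩
    have := hfin δ hδ
    have hpt := hpart δ hδ
    have hsol := hun δ hδ
    -- Here `Z` is the nonlocal part and `Y` the local one; the error vanishes on the layer near
    -- `p`.
    refine (hγ δ hδ).lpsNorm_sub_le hd hδ.1 hmu hlam hΩo.measurableSet hΩc.nonempty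
      (hul δ hδ).contDiffOn (hul δ hδ).equation (hM δ hδ) hsol.mem hsol.equation
      hpt.measurable_nloc hpt.measurable_loc hpt.union_eq.ge ?_ ?_ hC
      fun e he hez => hP δ ⟨hδ.1, hδ'.2.trans (min_le_right _ _)⟩ (γ δ) (hγ δ hδ) e he
        fun x hx => hez x (hsub δ hδ hx)
    · filter_upwards [hsol.constraint_nloc, hcompat δ hδ] with x h1 h2 using h1.trans h2
    · filter_upwards [hsol.constraint_loc] with x hx using neg_injective hx
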